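/- Let $a=A^2$, $\{n\}=a^n-a^{-n}$, $[n]=\{n\}/\{1\}$, $\{n\}!=\{1\}\cdots\{n\}$, $[n]!=[1]\cdots[n]$. Let $\mathcal B=\mathbb Z[A^{\pm1}][z]$ be the Kauffman bracket skein module of the solid torus ($z^n$ is $n$ parallel copies of the core; a crossing resolves as $A\cdot(\text{one smoothing})+A^{-1}\cdot(\text{the other})$, a contractible loop equals $-a-a^{-1}$), let $\mathcal B^{ev}$ be the submodule generated by the even powers of $z$, let $t:\mathcal B\to\mathcal B$ be the map induced by a full right handed twist of the solid torus, let $\langle\,,\rangle$ be the $\mathbb Z[A^{\pm1}]$-valued bilinear form on $\mathcal B$ given by cabling the zero-framed Hopf link and taking the Kauffman bracket in $S^3$ (normalized to be $1$ on the empty link), and put $\langle x\rangle=\langle x,1\rangle$. Let $$R_n=\prod_{i=0}^{n-1}(z-\lambda_{2i}),\qquad \lambda_i=-a^{i+1}-a^{-i-1}.$$ Formal series $\sum_{n\ge0}c_nR_n$ with coefficients in the fraction field of $\mathbb Z[A^{\pm1}]$ are multiplied by means of the expansions $R_nR_m=\sum_kC_{n,m}^kR_k$, where $C_{n,m}^k=0$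 if $n>k$ or $m>k$. Conjugation is $\overline A=A^{-1}$, $\overline z=z$. There is exactly one series $\omega=\sum_n c_nR_n$ such that $\langle\omega,x\rangle=\langle t(x)\rangle$ for all $x\in\mathcal B^{ev}$ (for each such $x$ the left hand side is a finite sum). It is invertible, its inverse is its conjugate $\overline\omega$, and if $\omega^p=\sum_nc_{n,p}R_n$ and $c'_{n,p}=\{n\}!\,c_{n,p}$ for $p\in\mathbb Z$, then: 1. For all $p\ge1$ and $n\ge0$, $$c'_{n,p}=(-1)^na^{n(n+3)/2}\sum_{\substack{k=(k_1,\dots,k_p)\\ k_i\ge0,\ \sum k_i=n}}a^{\varphi(k)}\frac{[n]!}{[k_1]!\cdots[k_p]!},\qquad \varphi(k)=\sum_{i=1}^{p-1}r_i(r_{i-1}+r_i+2),\quad r_i=k_{i+1}+\dots+k_p.$$ 2. For all $p\in\mathbb Z$ and $n\ge0$, $c'_{n,-p}=(-1)^n\,\overline{c'_{n,p}}$. 3. For all $p\in\mathbb Z$ and $n\ge0$, $c'_{n,p}\in\mathbb Z[A^{\pm1}]$. -/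

import Mathlib

noncomputable section

namespace Skein

/-! ### Scalars -/

/-- `ℤ[A^{±1}]`; the monomial `A ^ k` is `LaurentPolynomial.T k`. -/
abbrev Scalar : Type := LaurentPolynomial ℤ

/-- The skein module `𝓑 = ℤ[A^{±1}][z]` of the solid torus: `z = Polynomial.X` is the core,
`z ^ n` stands for `n` parallel copies of it. -/
abbrev SkeinModule : Type := Polynomial Scalar

/-- The field of fractions of `ℤ[A^{±1}]`. -/
abbrev Frac : Type := FractionRing Scalar

/-- The value `-A^2 - A^{-2}` of a contractible loop. -/
def delta : Scalar := -LaurentPolynomial.T 2 - LaurentPolynomial.T (-2)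

/-! ### The Kauffman bracket of a closed braid diagram in the annulus

A crossingless diagram is a list of layers drawn on `n` parallel strands (numbered from `0`) which
run once around the annulus. The layer `none` is the identity, the layer `some i` is the hook `≍` on
the strands `i`, `i + 1`: a cap joining its two lower ends and a cup joining its two upper ends. -/

/-- The elementary arcs of the annular closure of the layers `s`. The point `(l, j)` is the position
of the strand `j` at the level `l`; layer `l` lies between the levels `l` and `l + 1`, and the last
level is glued to the level `0`. -/
inductive Arc (n : ℕ) (s : List (Option ℕ)) :
    Fin (s.length + 1) × Fin n → Fin (s.length + 1) × Fin n → Prop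
  | through (l : Fin s.length) (j : Fin n)
      (h : ∀ i, s.get l = some i → j.val ≠ i ∧ j.val ≠ i + 1) : Arc n s (l.castSucc, j) (l.succ, j)
  | cap (l : Fin s.length) (j j' : Fin n) (h : s.get l = some j.val) (hj : j'.val = j.val + 1) :
      Arc n s (l.castSucc, j) (l.castSucc, j')
  | cup (l : Fin s.length) (j j' : Fin n) (h : s.get l = some j.val) (hj : j'.val = j.val + 1) :
      Arc n s (l.succ, j) (l.succ, j')
  | closing (j : Fin n) : Arc n s (Fin.last s.length, j) (0, j)

/-- The closed curves of a crossingless diagram in the annulus. -/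
abbrev Loop (n : ℕ) (s : List (Option ℕ)) : Type := Quot (Arc n s)

/-- A simple closed curve in the annulus is essential iff it meets the radial segment at the
level `0` an odd number of times. -/
def IsEssential {n : ℕ} {s : List (Option ℕ)} (q : Loop n s) : Prop :=
  Odd (Nat.card {j : Fin n // Quot.mk (Arc n s) (0, j) = q})

/-- The class of a crossingless diagram in the skein module of the annulus: a contractible curve
contributes `-A^2 - A^{-2}`, an essential one contributes `z`. -/
def loopValue (n : ℕ) (s : List (Option ℕ)) : SkeinModule :=
  Polynomial.C delta ^ Nat.card {q : Loop n s // ¬ IsEssential q} *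
    Polynomial.X ^ Nat.card {q : Loop n s // IsEssential q}

/-- A crossing of the strands `i`, `i + 1` of a braid diagram: `(i, true)` is resolved by the
Kauffman relation into `A · identity + A^{-1} · hook`, and `(i, false)`, the opposite crossing, into
`A^{-1} · identity + A · hook`. -/
abbrev Crossing : Type := ℕ × Bool

/-- The bracket of the annular closure of the layers `s` followed by the crossings `w`. -/
def resolve (n : ℕ) : List Crossing → List (Option ℕ) → SkeinModule
  | [], s => loopValue n s
  | (i, true) :: w, s =>
      Polynomial.C (LaurentPolynomial.T 1) * resolve n w (s ++ [none]) +
        Polynomial.C (LaurentPolynomial.T (-1)) * resolve n w (s ++ [some i])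
  | (i, false) :: w, s =>
      Polynomial.C (LaurentPolynomial.T (-1)) * resolve n w (s ++ [none]) +
        Polynomial.C (LaurentPolynomial.T 1) * resolve n w (s ++ [some i])

/-- The class, in the skein module of the solid torus, of the closure of a braid diagram on `n`
strands, with the blackboard framing. -/
def annularBracket (n : ℕ) (w : List Crossing) : SkeinModule := resolve n w []

/-- The Kauffman bracket in `S^3` of the closure of a braid diagram: every loop is contractible. -/
def planarBracket (n : ℕ) (w : List Crossing) : Scalar := (annularBracket n w).eval delta

/-- The right handed full twist `(σ_o σ_{o+1} ⋯ σ_{o+n-2})^n` of the `n` strands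
`o, …, o + n - 1`. -/
def fullTwist (o n : ℕ) : List Crossing :=
  (List.replicate n ((List.range (n - 1)).map fun i => (o + i, true))).flatten

/-- The inverse braid diagram. -/
def inverseBraid (w : List Crossing) : List Crossing := (w.map fun c => (c.1, !c.2)).reverse

/-! ### The twist map and the Hopf pairing -/

/-- The twist map `t`. A full right handed twist of the solid torus turns `n` parallel bands into the
closure of the full twist on `n` strands, where each band also receives one full twist itself; a full
twist of a band is the factor `-A^3`. -/
def twist : SkeinModule →ₗ[Scalar] SkeinModule :=
  (Polynomial.basisMonomials Scalar).constr Scalar fun n =>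
    Polynomial.C ((-LaurentPolynomial.T 3) ^ n) * annularBracket n (fullTwist 0 n)

/-- The bracket of the zero-framed Hopf link with one component replaced by `m` and the other
by `n` parallel copies. As a closed braid: the two cables make a full twist together, and the full
twist of each cable in itself is undone, so that strands of the same cable have linking number `0`,
strands of different cables are linked once, and no component crosses itself. -/
def hopfBracket (m n : ℕ) : Scalar :=
  planarBracket (m + n)
    (fullTwist 0 (m + n) ++ inverseBraid (fullTwist 0 m) ++ inverseBraid (fullTwist m n))

/-- The bilinear form `⟨x, y⟩` given by cabling the zero-framed Hopf link. -/
def pairing (x y : SkeinModule) : Scalar :=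
  x.sum fun m c => y.sum fun n d => c * d * hopfBracket m n

/-- `⟨x⟩ = ⟨x, 1⟩`. -/
def bracket (x : SkeinModule) : Scalar := pairing x 1

/-- The even part of `𝓑`, generated by the even powers of `z`. -/
def evenPart : Submodule Scalar SkeinModule :=
  Submodule.span Scalar (Set.range fun k : ℕ => (Polynomial.X ^ (2 * k) : SkeinModule))

/-! ### The polynomials `R_n` and power series in them -/

/-- `λ_i = -a^{i+1} - a^{-i-1}` with `a = A^2`. -/
def lam (i : ℕ) : Scalar :=
  -LaurentPolynomial.T (2 * ((i : ℤ) + 1)) - LaurentPolynomial.T (-(2 * ((i : ℤ) + 1)))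

/-- `R_n = ∏_{i<n} (z - λ_{2i})`. -/
def R (n : ℕ) : SkeinModule :=
  ∏ i ∈ Finset.range n, (Polynomial.X - Polynomial.C (lam (2 * i)))

theorem R_monic (n : ℕ) : (R n).Monic :=
  Polynomial.monic_prod_of_monic _ _ fun _ _ => Polynomial.monic_X_sub_C _

theorem R_degree (n : ℕ) : (R n).degree = n := by
  rw [R, Polynomial.degree_prod]
  simp

/-- The `R_n` as a sequence of polynomials with `deg R_n = n`. -/
def RSequence : Polynomial.Sequence Scalar where
  elems' := R
  degree_eq' := R_degree

/-- The basis `(R_n)` of `𝓑`. -/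
def RBasis : Module.Basis ℕ Scalar SkeinModule :=
  RSequence.basis fun i => by
    have h : (RSequence i).leadingCoeff = 1 := R_monic i
    rw [h]
    exact isUnit_one

/-- The coefficients in `R_n R_m = ∑_k C_{n,m}^k R_k`. -/
def structConst (n m k : ℕ) : Scalar := RBasis.repr (R n * R m) k

/-- A formal series `∑_n c_n R_n` with coefficients in the field of fractions, given by `n ↦ c_n`. -/
def Series : Type := ℕ → Frac

/-- The product of series. It is a finite sum in each degree, since `C_{n,m}^k = 0` when `n > k`
or `m > k`. -/
def Series.mul (c d : Series) : Series := fun k =>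
  ∑ n ∈ Finset.range (k + 1), ∑ m ∈ Finset.range (k + 1),
    c n * d m * algebraMap Scalar Frac (structConst n m k)

/-- The series `1 = R_0`. -/
def Series.one : Series := fun n => if n = 0 then 1 else 0

/-- Natural powers of a series. -/
def Series.pow (c : Series) : ℕ → Series
  | 0 => Series.one
  | p + 1 => (Series.pow c p).mul c

/-- Conjugation `A ↦ A^{-1}` on the field of fractions. -/
def conj : Frac ≃+* Frac :=
  IsFractionRing.ringEquivOfRingEquiv (LaurentPolynomial.invert (R := ℤ)).toRingEquiv

/-- Conjugation of series (`A ↦ A^{-1}`, `z ↦ z`; the `R_n` are invariant). -/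
def Series.conj (c : Series) : Series := fun n => Skein.conj (c n)

/-- `ω = ∑ c_n R_n` satisfies `⟨ω, x⟩ = ⟨t(x)⟩` for every even `x`; the left hand side is a finite
sum. -/
def IsOmega (c : Series) : Prop :=
  ∀ x ∈ evenPart,
    (Function.support fun n => c n * algebraMap Scalar Frac (pairing (R n) x)).Finite ∧
      ∑ᶠ n, c n * algebraMap Scalar Frac (pairing (R n) x) =
        algebraMap Scalar Frac (bracket (twist x))

/-- The integral powers of `ω`, where `ω^{-1}` is the conjugate `ω_-` of `ω = ω_+`. -/
def omegaPow (ω : Series) : ℤ → Series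
  | Int.ofNat p => ω.pow p
  | Int.negSucc p => ω.conj.pow (p + 1)

/-! ### Quantum integers -/

/-- `a = A^2` in the field of fractions. -/
def a : Frac := algebraMap Scalar Frac (LaurentPolynomial.T 2)

/-- `{n} = a^n - a^{-n}`. -/
def brace (n : ℕ) : Frac := a ^ (n : ℤ) - a ^ (-(n : ℤ))

/-- `{n}! = {1}{2}⋯{n}`. -/
def braceFactorial (n : ℕ) : Frac := ∏ i ∈ Finset.range n, brace (i + 1)

/-- `[n] = (a^n - a^{-n}) / (a - a^{-1})`. -/
def qInt (n : ℕ) : Frac := (a ^ (n : ℤ) - a ^ (-(n : ℤ))) / (a - a⁻¹)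

/-- `[n]! = [1][2]⋯[n]`. -/
def qFactorial (n : ℕ) : Frac := ∏ i ∈ Finset.range n, qInt (i + 1)

/-- The quantum multinomial `[n]! / ([k_1]! ⋯ [k_p]!)`. -/
def qMultinomial (n : ℕ) {p : ℕ} (k : Fin p → ℕ) : Frac :=
  qFactorial n / ∏ i, qFactorial (k i)

/-- `r_i = k_{i+1} + ⋯ + k_p`; the entry `k_{j+1}` is `k j` with `j : Fin p`. -/
def tailSum {p : ℕ} (k : Fin p → ℕ) (i : ℕ) : ℕ := ∑ j : Fin p, if i ≤ j.val then k j else 0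

/-- `φ(k) = ∑_{i=1}^{p-1} r_i (r_{i-1} + r_i + 2)`. -/
def phi {p : ℕ} (k : Fin p → ℕ) : ℕ :=
  ∑ i ∈ Finset.Ico 1 p, tailSum k i * (tailSum k (i - 1) + tailSum k i + 2)

/-- The normalized coefficient `c'_{n,p} = {n}! c_{n,p}` of `ω^p = ∑ c_{n,p} R_n`. -/
def normCoeff (ω : Series) (n : ℕ) (p : ℤ) : Frac := braceFactorial n * omegaPow ω p n

end Skein

end

noncomputable section

namespace Skein

/-! ### State sums

The loops of a crossingless diagram are counted by colourings: there are five colours, one of which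
carries the sign `-1`, so that a contractible loop contributes `5` and an essential one `3`. -/

/-! In the basis of closures $S_n$ of the Jones-Wenzl idempotents (`cheb`), both operations in the
definition of $\omega$ are diagonal. A full twist multiplies $S_n$ by $(-1)^nA^{n^2+2n}$
(`twist_cheb`), and encircling $S_n$ by $x(z)$ multiplies its bracket by $x(\lambda_n)$
(`pairing_cheb`). The $S_{2k}$ span $\mathcal B^{ev}$, so the condition on $\omega$ says exactly
that $\omega$ takes the value $a^{2k(k+1)}$ at $z=\lambda_{2k}$ for all $k$ (`isOmega_iff`).

Since $R_n(\lambda_{2k})=0$ for $n>k$ and $R_k(\lambda_{2k})\neq0$, evaluation at these points is a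
triangular system. It identifies series with functions of $k$, compatibly with products and
conjugation. Uniqueness, $\overline\omega=\omega^{-1}$ and the symmetry $p\mapsto-p$ are then
immediate, because $\omega^p$ is the series with values $a^{2pk(k+1)}$.

The explicit formula comes from expanding $\omega R_m$ in the $R_{m+j}$ (`sum_stepCoeff`), which is
a $q$-binomial summation (`sum_sumTerm`). Iterating $p$ times gives a sum over chains $n=r_0\ge
r_1\ge\dots\ge r_{p-1}$, that is, over tuples $k$ (`powCoeff_succ`). Integrality follows because the
multinomials are products of $q$-binomials, which are Laurent polynomials by Pascal's rule.

The topological input is a trace on a Temperley-Lieb algebra, built from the combinatorial bracket.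
The relations between numbers of loops are not proved by following curves. A state sum with signed
colours gives $5^c3^e$ for $c$ contractible and $e$ essential loops. It is also the trace of a
product of transfer matrices, so unique factorization turns matrix identities into identities of
loop counts. The annular trace then satisfies the Temperley-Lieb relations (`isTL_hook`), and
centrality of the full twist and the Jones-Wenzl recursion give the two diagonalizations. -/

/-- Colours of the state sum. -/
abbrev Colour : Type := Fin 5

/-- The sign of a colour. -/
def colourSign (c : Colour) : ℤ := if c = 0 then -1 else 1

theorem colourSign_mul_self (c : Colour) : colourSign c * colourSign c = 1 := by
  unfold colourSign; split_ifs <;> norm_num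

theorem sum_colourSign_pow (k : ℕ) :
    ∑ c, colourSign c ^ k = if Odd k then 3 else 5 := by
  rcases Nat.even_or_odd k with hk | hk
  · have : ¬ Odd k := Nat.not_odd_iff_even.2 hk
    simp [colourSign, hk.neg_one_pow, this]
  · simp [Fin.sum_univ_five, colourSign, hk.neg_one_pow, hk]

/-- The colourings `σ`, `τ` of the lower and upper ends of a layer extend to its arcs. -/
def LayerRel {n : ℕ} (o : Option ℕ) (σ τ : Fin n → Colour) : Prop :=
  (∀ j : Fin n, (∀ i, o = some i → j.val ≠ i ∧ j.val ≠ i + 1) → σ j = τ j) ∧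
  (∀ j j' : Fin n, o = some j.val → j'.val = j.val + 1 → σ j = σ j') ∧
  (∀ j j' : Fin n, o = some j.val → j'.val = j.val + 1 → τ j = τ j')

/-- The sign of a colouring of the strands. -/
def stateSign {n : ℕ} (σ : Fin n → Colour) : ℤ := ∏ j, colourSign (σ j)

open Classical in
/-- The transfer matrix of a layer. -/
def layerMatrix (n : ℕ) (o : Option ℕ) : Matrix (Fin n → Colour) (Fin n → Colour) ℤ :=
  Matrix.of fun σ τ => if LayerRel o σ τ then 1 else 0

/-- The state sum of the annular closure of the layers `s`. -/
def stateSum (n : ℕ) (s : List (Option ℕ)) : ℤ :=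
  (Matrix.diagonal stateSign * (s.map (layerMatrix n)).prod).trace

/-- An entry of a product of matrices is a sum over paths; a path here is a choice of state at every
level of the diagram. -/
theorem prod_map_apply {S : Type*} [Fintype S] [DecidableEq S] {B : Type*}
    (M : B → Matrix S S ℤ) (s : List B) (σ τ : S) :
    (s.map M).prod σ τ = ∑ f : Fin (s.length + 1) → S,
      if f 0 = σ ∧ f (Fin.last _) = τ then
        ∏ l : Fin s.length, M (s.get l) (f l.castSucc) (f l.succ) else 0 := by
  induction s generalizing σ with
  | nil =>
    refine Eq.trans ?_ (Equiv.sum_comp (Equiv.funUnique (Fin 1) S).symm _)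
    rw [Finset.sum_eq_single σ]
    · simp [Matrix.one_apply]
    · intro b _ hb; simp [hb]
    · simp
  | cons b s ih =>
    rw [List.map_cons, List.prod_cons, Matrix.mul_apply]
    simp only [ih]
    refine Eq.trans ?_ (Equiv.sum_comp (Fin.consEquiv (fun _ : Fin (s.length + 2) => S)) _)
    symm
    rw [Fintype.sum_prod_type, Finset.sum_eq_single σ]
    · symm
      simp only [Finset.mul_sum]
      rw [Finset.sum_comm]
      refine Finset.sum_congr rfl fun f _ => ?_
      rw [Finset.sum_eq_single (f 0)]
      · have h1 : (Fin.cons σ f : Fin (s.length + 2) → S) (Fin.last (s.length + 1))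
            = f (Fin.last _) := by rw [← Fin.succ_last, Fin.cons_succ]
        simp only [Fin.consEquiv, Equiv.coe_fn_mk, List.length_cons, Fin.cons_zero, h1, true_and]
        split_ifs
        · rw [Fin.prod_univ_succ]; rfl
        · simp
      · intro c _ hc; simp [hc.symm]
      · simp
    · intro c _ hc; simp [Fin.consEquiv, hc]
    · simp

open Classical in
theorem stateSum_eq_sum (n : ℕ) (s : List (Option ℕ)) :
    stateSum n s = ∑ f : Fin (s.length + 1) → Fin n → Colour,
      if f (Fin.last _) = f 0 ∧ ∀ l : Fin s.length, LayerRel (s.get l) (f l.castSucc) (f l.succ)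
      then stateSign (f 0) else 0 := by
  simp only [stateSum, Matrix.trace, Matrix.diag, Matrix.diagonal_mul, prod_map_apply,
    Finset.mul_sum]
  rw [Finset.sum_comm]
  refine Finset.sum_congr rfl fun f _ => ?_
  rw [Finset.sum_eq_single (f 0)]
  · simp only [layerMatrix, Matrix.of_apply, true_and]
    by_cases h : f (Fin.last _) = f 0
    · simp only [h, if_true, true_and]
      by_cases h2 : ∀ l : Fin s.length, LayerRel (s.get l) (f l.castSucc) (f l.succ)
      · simp only [h2, if_true, implies_true, Finset.prod_const_one, mul_one]
      · rw [if_neg h2]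
        push Not at h2
        obtain ⟨l, hl⟩ := h2
        rw [Finset.prod_eq_zero (Finset.mem_univ l) (if_neg hl), mul_zero]
    · simp [h]
  · intro c _ hc; simp [hc.symm]
  · simp

theorem respects_arc_iff (n : ℕ) (s : List (Option ℕ))
    (f : Fin (s.length + 1) → Fin n → Colour) :
    (∀ x y, Arc n s x y → f x.1 x.2 = f y.1 y.2) ↔
      f (Fin.last _) = f 0 ∧ ∀ l : Fin s.length, LayerRel (s.get l) (f l.castSucc) (f l.succ) := by
  constructor
  · intro h
    refine ⟨funext fun j => h _ _ (Arc.closing j), fun l => ⟨fun j hj => ?_, ?_, ?_⟩⟩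
    · exact h _ _ (Arc.through l j hj)
    · exact fun j j' h1 h2 => h _ _ (Arc.cap l j j' h1 h2)
    · exact fun j j' h1 h2 => h _ _ (Arc.cup l j j' h1 h2)
  · rintro ⟨h1, h2⟩ x y hxy
    cases hxy with
    | through l j h => exact (h2 l).1 j h
    | cap l j j' h hj => exact (h2 l).2.1 j j' h hj
    | cup l j j' h hj => exact (h2 l).2.2 j j' h hj
    | closing j => exact congrFun h1 j

instance (n : ℕ) (s : List (Option ℕ)) : Finite (Loop n s) :=
  Quot.finite _

/-- The state sum counts the loops. -/
theorem stateSum_eq (n : ℕ) (s : List (Option ℕ)) :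
    stateSum n s = 5 ^ Nat.card {q : Loop n s // ¬ IsEssential q} *
      3 ^ Nat.card {q : Loop n s // IsEssential q} := by
  classical
  have := Fintype.ofFinite (Loop n s)
  rw [stateSum_eq_sum]
  simp only [← respects_arc_iff]
  have key : (∑ f : Fin (s.length + 1) → Fin n → Colour,
      if ∀ x y, Arc n s x y → f x.1 x.2 = f y.1 y.2 then stateSign (f 0) else 0) =
      ∑ g : Loop n s → Colour, ∏ q, colourSign (g q) ^
        Nat.card {j : Fin n // Quot.mk (Arc n s) (0, j) = q} := by
    rw [← Finset.sum_filter]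
    symm
    -- A colouring of the points that is constant along arcs is the same thing as a colouring of the
    -- loops.
    refine Finset.sum_bij' (fun g _ l j => g (Quot.mk _ (l, j)))
      (fun f hf => Quot.lift (fun x => f x.1 x.2) (Finset.mem_filter.1 hf).2) ?_ ?_ ?_ ?_ ?_
    · intro g _
      simp only [Finset.mem_filter, Finset.mem_univ, true_and]
      exact fun x y h => congrArg g (Quot.sound h)
    · intros; exact Finset.mem_univ _
    · intro g _; funext q; induction q using Quot.ind; rfl
    · intro f _; rfl
    · intro g _
      unfold stateSign
      rw [← Finset.prod_fiberwise_of_maps_to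
        (g := fun j : Fin n => Quot.mk (Arc n s) (0, j)) (t := Finset.univ) (by simp)]
      refine Finset.prod_congr rfl fun q _ => ?_
      rw [Finset.prod_congr rfl (g := fun _ => colourSign (g q)), Finset.prod_const,
        Nat.card_eq_fintype_card, Fintype.card_subtype]
      intro j hj
      exact congrArg (fun q => colourSign (g q)) (Finset.mem_filter.1 hj).2
  -- The sum over colourings of the loops factors into one sum per loop, which is 3 or 5 according
  -- to the parity of its intersection with level 0.
  rw [key, ← Fintype.piFinset_univ, ← Finset.prod_univ_sum (fun _ => Finset.univ)
    (fun (q : Loop n s) c => colourSign c ^ Nat.card {j : Fin n // Quot.mk (Arc n s) (0, j) = q})]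
  simp only [sum_colourSign_pow]
  rw [Finset.prod_ite, Finset.prod_const, Finset.prod_const, mul_comm]
  simp only [Nat.card_eq_fintype_card, Fintype.card_subtype, IsEssential]

/-- This is why there are five colours with one negative sign: $4+1$ and $4-1$ are distinct primes,
so the state sum determines both loop counts. -/
theorem five_pow_mul_three_pow_inj {a b c d : ℕ} (h : (5 : ℤ) ^ a * 3 ^ b = 5 ^ c * 3 ^ d) :
    a = c ∧ b = d := by
  have h' : 5 ^ a * 3 ^ b = 5 ^ c * 3 ^ d := by exact_mod_cast h
  have h1 := congrArg (fun n => n.factorization 5) h'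
  have h2 := congrArg (fun n => n.factorization 3) h'
  simp only [Nat.factorization_mul (pow_ne_zero _ (by norm_num : (5:ℕ) ≠ 0))
    (pow_ne_zero _ (by norm_num : (3:ℕ) ≠ 0)), Nat.factorization_pow,
    Nat.Prime.factorization (by norm_num : Nat.Prime 5),
    Nat.Prime.factorization (by norm_num : Nat.Prime 3)] at h1 h2
  simp at h1 h2
  exact ⟨h1, h2⟩

/-- The bridge from integers to the skein module: a factor 5 in the state sum can only come from a
contractible loop, worth `delta`. -/
theorem loopValue_eq_of_stateSum {n n' : ℕ} {s s' : List (Option ℕ)} (k : ℕ)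
    (h : stateSum n s = 5 ^ k * stateSum n' s') :
    loopValue n s = Polynomial.C delta ^ k * loopValue n' s' := by
  rw [stateSum_eq, stateSum_eq, ← mul_assoc, ← pow_add] at h
  obtain ⟨h1, h2⟩ := five_pow_mul_three_pow_inj h
  rw [loopValue, loopValue, h1, h2]; ring

theorem loopValue_mul_of_stateSum {m n l : ℕ} {s s' u : List (Option ℕ)}
    (h : stateSum l u = stateSum m s * stateSum n s') :
    loopValue l u = loopValue m s * loopValue n s' := by
  have h' : stateSum l u = _ := stateSum_eq l u
  rw [h, stateSum_eq, stateSum_eq, mul_mul_mul_comm, ← pow_add, ← pow_add] at h'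
  obtain ⟨h1, h2⟩ := five_pow_mul_three_pow_inj h'
  rw [loopValue, loopValue, loopValue, ← h1, ← h2]; ring

end Skein
end

noncomputable section

namespace Skein

/-! ### Transfer matrices of hooks satisfy the Temperley-Lieb relations with loop value 5 -/

theorem layerMatrix_none (n : ℕ) : layerMatrix n none = 1 := by
  ext σ τ
  have : LayerRel none σ τ ↔ σ = τ := by
    simp [LayerRel, funext_iff]
  simp [layerMatrix, this, Matrix.one_apply]

theorem layerRel_some_iff {n i : ℕ} (hi : i + 1 < n) (σ τ : Fin n → Colour) :
    LayerRel (some i) σ τ ↔ σ ⟨i, by omega⟩ = σ ⟨i + 1, hi⟩ ∧ τ ⟨i, by omega⟩ = τ ⟨i + 1, hi⟩ ∧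
      ∀ j, j ≠ ⟨i, by omega⟩ → j ≠ ⟨i + 1, hi⟩ → σ j = τ j := by
  constructor
  · rintro ⟨h1, h2, h3⟩
    refine ⟨h2 _ _ rfl rfl, h3 _ _ rfl rfl, fun j hj hj' => h1 j ?_⟩
    rintro k ⟨⟩
    exact ⟨fun h => hj (Fin.ext h), fun h => hj' (Fin.ext h)⟩
  · rintro ⟨h1, h2, h3⟩
    refine ⟨fun j hj => h3 j ?_ ?_, ?_, ?_⟩
    · rintro rfl; exact (hj i rfl).1 rfl
    · rintro rfl; exact (hj i rfl).2 rfl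
    all_goals
      rintro ⟨j, hj⟩ ⟨j', hj'⟩ h h'
      simp only [Option.some.injEq] at h h'
      subst h h'
      assumption

section hook

variable {J : Type*} [DecidableEq J]

/-- Recolour the two points `p`, `q` by `c`. -/
def recolour (p q : J) (c : Colour) (σ : J → Colour) : J → Colour :=
  Function.update (Function.update σ p c) q c

theorem recolour_apply (p q : J) (c : Colour) (σ : J → Colour) (j : J) :
    recolour p q c σ j = if j = p ∨ j = q then c else σ j := by
  unfold recolour
  simp only [Function.update_apply]
  split_ifs <;> simp_all

/-- The hook joining the points `p` and `q`, as an operator on functions of states. -/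
def hookOp (p q : J) (g : (J → Colour) → ℤ) (σ : J → Colour) : ℤ :=
  if σ p = σ q then ∑ c, g (recolour p q c σ) else 0

theorem recolour_recolour (p q : J) (c d : Colour) (σ : J → Colour) :
    recolour p q d (recolour p q c σ) = recolour p q d σ := by
  ext j; simp only [recolour_apply]; split_ifs <;> rfl

theorem hookOp_hookOp (p q : J) (g : (J → Colour) → ℤ) :
    hookOp p q (hookOp p q g) = 5 • hookOp p q g := by
  ext σ
  simp only [hookOp, recolour_recolour, recolour_apply, Pi.smul_apply, true_or, or_true, if_true]
  split_ifs <;> simp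

/-- The middle hook forces the new colour of `p`, `q` to be that of `r`, and the last hook forces
`q`, `r` back to it. Both inner sums collapse to one term and `r` keeps its colour. -/
theorem hookOp_braid {p q r : J} (hpq : p ≠ q) (hpr : p ≠ r) (hqr : q ≠ r)
    (g : (J → Colour) → ℤ) :
    hookOp p q (hookOp q r (hookOp p q g)) = hookOp p q g := by
  ext σ
  simp only [hookOp, recolour_apply]
  by_cases h : σ p = σ q
  swap
  · simp [h]
  simp only [h, if_true, hpq, hpr, hpr.symm, hqr.symm, true_or, or_true, or_self, if_false]
  rw [Finset.sum_eq_single (σ r)]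
  · rw [if_pos rfl, Finset.sum_eq_single (σ r)]
    · rw [if_pos rfl]
      refine Finset.sum_congr rfl fun c _ => congrArg g ?_
      ext j; simp only [recolour_apply]; split_ifs <;> simp_all
    · intro d _ hd; exact if_neg hd.symm
    · simp
  · intro c _ hc; exact if_neg hc
  · simp

theorem hookOp_braid' {p q r : J} (hpq : p ≠ q) (hpr : p ≠ r) (hqr : q ≠ r)
    (g : (J → Colour) → ℤ) :
    hookOp q r (hookOp p q (hookOp q r g)) = hookOp q r g := by
  ext σ
  simp only [hookOp, recolour_apply]
  by_cases h : σ q = σ r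
  swap
  · simp [h]
  simp only [h, if_true, hpq, hpr, hpq.symm, hpr.symm, hqr.symm, true_or, or_true, or_self,
    if_false]
  rw [Finset.sum_eq_single (σ p)]
  · rw [if_pos rfl, Finset.sum_eq_single (σ p)]
    · rw [if_pos rfl]
      refine Finset.sum_congr rfl fun c _ => congrArg g ?_
      ext j; simp only [recolour_apply]; split_ifs <;> simp_all
    · intro d _ hd; exact if_neg hd
    · simp
  · intro c _ hc; exact if_neg hc.symm
  · simp

theorem hookOp_comm {p q r s : J} (hpr : p ≠ r) (hps : p ≠ s) (hqr : q ≠ r) (hqs : q ≠ s)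
    (g : (J → Colour) → ℤ) :
    hookOp p q (hookOp r s g) = hookOp r s (hookOp p q g) := by
  ext σ
  simp only [hookOp, recolour_apply, hpr, hps, hqr, hqs, hpr.symm, hps.symm, hqr.symm, hqs.symm,
    or_self, if_false]
  split_ifs
  · rw [Finset.sum_comm]
    refine Finset.sum_congr rfl fun c _ => Finset.sum_congr rfl fun d _ => congrArg g ?_
    ext j; simp only [recolour_apply]; split_ifs with h1 h2 <;> try rfl
    rcases h1 with rfl | rfl <;> rcases h2 with rfl | rfl <;> simp_all
  all_goals simp

end hook

theorem layerMatrix_mulVec {n i : ℕ} (hi : i + 1 < n) (g : (Fin n → Colour) → ℤ) :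
    Matrix.mulVec (layerMatrix n (some i)) g = hookOp ⟨i, by omega⟩ ⟨i + 1, hi⟩ g := by
  classical
  ext σ
  simp only [Matrix.mulVec, dotProduct, layerMatrix, Matrix.of_apply, layerRel_some_iff hi,
    hookOp, ite_mul, one_mul, zero_mul]
  split_ifs with h
  · rw [← Finset.sum_filter]
    symm
    refine Finset.sum_bij' (fun c _ => recolour ⟨i, by omega⟩ ⟨i + 1, hi⟩ c σ)
      (fun τ _ => τ ⟨i, by omega⟩) ?_ ?_ ?_ ?_ ?_
    · intro c _
      simp only [Finset.mem_filter, Finset.mem_univ, true_and, recolour_apply]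
      refine ⟨h, by simp, fun j hj hj' => by simp [hj, hj']⟩
    · intros; exact Finset.mem_univ _
    · intro c _; simp [recolour_apply]
    · intro τ hτ
      obtain ⟨h1, h2, h3⟩ := (Finset.mem_filter.1 hτ).2
      ext j
      rw [recolour_apply]
      split_ifs with hj
      · rcases hj with rfl | rfl
        · rfl
        · rw [h2]
      · push Not at hj
        rw [h3 j hj.1 hj.2]
    · intros; rfl
  · exact Finset.sum_eq_zero fun τ _ => if_neg fun hτ => h hτ.1

theorem matrix_eq_of_mulVec {S : Type*} [Fintype S] [DecidableEq S] {M N : Matrix S S ℤ}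
    (h : ∀ g, M.mulVec g = N.mulVec g) : M = N :=
  Matrix.toLin'.injective (LinearMap.ext h)

theorem layerMatrix_mul_self {n i : ℕ} (hi : i + 1 < n) :
    layerMatrix n (some i) * layerMatrix n (some i) = (5 : ℤ) • layerMatrix n (some i) := by
  refine matrix_eq_of_mulVec fun g => ?_
  rw [← Matrix.mulVec_mulVec, Matrix.smul_mulVec]
  simp only [layerMatrix_mulVec hi, hookOp_hookOp]
  simp

theorem layerMatrix_braid {n i : ℕ} (hi : i + 2 < n) :
    layerMatrix n (some i) * layerMatrix n (some (i + 1)) * layerMatrix n (some i) =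
      layerMatrix n (some i) := by
  refine matrix_eq_of_mulVec fun g => ?_
  rw [← Matrix.mulVec_mulVec, ← Matrix.mulVec_mulVec]
  simp only [layerMatrix_mulVec (show i + 1 < n by omega), layerMatrix_mulVec (show i + 1 + 1 < n by omega)]
  apply hookOp_braid <;> simp only [ne_eq, Fin.ext_iff] <;> omega

theorem layerMatrix_braid' {n i : ℕ} (hi : i + 2 < n) :
    layerMatrix n (some (i + 1)) * layerMatrix n (some i) * layerMatrix n (some (i + 1)) =
      layerMatrix n (some (i + 1)) := by
  refine matrix_eq_of_mulVec fun g => ?_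
  rw [← Matrix.mulVec_mulVec, ← Matrix.mulVec_mulVec]
  simp only [layerMatrix_mulVec (show i + 1 < n by omega), layerMatrix_mulVec (show i + 1 + 1 < n by omega)]
  apply hookOp_braid' <;> simp only [ne_eq, Fin.ext_iff] <;> omega

theorem layerMatrix_comm {n i j : ℕ} (hij : i + 2 ≤ j) (hj : j + 1 < n) :
    layerMatrix n (some i) * layerMatrix n (some j) =
      layerMatrix n (some j) * layerMatrix n (some i) := by
  refine matrix_eq_of_mulVec fun g => ?_
  rw [← Matrix.mulVec_mulVec, ← Matrix.mulVec_mulVec]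
  simp only [layerMatrix_mulVec (show i + 1 < n by omega), layerMatrix_mulVec hj]
  apply hookOp_comm <;> simp only [ne_eq, Fin.ext_iff] <;> omega

/-- A hook replaces one pair of equal colours by another, and either pair has sign a square, hence
1. -/
theorem stateSign_eq {n i : ℕ} (hi : i + 1 < n) {σ τ : Fin n → Colour}
    (h : LayerRel (some i) σ τ) : stateSign σ = stateSign τ := by
  obtain ⟨h1, h2, h3⟩ := (layerRel_some_iff hi σ τ).1 h
  have h4 : stateSign σ * stateSign τ = 1 := by
    unfold stateSign
    rw [← Finset.prod_mul_distrib, Finset.prod_eq_mul (⟨i, by omega⟩ : Fin n) ⟨i + 1, hi⟩]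
    · rw [h1, h2, mul_mul_mul_comm, colourSign_mul_self, colourSign_mul_self, one_mul]
    · simp [Fin.ext_iff]
    · rintro j - ⟨hj, hj'⟩
      rw [h3 j hj hj', colourSign_mul_self]
    · simp
    · simp
  have h5 : stateSign τ * stateSign τ = 1 := by
    unfold stateSign
    rw [← Finset.prod_mul_distrib]
    exact Finset.prod_eq_one fun j _ => colourSign_mul_self _
  calc stateSign σ = stateSign σ * (stateSign τ * stateSign τ) := by rw [h5, mul_one]
    _ = stateSign τ := by rw [← mul_assoc, h4, one_mul]

theorem diagonal_stateSign_commute {n i : ℕ} (hi : i + 1 < n) :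
    Commute (Matrix.diagonal stateSign) (layerMatrix n (some i)) := by
  ext σ τ
  rw [Matrix.diagonal_mul, Matrix.mul_diagonal, layerMatrix, Matrix.of_apply]
  split_ifs with h
  · rw [stateSign_eq hi h, mul_comm]
  · simp

/-! ### State sums of words in the hooks -/

/-- The transfer matrix of a word in the hooks. -/
def hookProd (n : ℕ) (w : List ℕ) : Matrix (Fin n → Colour) (Fin n → Colour) ℤ :=
  (w.map fun i => layerMatrix n (some i)).prod

theorem stateSum_map_some (n : ℕ) (w : List ℕ) :
    stateSum n (w.map some) = (Matrix.diagonal stateSign * hookProd n w).trace := by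
  simp only [stateSum, hookProd, List.map_map]
  rfl

theorem hookProd_append (n : ℕ) (u v : List ℕ) :
    hookProd n (u ++ v) = hookProd n u * hookProd n v := by
  simp [hookProd]

theorem stateSum_reduceOption (n : ℕ) (s : List (Option ℕ)) :
    stateSum n (s.reduceOption.map some) = stateSum n s := by
  have : ((s.reduceOption.map some).map (layerMatrix n)).prod = (s.map (layerMatrix n)).prod := by
    induction s with
    | nil => rfl
    | cons o s ih =>
      cases o with
      | none => simpa [layerMatrix_none] using ih
      | some i =>
        simp only [List.reduceOption_cons_of_some, List.map_cons, List.prod_cons, ih]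
  rw [stateSum, this, stateSum]

theorem commute_hookProd {n : ℕ} {w : List ℕ} (hw : ∀ i ∈ w, i + 1 < n) :
    Commute (Matrix.diagonal stateSign) (hookProd n w) := by
  refine Commute.list_prod_right _ _ fun M hM => ?_
  obtain ⟨i, hi, rfl⟩ := List.mem_map.1 hM
  exact diagonal_stateSign_commute (hw i hi)

/-- Rotating the annulus moves the level at which signs are counted. This is harmless because the
sign matrix commutes with every hook; the rest is cyclicity of the matrix trace. -/
theorem stateSum_cyclic {n : ℕ} {u v : List ℕ} (hu : ∀ i ∈ u, i + 1 < n) :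
    stateSum n ((u ++ v).map some) = stateSum n ((v ++ u).map some) := by
  rw [stateSum_map_some, stateSum_map_some, hookProd_append, hookProd_append, ← mul_assoc,
    (commute_hookProd hu).eq, mul_assoc, Matrix.trace_mul_comm, mul_assoc]

/-! ### Juxtaposition -/

open scoped Kronecker

theorem append_eq_append_iff' {m n : ℕ} {α : Type*} {σ σ' : Fin m → α} {τ τ' : Fin n → α} :
    Fin.append σ τ = Fin.append σ' τ' ↔ σ = σ' ∧ τ = τ' := by
  rw [← Prod.mk_inj]
  exact (Fin.appendEquiv m n).injective.eq_iff (a := (σ, τ)) (b := (σ', τ'))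

theorem layerRel_append_left {m n i : ℕ} (hi : i + 1 < m) (σ σ' : Fin m → Colour)
    (τ τ' : Fin n → Colour) :
    LayerRel (some i) (Fin.append σ τ) (Fin.append σ' τ') ↔ LayerRel (some i) σ σ' ∧ τ = τ' := by
  rw [layerRel_some_iff (by omega : i + 1 < m + n), layerRel_some_iff hi]
  have e1 : (⟨i, by omega⟩ : Fin (m + n)) = Fin.castAdd n ⟨i, by omega⟩ := rfl
  have e2 : (⟨i + 1, by omega⟩ : Fin (m + n)) = Fin.castAdd n ⟨i + 1, by omega⟩ := rfl
  rw [e1, e2]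
  simp only [Fin.append_left]
  constructor
  · rintro ⟨h1, h2, h3⟩
    refine ⟨⟨h1, h2, fun j hj hj' => ?_⟩, funext fun j => ?_⟩
    · simpa using h3 (Fin.castAdd n j) (by simpa [Fin.ext_iff] using hj) (by simpa [Fin.ext_iff, add_assoc] using hj')
    · simpa using h3 (Fin.natAdd m j) (by simp [Fin.ext_iff]; omega) (by simp [Fin.ext_iff]; omega)
  · rintro ⟨⟨h1, h2, h3⟩, rfl⟩
    refine ⟨h1, h2, fun j => ?_⟩
    refine Fin.addCases (fun j hj hj' => ?_) (fun j _ _ => by simp) j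
    simpa using h3 j (by simpa [Fin.ext_iff] using hj) (by simpa [Fin.ext_iff, add_assoc] using hj')

theorem layerRel_append_right {m n i : ℕ} (hi : i + 1 < n) (σ σ' : Fin m → Colour)
    (τ τ' : Fin n → Colour) :
    LayerRel (some (m + i)) (Fin.append σ τ) (Fin.append σ' τ') ↔
      σ = σ' ∧ LayerRel (some i) τ τ' := by
  rw [layerRel_some_iff (by omega : m + i + 1 < m + n), layerRel_some_iff hi]
  have e1 : (⟨m + i, by omega⟩ : Fin (m + n)) = Fin.natAdd m ⟨i, by omega⟩ := rfl
  have e2 : (⟨m + i + 1, by omega⟩ : Fin (m + n)) = Fin.natAdd m ⟨i + 1, by omega⟩ := rfl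
  rw [e1, e2]
  simp only [Fin.append_right]
  constructor
  · rintro ⟨h1, h2, h3⟩
    refine ⟨funext fun j => ?_, ⟨h1, h2, fun j hj hj' => ?_⟩⟩
    · simpa using h3 (Fin.castAdd n j) (by simp [Fin.ext_iff]; omega) (by simp [Fin.ext_iff]; omega)
    · simpa using h3 (Fin.natAdd m j) (by simpa [Fin.ext_iff] using hj) (by simpa [Fin.ext_iff, add_assoc] using hj')
  · rintro ⟨rfl, h1, h2, h3⟩
    refine ⟨h1, h2, fun j => ?_⟩
    refine Fin.addCases (fun j _ _ => by simp) (fun j hj hj' => ?_) j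
    simpa using h3 j (by simpa [Fin.ext_iff] using hj) (by simpa [Fin.ext_iff, add_assoc] using hj')

/-- Splitting the strands into the first `m` and the last `n`. -/
def splitStates (m n : ℕ) :
    Matrix (Fin (m + n) → Colour) (Fin (m + n) → Colour) ℤ ≃ₐ[ℤ]
      Matrix ((Fin m → Colour) × (Fin n → Colour)) ((Fin m → Colour) × (Fin n → Colour)) ℤ :=
  Matrix.reindexAlgEquiv ℤ ℤ (Fin.appendEquiv m n).symm

theorem splitStates_apply (m n : ℕ) (M : Matrix (Fin (m + n) → Colour) (Fin (m + n) → Colour) ℤ)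
    (x y) : splitStates m n M x y = M (Fin.append x.1 x.2) (Fin.append y.1 y.2) := rfl

theorem trace_splitStates (m n : ℕ)
    (M : Matrix (Fin (m + n) → Colour) (Fin (m + n) → Colour) ℤ) :
    (splitStates m n M).trace = M.trace :=
  Equiv.sum_comp (Fin.appendEquiv m n) fun x => M x x

theorem splitStates_diagonal (m n : ℕ) :
    splitStates m n (Matrix.diagonal stateSign) =
      Matrix.diagonal stateSign ⊗ₖ Matrix.diagonal stateSign := by
  rw [Matrix.diagonal_kronecker_diagonal]
  ext x y
  rw [splitStates_apply, Matrix.diagonal_apply, Matrix.diagonal_apply]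
  simp only [append_eq_append_iff', Prod.ext_iff]
  split_ifs
  · simp [stateSign, Fin.prod_univ_add]
  · rfl

theorem splitStates_left {m n i : ℕ} (hi : i + 1 < m) :
    splitStates m n (layerMatrix (m + n) (some i)) =
      layerMatrix m (some i) ⊗ₖ (1 : Matrix (Fin n → Colour) (Fin n → Colour) ℤ) := by
  classical
  ext x y
  rw [splitStates_apply]
  rw [show (layerMatrix m (some i) ⊗ₖ (1 : Matrix (Fin n → Colour) (Fin n → Colour) ℤ)) x y =
    layerMatrix m (some i) x.1 y.1 * (1 : Matrix (Fin n → Colour) (Fin n → Colour) ℤ) x.2 y.2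
    from rfl]
  simp only [layerMatrix, Matrix.of_apply, layerRel_append_left hi, Matrix.one_apply]
  split_ifs <;> simp_all

theorem splitStates_right {m n i : ℕ} (hi : i + 1 < n) :
    splitStates m n (layerMatrix (m + n) (some (m + i))) =
      (1 : Matrix (Fin m → Colour) (Fin m → Colour) ℤ) ⊗ₖ layerMatrix n (some i) := by
  classical
  ext x y
  rw [splitStates_apply]
  rw [show ((1 : Matrix (Fin m → Colour) (Fin m → Colour) ℤ) ⊗ₖ layerMatrix n (some i)) x y =
    (1 : Matrix (Fin m → Colour) (Fin m → Colour) ℤ) x.1 y.1 * layerMatrix n (some i) x.2 y.2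
    from rfl]
  simp only [layerMatrix, Matrix.of_apply, layerRel_append_right hi, Matrix.one_apply]
  split_ifs <;> simp_all

theorem splitStates_hookProd_left {m n : ℕ} {w : List ℕ} (hw : ∀ i ∈ w, i + 1 < m) :
    splitStates m n (hookProd (m + n) w) = hookProd m w ⊗ₖ 1 := by
  induction w with
  | nil => simp [hookProd]
  | cons i w ih =>
    have e : ∀ k, hookProd k (i :: w) = layerMatrix k (some i) * hookProd k w := fun k => by
      simp [hookProd]
    rw [e, e, map_mul, splitStates_left (hw i (by simp)), ih fun j hj => hw j (by simp [hj]),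
      ← Matrix.mul_kronecker_mul, one_mul]

theorem splitStates_hookProd_right {m n : ℕ} {w : List ℕ} (hw : ∀ i ∈ w, i + 1 < n) :
    splitStates m n (hookProd (m + n) (w.map (m + ·))) = 1 ⊗ₖ hookProd n w := by
  induction w with
  | nil => simp [hookProd]
  | cons i w ih =>
    have e : ∀ k j (v : List ℕ), hookProd k (j :: v) = layerMatrix k (some j) * hookProd k v :=
      fun k j v => by simp [hookProd]
    rw [List.map_cons, e, e, map_mul, splitStates_right (hw i (by simp)),
      ih fun j hj => hw j (by simp [hj]), ← Matrix.mul_kronecker_mul, one_mul]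

/-- Hooks on disjoint groups of strands act on different tensor factors, the sign is multiplicative,
and the trace of a Kronecker product is the product of traces. -/
theorem stateSum_juxtapose {m n : ℕ} {u v : List ℕ} (hu : ∀ i ∈ u, i + 1 < m)
    (hv : ∀ i ∈ v, i + 1 < n) :
    stateSum (m + n) ((u ++ v.map (m + ·)).map some) =
      stateSum m (u.map some) * stateSum n (v.map some) := by
  rw [stateSum_map_some, stateSum_map_some, stateSum_map_some, ← trace_splitStates, map_mul,
    hookProd_append, map_mul, splitStates_diagonal, splitStates_hookProd_left hu,
    splitStates_hookProd_right hv, ← Matrix.mul_kronecker_mul, ← Matrix.mul_kronecker_mul,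
    one_mul, mul_one, Matrix.trace_kronecker]

/-! ### Relations between the values of crossingless diagrams -/

theorem loopValue_reduceOption (n : ℕ) (s : List (Option ℕ)) :
    loopValue n s = loopValue n (s.reduceOption.map some) := by
  simpa using loopValue_eq_of_stateSum 0 (by rw [stateSum_reduceOption]; simp)

theorem loopValue_cyclic {n : ℕ} {u v : List ℕ} (hu : ∀ i ∈ u, i + 1 < n) :
    loopValue n ((u ++ v).map some) = loopValue n ((v ++ u).map some) := by
  refine (loopValue_eq_of_stateSum 0 ?_).trans (by rw [pow_zero, one_mul])
  rw [stateSum_cyclic hu, pow_zero, one_mul]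

theorem loopValue_juxtapose {m n : ℕ} {u v : List ℕ} (hu : ∀ i ∈ u, i + 1 < m)
    (hv : ∀ i ∈ v, i + 1 < n) :
    loopValue (m + n) ((u ++ v.map (m + ·)).map some) =
      loopValue m (u.map some) * loopValue n (v.map some) :=
  loopValue_mul_of_stateSum (stateSum_juxtapose hu hv)

theorem loopValue_congr {n : ℕ} {x y : List ℕ} (h : hookProd n x = hookProd n y) (u v : List ℕ) :
    loopValue n ((u ++ x ++ v).map some) = loopValue n ((u ++ y ++ v).map some) := by
  have : stateSum n ((u ++ x ++ v).map some) = stateSum n ((u ++ y ++ v).map some) := by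
    simp only [stateSum_map_some, hookProd_append, h]
  refine (loopValue_eq_of_stateSum 0 ?_).trans (by rw [pow_zero, one_mul])
  rw [this, pow_zero, one_mul]

theorem loopValue_hook_hook {n i : ℕ} (hi : i + 1 < n) (u v : List ℕ) :
    loopValue n ((u ++ [i, i] ++ v).map some) =
      Polynomial.C delta * loopValue n ((u ++ [i] ++ v).map some) := by
  have : hookProd n [i, i] = (5 : ℤ) • hookProd n [i] := by
    simp [hookProd, layerMatrix_mul_self hi]
  have : stateSum n ((u ++ [i, i] ++ v).map some) = 5 * stateSum n ((u ++ [i] ++ v).map some) := by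
    rw [stateSum_map_some, stateSum_map_some, hookProd_append, hookProd_append, this,
      hookProd_append, hookProd_append]
    simp only [Matrix.mul_smul, Matrix.smul_mul, Matrix.trace_smul, smul_eq_mul]
  refine (loopValue_eq_of_stateSum 1 ?_).trans (by rw [pow_one])
  rw [this, pow_one]

theorem loopValue_braid {n i j : ℕ} (hi : i + 1 < n) (hj : j + 1 < n) (h : j = i + 1 ∨ i = j + 1)
    (u v : List ℕ) :
    loopValue n ((u ++ [i, j, i] ++ v).map some) = loopValue n ((u ++ [i] ++ v).map some) := by
  refine loopValue_congr ?_ u v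
  rcases h with rfl | rfl
  · simpa [hookProd, mul_assoc] using layerMatrix_braid hj
  · simpa [hookProd, mul_assoc] using layerMatrix_braid' hi

theorem loopValue_comm {n i j : ℕ} (hi : i + 1 < n) (hj : j + 1 < n) (h : i + 2 ≤ j ∨ j + 2 ≤ i)
    (u v : List ℕ) :
    loopValue n ((u ++ [i, j] ++ v).map some) = loopValue n ((u ++ [j, i] ++ v).map some) := by
  refine loopValue_congr ?_ u v
  rcases h with h | h
  · simpa [hookProd] using layerMatrix_comm h hj
  · simpa [hookProd] using (layerMatrix_comm h hi).symm

theorem loopValue_zero : loopValue 0 [] = 1 := by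
  have : IsEmpty (Loop 0 []) := ⟨fun q => by
    induction q using Quot.ind with
    | mk x => exact x.2.elim0⟩
  simp [loopValue]

theorem loopValue_of_stateSum_eq {n k l : ℕ} {s : List (Option ℕ)}
    (h : stateSum n s = 5 ^ k * 3 ^ l) : loopValue n s = Polynomial.C delta ^ k * Polynomial.X ^ l := by
  rw [stateSum_eq] at h
  obtain ⟨h1, h2⟩ := five_pow_mul_three_pow_inj h
  rw [loopValue, h1, h2]

theorem loopValue_one : loopValue 1 [] = Polynomial.X := by
  have : stateSum 1 [] = 5 ^ 0 * 3 ^ 1 := by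
    simp only [stateSum, List.map_nil, List.prod_nil, mul_one, Matrix.trace_diagonal]
    rw [← (Equiv.funUnique (Fin 1) Colour).symm.sum_comp]
    simpa [stateSign] using sum_colourSign_pow 1
  simpa using loopValue_of_stateSum_eq this

theorem loopValue_hook : loopValue 2 [some 0] = Polynomial.C delta := by
  have : stateSum 2 [some 0] = 5 ^ 1 * 3 ^ 0 := by
    have h := stateSum_map_some 2 [0]
    rw [List.map_cons, List.map_nil] at h
    rw [h, hookProd, List.map_cons, List.map_nil, List.prod_cons, List.prod_nil, mul_one]
    simp only [Matrix.trace, Matrix.diag, Matrix.diagonal_mul]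
    rw [← (finTwoArrowEquiv Colour).symm.sum_comp, Fintype.sum_prod_type]
    simp only [layerMatrix, Matrix.of_apply, layerRel_some_iff (show 0 + 1 < 2 by norm_num)]
    simp [stateSign, finTwoArrowEquiv, colourSign_mul_self]
  simpa using loopValue_of_stateSum_eq this

end Skein
end

noncomputable section

namespace Skein

/-! ### The Temperley-Lieb algebra -/

section TemperleyLieb

variable {K : Type*} [Field K] {T : Type*} [Ring T] [Algebra K T]

/-- The relations of the Temperley-Lieb algebra. -/
structure IsTL (δ : K) (e : ℕ → T) : Prop where
  sq : ∀ i, e i * e i = δ • e i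
  up : ∀ i, e i * e (i + 1) * e i = e i
  down : ∀ i, e (i + 1) * e i * e (i + 1) = e (i + 1)
  comm : ∀ i j, i + 2 ≤ j → Commute (e i) (e j)

/-- The subalgebra on the first `n` strands. -/
def tlSub (K : Type*) [Field K] {T : Type*} [Ring T] [Algebra K T] (e : ℕ → T) (n : ℕ) :
    Subalgebra K T :=
  Algebra.adjoin K {x | ∃ i, i + 1 < n ∧ e i = x}

variable {δ : K} {e : ℕ → T}

theorem mem_tlSub {n i : ℕ} (h : i + 1 < n) : e i ∈ tlSub K e n :=
  Algebra.subset_adjoin ⟨i, h, rfl⟩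

theorem tlSub_mono {m n : ℕ} (h : m ≤ n) : tlSub K e m ≤ tlSub K e n :=
  Algebra.adjoin_mono fun _ ⟨i, hi, hx⟩ => ⟨i, hi.trans_le h, hx⟩

theorem commute_of_mem_tlSub {n : ℕ} {x y : T} (hx : x ∈ tlSub K e n)
    (h : ∀ i, i + 1 < n → Commute y (e i)) : Commute y x := by
  induction hx using Algebra.adjoin_induction with
  | mem x hx => obtain ⟨i, hi, rfl⟩ := hx; exact h i hi
  | algebraMap r => exact (Algebra.commutes r y).symm
  | add x y _ _ hx hy => exact hx.add_right hy
  | mul x y _ _ hx hy => exact hx.mul_right hy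

theorem IsTL.commute_hook (h : IsTL δ e) {n : ℕ} {x : T} (hx : x ∈ tlSub K e n) {i : ℕ}
    (hi : n ≤ i) : Commute (e i) x :=
  commute_of_mem_tlSub hx fun j hj => (h.comm j i (by omega)).symm

/-- A nested hook of a subalgebra collapses. -/
theorem IsTL.hook_mul_hook_aux (h : IsTL δ e) (m : ℕ) :
    (∀ x ∈ tlSub K e (m + 1), ∃ y ∈ tlSub K e m, e m * x * e m = y * e m) ∧
    ∀ x ∈ tlSub K e (m + 2), x ∈ Subalgebra.toSubmodule (tlSub K e (m + 1)) ⊔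
      Submodule.span K {x | ∃ u ∈ tlSub K e (m + 1), ∃ v ∈ tlSub K e (m + 1), u * e m * v = x} := by
  -- The two claims alternate in the induction: collapsing $e_mxe_m$ for $x$ on $m+1$ strands shows
  -- that words on $m+2$ strands need $e_m$ at most once.
  have step : ∀ m : ℕ, (∀ x ∈ tlSub K e (m + 1), ∃ y ∈ tlSub K e m, e m * x * e m = y * e m) →
      ∀ x ∈ tlSub K e (m + 2), x ∈ Subalgebra.toSubmodule (tlSub K e (m + 1)) ⊔
        Submodule.span K
          {x | ∃ u ∈ tlSub K e (m + 1), ∃ v ∈ tlSub K e (m + 1), u * e m * v = x} := by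
    intro m P
    set S := Subalgebra.toSubmodule (tlSub K e (m + 1)) ⊔ Submodule.span K
      {x | ∃ u ∈ tlSub K e (m + 1), ∃ v ∈ tlSub K e (m + 1), u * e m * v = x} with hS
    have hspan : ∀ u ∈ tlSub K e (m + 1), ∀ v ∈ tlSub K e (m + 1), u * e m * v ∈ S :=
      fun u hu v hv => Submodule.mem_sup_right (Submodule.subset_span ⟨u, hu, v, hv, rfl⟩)
    have hind : ∀ f : T →ₗ[K] T, (∀ x ∈ tlSub K e (m + 1), f x ∈ S) →
        (∀ u ∈ tlSub K e (m + 1), ∀ v ∈ tlSub K e (m + 1), f (u * e m * v) ∈ S) →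
        ∀ x ∈ S, f x ∈ S := by
      intro f h1 h2 x hx
      have : S ≤ S.comap f := by
        rw [hS]
        refine sup_le (fun x hx => h1 x hx) (Submodule.span_le.2 ?_)
        rintro _ ⟨u, hu, v, hv, rfl⟩
        exact h2 u hu v hv
      exact this hx
    have hmul : ∀ x ∈ tlSub K e (m + 2), ∀ y ∈ S, x * y ∈ S := by
      intro x hx
      induction hx using Algebra.adjoin_induction with
      | mem x hx =>
        obtain ⟨i, hi, rfl⟩ := hx
        rcases Nat.lt_or_ge i m with him | him
        · have hi' : e i ∈ tlSub K e (m + 1) := mem_tlSub (by omega)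
          refine hind (LinearMap.mulLeft K (e i)) (fun x hx => ?_) (fun u hu v hv => ?_)
          · exact Submodule.mem_sup_left (Subalgebra.mul_mem _ hi' hx)
          · simpa [mul_assoc] using hspan (e i * u) (mul_mem hi' hu) v hv
        · obtain rfl : i = m := by omega
          refine hind (LinearMap.mulLeft K (e i)) (fun x hx => ?_) (fun u hu v hv => ?_)
          · simpa using hspan 1 (one_mem _) x hx
          · obtain ⟨y, hy, hy'⟩ := P u hu
            have := hspan y (tlSub_mono (Nat.le_succ _) hy) v hv
            rw [← hy'] at this
            simpa [mul_assoc] using this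
      | algebraMap r => intro y hy; rw [← Algebra.smul_def]; exact S.smul_mem r hy
      | add x x' _ _ hx hx' => intro y hy; rw [add_mul]; exact S.add_mem (hx y hy) (hx' y hy)
      | mul x x' _ _ hx hx' => intro y hy; rw [mul_assoc]; exact hx _ (hx' y hy)
    intro x hx
    simpa using hmul x hx 1 (Submodule.mem_sup_left (one_mem (tlSub K e (m + 1))))
  suffices P : ∀ x ∈ tlSub K e (m + 1), ∃ y ∈ tlSub K e m, e m * x * e m = y * e m from
    ⟨P, step m P⟩
  induction m with
  | zero =>
    intro x hx
    have hx' : x ∈ (⊥ : Subalgebra K T) := by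
      have : {x : T | ∃ i, i + 1 < 0 + 1 ∧ e i = x} = ∅ := by ext; simp
      rwa [tlSub, this, Algebra.adjoin_empty] at hx
    obtain ⟨c, rfl⟩ := Algebra.mem_bot.1 hx'
    refine ⟨algebraMap K T (c * δ), Subalgebra.algebraMap_mem _ _, ?_⟩
    rw [← Algebra.commutes, mul_assoc, h.sq, ← Algebra.smul_def, ← Algebra.smul_def, smul_smul]
  -- By the spanning claim one level down, $x$ is on $m+1$ strands and commutes with $e_{m+1}$, or
  -- is $ue_mv$ with $u,v$ commuting with $e_{m+1}$. The relations $e_{m+1}^2=\delta e_{m+1}$ and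
  -- $e_{m+1}e_me_{m+1}=e_{m+1}$ finish the two cases.
  | succ m ih =>
    intro x hx
    have hx' := step m ih x hx
    have key : Subalgebra.toSubmodule (tlSub K e (m + 1)) ⊔ Submodule.span K
        {x | ∃ u ∈ tlSub K e (m + 1), ∃ v ∈ tlSub K e (m + 1), u * e m * v = x} ≤
        ((Subalgebra.toSubmodule (tlSub K e (m + 1))).map
          (LinearMap.mulRight K (e (m + 1)))).comap
          (LinearMap.mulRight K (e (m + 1)) ∘ₗ LinearMap.mulLeft K (e (m + 1))) := by
      refine sup_le (fun x hx => ?_) (Submodule.span_le.2 ?_)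
      · refine ⟨δ • x, Subalgebra.smul_mem _ hx δ, ?_⟩
        have := (h.commute_hook hx (le_refl (m + 1))).eq
        simp only [LinearMap.mulRight_apply, LinearMap.comp_apply, LinearMap.mulLeft_apply]
        rw [this, mul_assoc, h.sq, smul_mul_assoc, mul_smul_comm]
      · rintro _ ⟨u, hu, v, hv, rfl⟩
        refine ⟨u * v, Subalgebra.mul_mem _ hu hv, ?_⟩
        have h1 := (h.commute_hook hu (le_refl (m + 1))).eq
        have h2 := (h.commute_hook hv (le_refl (m + 1))).eq
        simp only [LinearMap.mulRight_apply, LinearMap.comp_apply, LinearMap.mulLeft_apply]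
        calc u * v * e (m + 1) = u * (e (m + 1) * e m * e (m + 1)) * v := by
              rw [h.down, mul_assoc, ← h2, mul_assoc]
          _ = (u * e (m + 1)) * e m * (e (m + 1) * v) := by simp only [mul_assoc]
          _ = e (m + 1) * (u * e m * v) * e (m + 1) := by
              rw [h2, ← h1]; simp only [mul_assoc]
    obtain ⟨y, hy, hy'⟩ := key hx'
    exact ⟨y, hy, hy'.symm⟩

/-- `e_m x e_m` is a multiple of `e_m` by an element on `m` strands. -/
theorem IsTL.hook_mul_hook (h : IsTL δ e) {m : ℕ} {x : T} (hx : x ∈ tlSub K e (m + 2)) :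
    ∃ y ∈ tlSub K e m, e m * x * e m = y * e m := by
  obtain ⟨P, Q⟩ := h.hook_mul_hook_aux m
  have key : Subalgebra.toSubmodule (tlSub K e (m + 1)) ⊔ Submodule.span K
      {x | ∃ u ∈ tlSub K e (m + 1), ∃ v ∈ tlSub K e (m + 1), u * e m * v = x} ≤
      ((Subalgebra.toSubmodule (tlSub K e m)).map (LinearMap.mulRight K (e m))).comap
        (LinearMap.mulRight K (e m) ∘ₗ LinearMap.mulLeft K (e m)) := by
    refine sup_le (fun x hx => ?_) (Submodule.span_le.2 ?_)
    · obtain ⟨y, hy, hy'⟩ := P x hx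
      exact ⟨y, hy, hy'.symm⟩
    · rintro _ ⟨u, hu, v, hv, rfl⟩
      obtain ⟨y, hy, hy'⟩ := P u hu
      obtain ⟨z, hz, hz'⟩ := P v hv
      refine ⟨y * z, Subalgebra.mul_mem _ hy hz, ?_⟩
      simp only [LinearMap.mulRight_apply, LinearMap.comp_apply, LinearMap.mulLeft_apply]
      calc y * z * e m = y * (e m * v * e m) := by rw [hz', mul_assoc]
        _ = (y * e m) * (v * e m) := by simp only [mul_assoc]
        _ = e m * (u * e m * v) * e m := by rw [← hy']; simp only [mul_assoc]
  obtain ⟨y, hy, hy'⟩ := key (Q x hx)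
  exact ⟨y, hy, hy'.symm⟩

/-- Up to scalars, the elements on `m + 2` strands are generated by the last hook. -/
theorem IsTL.mem_span (h : IsTL δ e) {m : ℕ} {x : T} (hx : x ∈ tlSub K e (m + 2)) :
    x ∈ Submodule.span K {(1 : T)} ⊔ Submodule.span K
      {x | ∃ u ∈ tlSub K e (m + 2), ∃ v ∈ tlSub K e (m + 2), u * e m * v = x} := by
  set I := Submodule.span K
      {x | ∃ u ∈ tlSub K e (m + 2), ∃ v ∈ tlSub K e (m + 2), u * e m * v = x} with hI
  have hl : ∀ a ∈ tlSub K e (m + 2), ∀ b ∈ tlSub K e (m + 2), ∀ y ∈ I, a * y * b ∈ I := by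
    intro a ha b hb y hy
    have : I ≤ I.comap (LinearMap.mulRight K b ∘ₗ LinearMap.mulLeft K a) := by
      conv_lhs => rw [hI]
      refine Submodule.span_le.2 ?_
      rintro _ ⟨u, hu, v, hv, rfl⟩
      refine Submodule.subset_span ⟨a * u, mul_mem ha hu, v * b, mul_mem hv hb, ?_⟩
      simp [mul_assoc]
    exact this hy
  -- Descending in $i$: $e_i=e_ie_{i+1}e_i$ puts each hook in the ideal generated by the next one.
  have he : ∀ k i, i + k = m → e i ∈ I := by
    intro k
    induction k with
    | zero =>
      intro i hi
      obtain rfl : i = m := by omega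
      exact Submodule.subset_span ⟨1, one_mem _, 1, one_mem _, by simp⟩
    | succ k ih =>
      intro i hi
      rw [← h.up i]
      exact hl _ (mem_tlSub (by omega)) _ (mem_tlSub (by omega)) _ (ih (i + 1) (by omega))
  induction hx using Algebra.adjoin_induction with
  | mem x hx =>
    obtain ⟨i, hi, rfl⟩ := hx
    exact Submodule.mem_sup_right (he (m - i) i (by omega))
  | algebraMap r =>
    rw [Algebra.algebraMap_eq_smul_one]
    exact Submodule.mem_sup_left (Submodule.smul_mem _ _ (Submodule.mem_span_singleton_self _))
  | add x y _ _ hx hy => exact Submodule.add_mem _ hx hy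
  | mul x y hx0 _ hx hy =>
    obtain ⟨a, ha, b, hb, rfl⟩ := Submodule.mem_sup.1 hy
    obtain ⟨c, rfl⟩ := Submodule.mem_span_singleton.1 ha
    rw [mul_add, mul_smul_comm, mul_one]
    refine Submodule.add_mem _ (Submodule.smul_mem _ _ hx) (Submodule.mem_sup_right ?_)
    simpa using hl x hx0 1 (one_mem _) b hb

/-! ### Braids -/

section Braids

variable {A : K}

/-- The resolution of a positive crossing. -/
def sig (A : K) (e : ℕ → T) (i : ℕ) : T := A • 1 + A⁻¹ • e i

/-- The resolution of a negative crossing. -/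
def sigInv (A : K) (e : ℕ → T) (i : ℕ) : T := A⁻¹ • 1 + A • e i

theorem sig_mem {n i : ℕ} (h : i + 1 < n) : sig A e i ∈ tlSub K e n :=
  add_mem (Subalgebra.smul_mem _ (one_mem _) _) (Subalgebra.smul_mem _ (mem_tlSub h) _)

theorem sigInv_mem {n i : ℕ} (h : i + 1 < n) : sigInv A e i ∈ tlSub K e n :=
  add_mem (Subalgebra.smul_mem _ (one_mem _) _) (Subalgebra.smul_mem _ (mem_tlSub h) _)

theorem commute_sig {x : T} {i : ℕ} (h : Commute x (e i)) : Commute x (sig A e i) :=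
  ((Commute.one_right x).smul_right A).add_right (h.smul_right _)

theorem commute_of_commute_sig (hA : A ≠ 0) {x : T} {i : ℕ} (h : Commute x (sig A e i)) :
    Commute x (e i) := by
  have : e i = A • (sig A e i - A • 1) := by
    rw [sig, add_sub_cancel_left, smul_smul, mul_inv_cancel₀ hA, one_smul]
  rw [this]
  exact (h.sub_right ((Commute.one_right x).smul_right A)).smul_right _

variable (hA : A ≠ 0) (h : IsTL (-A ^ 2 - A⁻¹ ^ 2) e)
include hA h

theorem IsTL.sig_mul_sigInv (i : ℕ) : sig A e i * sigInv A e i = 1 := by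
  simp only [sig, sigInv, mul_add, add_mul, smul_mul_smul_comm, h.sq, smul_smul, one_mul, mul_one]
  match_scalars <;> field_simp
  ring

theorem IsTL.sigInv_mul_sig (i : ℕ) : sigInv A e i * sig A e i = 1 := by
  simp only [sig, sigInv, mul_add, add_mul, smul_mul_smul_comm, h.sq, smul_smul, one_mul, mul_one]
  match_scalars <;> field_simp
  ring

/-- A curl: $A+A^{-1}\delta=-A^{-3}$. -/
theorem IsTL.hook_mul_sig (i : ℕ) : e i * sig A e i = (-A⁻¹ ^ 3) • e i := by
  simp only [sig, mul_add, mul_smul_comm, h.sq, smul_smul, mul_one]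
  match_scalars
  field_simp
  ring

/-- A cap slides under or over a strand (Reidemeister II): the terms in $e_{i+1}$ alone have total
coefficient $A^2+\delta+A^{-2}=0$. -/
theorem IsTL.hook_mul_sig_mul_sig (i : ℕ) :
    e (i + 1) * sig A e i * sig A e (i + 1) = e (i + 1) * e i := by
  simp only [sig, mul_add, add_mul, mul_smul_comm, smul_mul_assoc, h.sq, smul_smul, mul_one, h.down]
  match_scalars <;> field_simp
  ring

theorem IsTL.hook_mul_sig_mul_sig' (i : ℕ) :
    e i * sig A e (i + 1) * sig A e i = e i * e (i + 1) := by
  simp only [sig, mul_add, add_mul, mul_smul_comm, smul_mul_assoc, h.sq, smul_smul, mul_one, h.up]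
  match_scalars <;> field_simp
  ring

/-- Kauffman's argument: resolve one crossing on each side. The hook terms simplify by Reidemeister
II, and what remains agrees after expansion. -/
theorem IsTL.sig_braid (i : ℕ) :
    sig A e i * sig A e (i + 1) * sig A e i = sig A e (i + 1) * sig A e i * sig A e (i + 1) := by
  have e1 : sig A e i * sig A e (i + 1) * sig A e i =
      A • (sig A e (i + 1) * sig A e i) + A⁻¹ • (e i * e (i + 1)) := by
    rw [← h.hook_mul_sig_mul_sig' hA]
    conv_lhs => rw [mul_assoc]; enter [1]; rw [sig]
    simp only [add_mul, smul_mul_assoc, one_mul, mul_assoc]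
  have e2 : sig A e (i + 1) * sig A e i * sig A e (i + 1) =
      A • (sig A e i * sig A e (i + 1)) + A⁻¹ • (e (i + 1) * e i) := by
    rw [← h.hook_mul_sig_mul_sig hA]
    conv_lhs => rw [mul_assoc]; enter [1]; rw [sig]
    simp only [add_mul, smul_mul_assoc, one_mul, mul_assoc]
  rw [e1, e2]
  simp only [sig, mul_add, add_mul, smul_mul_smul_comm, smul_smul, one_mul, mul_one, smul_add]
  match_scalars <;> field_simp

omit hA in
theorem IsTL.sig_comm {i j : ℕ} (hij : i + 2 ≤ j) : Commute (sig A e i) (sig A e j) :=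
  commute_sig (commute_sig (h.comm i j hij).symm).symm

omit h hA

/-- The braid `σ_0 ⋯ σ_{k-1}`. -/
def cox (A : K) (e : ℕ → T) (k : ℕ) : T := ((List.range k).map (sig A e)).prod

/-- The full twist on `n` strands. -/
def ftwist (A : K) (e : ℕ → T) (n : ℕ) : T := cox A e (n - 1) ^ n

/-- The strand `n` runs around the strands `0, …, n - 1`. -/
def around (A : K) (e : ℕ → T) : ℕ → T
  | 0 => 1
  | n + 1 => sig A e n * around A e n * sig A e n

/-- The braid `σ_m σ_{m-1} ⋯ σ_{m+1-k}`. -/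
def desc (A : K) (e : ℕ → T) (m : ℕ) : ℕ → T
  | 0 => 1
  | k + 1 => desc A e m k * sig A e (m - k)

theorem cox_succ (k : ℕ) : cox A e (k + 1) = cox A e k * sig A e k := by
  simp [cox, List.range_succ]

theorem cox_mem (k : ℕ) : cox A e k ∈ tlSub K e (k + 1) := by
  refine list_prod_mem fun x hx => ?_
  obtain ⟨i, hi, rfl⟩ := List.mem_map.1 hx
  exact sig_mem (by simpa using hi)

theorem ftwist_mem (n : ℕ) : ftwist A e n ∈ tlSub K e n := by
  cases n with
  | zero => simp [ftwist, one_mem]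
  | succ n => exact pow_mem (cox_mem n) _

theorem around_mem (n : ℕ) : around A e n ∈ tlSub K e (n + 1) := by
  induction n with
  | zero => exact one_mem _
  | succ n ih =>
    exact mul_mem (mul_mem (sig_mem (by omega)) (tlSub_mono (by omega) ih)) (sig_mem (by omega))

theorem desc_succ_succ (m k : ℕ) :
    desc A e (m + 1) (k + 1) = sig A e (m + 1) * desc A e m k := by
  induction k with
  | zero => simp [desc]
  | succ k ih => rw [desc, ih, desc, mul_assoc, Nat.succ_sub_succ]

theorem around_succ (m : ℕ) :
    around A e (m + 1) = desc A e m (m + 1) * cox A e (m + 1) := by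
  induction m with
  | zero => simp [around, desc, cox]
  | succ m ih => rw [around, ih, desc_succ_succ, cox_succ (m + 1)]; simp only [mul_assoc]

include h hA

/-- Conjugation by $\sigma_0\cdots\sigma_{k-1}$ shifts the generators by one position. -/
theorem IsTL.cox_mul_sig {j k : ℕ} (hjk : j + 2 ≤ k) :
    cox A e k * sig A e j = sig A e (j + 1) * cox A e k := by
  induction k, hjk using Nat.le_induction with
  | base =>
    have hc : Commute (sig A e (j + 1)) (cox A e j) :=
      (commute_sig (h.commute_hook (cox_mem j) (le_refl _)).symm).symm
    calc cox A e (j + 2) * sig A e j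
        = cox A e j * (sig A e j * sig A e (j + 1) * sig A e j) := by
          rw [cox_succ, cox_succ]; simp only [mul_assoc]
      _ = sig A e (j + 1) * cox A e (j + 2) := by
          rw [h.sig_braid hA, cox_succ, cox_succ, ← mul_assoc, ← mul_assoc, ← hc.eq]
          simp only [mul_assoc]
  | succ k hk ih =>
    rw [cox_succ, mul_assoc, ← (h.sig_comm hk).eq, ← mul_assoc, ih, mul_assoc]

theorem IsTL.desc_mul_cox {m k : ℕ} (hk : k ≤ m) :
    desc A e m k * cox A e (m + 1) = cox A e m * desc A e m (k + 1) := by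
  induction k with
  | zero => simp [desc, cox_succ]
  | succ k ih =>
    obtain ⟨j, rfl⟩ : ∃ j, m = j + 1 + k := ⟨m - 1 - k, by omega⟩
    have := h.cox_mul_sig hA (j := j) (k := j + 1 + k + 1) (by omega)
    rw [desc, mul_assoc, Nat.add_sub_cancel, ← this, ← mul_assoc, ih (by omega), mul_assoc]
    conv_rhs => rw [desc]
    congr 3; omega

/-- Collects on the right the crossings involving the new last strand, leaving the power on one
strand fewer; for $k=m+1$ that power is the full twist on $m+1$ strands. -/
theorem IsTL.cox_succ_pow {m k : ℕ} (hk : k ≤ m + 1) :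
    cox A e (m + 1) ^ k = cox A e m ^ k * desc A e m k := by
  induction k with
  | zero => simp [desc]
  | succ k ih =>
    rw [pow_succ, ih (by omega), mul_assoc, h.desc_mul_cox hA (by omega), ← mul_assoc, ← pow_succ]

/-- The full twist on `n + 1` strands in terms of the one on `n` strands. -/
theorem IsTL.ftwist_succ (n : ℕ) : ftwist A e (n + 1) = ftwist A e n * around A e n := by
  cases n with
  | zero => simp [ftwist, around, cox]
  | succ m =>
    simp only [ftwist, Nat.add_sub_cancel]
    rw [pow_succ (cox A e (m + 1)), h.cox_succ_pow hA (le_refl _), around_succ, mul_assoc]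

/-- The encircling strand can be moved past any crossing of the strands it encircles. For crossings
away from the last encircled strand this is the inductive hypothesis; the last crossing takes two
braid relations. -/
theorem IsTL.around_commute_sig {n i : ℕ} (hi : i + 1 < n) :
    Commute (around A e n) (sig A e i) := by
  induction n with
  | zero => omega
  | succ n ih =>
    rcases Nat.lt_or_ge (i + 1) n with hin | hin
    · have h1 := h.sig_comm (A := A) (i := i) (j := n) (by omega)
      exact ((h1.mul_right (ih hin).symm).mul_right h1).symm
    · obtain rfl : n = i + 1 := by omega
      have h1 : Commute (sig A e (i + 1)) (around A e i) :=
        (commute_sig (h.commute_hook (around_mem i) (le_refl _)).symm).symm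
      have hb := h.sig_braid hA i
      set x := sig A e i
      set y := sig A e (i + 1)
      set D := around A e i
      change y * (x * D * x) * y * x = x * (y * (x * D * x) * y)
      calc y * (x * D * x) * y * x = y * x * D * (x * y * x) := by simp only [mul_assoc]
        _ = y * x * (D * y) * x * y := by rw [hb]; simp only [mul_assoc]
        _ = (y * x * y) * D * x * y := by rw [← h1.eq]; simp only [mul_assoc]
        _ = x * (y * (x * D * x) * y) := by rw [← hb]; simp only [mul_assoc]

theorem IsTL.around_commute {n : ℕ} {x : T} (hx : x ∈ tlSub K e n) : Commute (around A e n) x :=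
  commute_of_mem_tlSub hx fun _ hi => commute_of_commute_sig hA (h.around_commute_sig hA hi)

/-- The full twist is central. -/
theorem IsTL.ftwist_commute_sig {n i : ℕ} (hi : i + 1 < n) :
    Commute (ftwist A e n) (sig A e i) := by
  induction n with
  | zero => omega
  | succ n ih =>
    rcases Nat.lt_or_ge (i + 1) n with hin | hin
    · rw [h.ftwist_succ hA]
      exact ((ih hin).symm.mul_right (h.around_commute_sig hA hin).symm).symm
    · obtain rfl : n = i + 1 := by omega
      -- For the last crossing $x=\sigma_i$, split off the two last strands. With $D$ = `around A e
      -- i`, the claim reduces to $D$ commuting with $xDx$, which is `around_commute`.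
      rw [h.ftwist_succ hA, h.ftwist_succ hA, mul_assoc]
      have h1 : Commute (sig A e i) (ftwist A e i) :=
        (commute_sig (h.commute_hook (ftwist_mem i) (le_refl _)).symm).symm
      have h2 := (h.around_commute hA (around_mem (A := A) (K := K) (e := e) i)).eq
      refine (h1.mul_right ?_).symm
      rw [around] at h2 ⊢
      set x := sig A e i
      set D := around A e i
      change x * (D * (x * D * x)) = D * (x * D * x) * x
      calc x * (D * (x * D * x)) = (x * D * x * D) * x := by simp only [mul_assoc]
        _ = D * (x * D * x) * x := by rw [h2]

theorem IsTL.ftwist_commute {n : ℕ} {x : T} (hx : x ∈ tlSub K e n) : Commute (ftwist A e n) x :=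
  commute_of_mem_tlSub hx fun _ hi => commute_of_commute_sig hA (h.ftwist_commute_sig hA hi)

/-- Two strands joined by a cap and led around the others can be pulled off them. Only two curls of
the cap remain, each worth $-A^{-3}$. -/
theorem IsTL.hook_mul_around (n : ℕ) :
    e n * around A e n * around A e (n + 1) = (A⁻¹ ^ 6) • e n := by
  induction n with
  | zero =>
    simp only [around, mul_one]
    rw [← mul_assoc, h.hook_mul_sig hA, smul_mul_assoc, h.hook_mul_sig hA, smul_smul]
    congr 1; ring
  | succ n ih =>
    have hD : Commute (sig A e (n + 1)) (around A e n) :=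
      (commute_sig (h.commute_hook (around_mem n) (le_refl _)).symm).symm
    have hb := h.sig_braid hA n
    have h1 := h.hook_mul_sig_mul_sig hA n
    have h2 := h.hook_mul_sig_mul_sig' hA n
    have h3 := h.down n
    simp only [around] at ih ⊢
    set x := sig A e n
    set y := sig A e (n + 1)
    set D := around A e n
    calc e (n + 1) * (x * D * x) * (y * (x * D * x) * y)
        = e (n + 1) * x * D * (x * y * x) * D * x * y := by simp only [mul_assoc]
      _ = e (n + 1) * x * (D * y) * x * (y * D) * x * y := by rw [hb]; simp only [mul_assoc]
      _ = (e (n + 1) * x * y) * D * x * D * (y * x * y) := by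
          rw [← hD.eq, hD.eq]; simp only [mul_assoc, hD.eq]
      _ = e (n + 1) * (e n * D * (x * D * x)) * y * x := by
          rw [h1, ← hb]; simp only [mul_assoc]
      _ = (A⁻¹ ^ 6) • (e (n + 1) * (e n * y * x)) := by
          rw [ih]; simp only [mul_assoc, smul_mul_assoc, mul_smul_comm]
      _ = (A⁻¹ ^ 6) • e (n + 1) := by rw [h2, ← mul_assoc, h3]

/-- A hook undoes the full twist of its two strands. -/
theorem IsTL.hook_mul_ftwist (n : ℕ) :
    e n * ftwist A e (n + 2) = (A⁻¹ ^ 6) • (e n * ftwist A e n) := by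
  rw [h.ftwist_succ hA, h.ftwist_succ hA, mul_assoc, ← mul_assoc,
    (h.commute_hook (ftwist_mem n) (le_refl _)).eq, mul_assoc, ← mul_assoc (e n),
    h.hook_mul_around hA, mul_smul_comm]

end Braids

/-! ### Jones-Wenzl idempotents -/

variable {c : ℕ → K}

/-- The Jones-Wenzl idempotent on `k + 1` strands; `c k` stands for `[k + 1] / [k + 2]`. -/
def jw (c : ℕ → K) (e : ℕ → T) : ℕ → T
  | 0 => 1
  | k + 1 => jw c e k + c k • (jw c e k * e k * jw c e k)

theorem jw_mem (k : ℕ) : jw c e k ∈ tlSub K e (k + 1) := by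
  induction k with
  | zero => exact one_mem _
  | succ k ih =>
    have h1 := tlSub_mono (Nat.le_succ _) ih
    exact add_mem h1 (Subalgebra.smul_mem _ (mul_mem (mul_mem h1 (mem_tlSub (by omega))) h1) _)

theorem jw_mul_jw_succ {k : ℕ} (h : jw c e k * jw c e k = jw c e k) :
    jw c e k * jw c e (k + 1) = jw c e (k + 1) := by
  rw [jw, mul_add, mul_smul_comm, ← mul_assoc, ← mul_assoc, h]

theorem jw_succ_mul_jw {k : ℕ} (h : jw c e k * jw c e k = jw c e k) :
    jw c e (k + 1) * jw c e k = jw c e (k + 1) := by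
  rw [jw, add_mul, smul_mul_assoc, mul_assoc, h]

/-- The partial closure of the idempotent: the first summand of its recursion leaves a loop
$\delta$, the second is straightened by $e_{k+1}e_ke_{k+1}=e_{k+1}$ and contributes $c_k$. -/
theorem IsTL.hook_mul_jw_mul_hook_of_idem (h : IsTL δ e) {k : ℕ}
    (hk : jw c e k * jw c e k = jw c e k) :
    e (k + 1) * jw c e (k + 1) * e (k + 1) = (δ + c k) • (jw c e k * e (k + 1)) := by
  have h1 := (h.commute_hook (jw_mem (c := c) (K := K) (e := e) k) (le_refl _)).eq
  rw [jw]
  set g := jw c e k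
  calc e (k + 1) * (g + c k • (g * e k * g)) * e (k + 1)
      = (e (k + 1) * g) * e (k + 1) + c k • ((e (k + 1) * g) * e k * (g * e (k + 1))) := by
        simp only [mul_add, add_mul, mul_smul_comm, smul_mul_assoc, mul_assoc]
    _ = g * (e (k + 1) * e (k + 1)) +
          c k • (g * (e (k + 1) * e k * e (k + 1)) * g) := by
        rw [h1, ← h1]
        simp only [mul_assoc, h1]
    _ = (δ + c k) • (g * e (k + 1)) := by
        rw [h.sq, h.down, mul_assoc, h1, ← mul_assoc, hk, mul_smul_comm, add_smul]

variable (h : IsTL δ e) (h0 : c 0 * δ = -1) (hc : ∀ k, c (k + 1) * (δ + c k) = -1)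
include h h0 hc

/-- The last two clauses are what makes the induction run: they say exactly that $e_k$ annihilates
the next idempotent $g+c_kge_kg$ from the left and from the right. They follow from the partial
closure and $c_{k+1}(\delta+c_k)=-1$. -/
theorem IsTL.jw_spec (k : ℕ) :
    (jw c e k * jw c e k = jw c e k ∧ (∀ i < k, e i * jw c e k = 0) ∧
      ∀ i < k, jw c e k * e i = 0) ∧
    c k • (e k * jw c e k * e k * jw c e k) = -(e k * jw c e k) ∧
    c k • (jw c e k * (e k * jw c e k * e k)) = -(jw c e k * e k) := by
  induction k with
  | zero => simp [jw, h.sq, smul_smul, h0]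
  | succ k ih =>
    obtain ⟨⟨i1, i2, i3⟩, b1, b2⟩ := ih
    have r1 : jw c e (k + 1) * e k = 0 := by
      rw [jw, add_mul, smul_mul_assoc]
      simp only [mul_assoc] at b2 ⊢
      rw [b2, add_neg_cancel]
    have l1 : e k * jw c e (k + 1) = 0 := by
      rw [jw, mul_add, mul_smul_comm]
      simp only [mul_assoc] at b1 ⊢
      rw [b1, add_neg_cancel]
    have hm := (h.commute_hook (jw_mem (c := c) (K := K) (e := e) k) (le_refl _)).eq
    refine ⟨⟨?_, fun i hi => ?_, fun i hi => ?_⟩, ?_, ?_⟩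
    · conv_lhs => enter [2]; rw [jw]
      rw [mul_add, mul_smul_comm, ← mul_assoc, ← mul_assoc, jw_succ_mul_jw i1, r1, zero_mul,
        smul_zero, add_zero]
    · rcases Nat.lt_succ_iff_lt_or_eq.1 hi with hi | rfl
      · rw [← jw_mul_jw_succ i1, ← mul_assoc, i2 i hi, zero_mul]
      · exact l1
    · rcases Nat.lt_succ_iff_lt_or_eq.1 hi with hi | rfl
      · rw [← jw_succ_mul_jw i1, mul_assoc, i3 i hi, mul_zero]
      · exact r1
    · rw [h.hook_mul_jw_mul_hook_of_idem i1, ← hm, smul_mul_assoc, mul_assoc, jw_mul_jw_succ i1,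
        smul_smul, hc, neg_one_smul]
    · rw [h.hook_mul_jw_mul_hook_of_idem i1, mul_smul_comm, ← mul_assoc, jw_succ_mul_jw i1,
        smul_smul, hc, neg_one_smul]

theorem IsTL.jw_idem (k : ℕ) : jw c e k * jw c e k = jw c e k := (h.jw_spec h0 hc k).1.1

theorem IsTL.hook_mul_jw_mul_hook (k : ℕ) :
    e (k + 1) * jw c e (k + 1) * e (k + 1) = (δ + c k) • (jw c e k * e (k + 1)) :=
  h.hook_mul_jw_mul_hook_of_idem (h.jw_idem h0 hc k)

/-- Hooks are annihilated, so every one of the $k(k+1)$ crossings acts as its identity smoothing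
$A$. -/
theorem IsTL.jw_mul_ftwist (A : K) (k : ℕ) :
    jw c e k * ftwist A e (k + 1) = A ^ (k * (k + 1)) • jw c e k := by
  have h1 : ∀ j ≤ k, jw c e k * cox A e j = A ^ j • jw c e k := by
    intro j hj
    induction j with
    | zero => simp [cox]
    | succ j ih =>
      rw [cox_succ, ← mul_assoc, ih (by omega), sig, mul_add, smul_mul_assoc, mul_smul_comm,
        mul_smul_comm, smul_mul_assoc, (h.jw_spec h0 hc k).1.2.2 j (by omega), mul_one, smul_zero,
        smul_zero, add_zero, smul_smul, pow_succ]
  have h2 : ∀ j, jw c e k * cox A e k ^ j = A ^ (k * j) • jw c e k := by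
    intro j
    induction j with
    | zero => simp
    | succ j ih =>
      rw [pow_succ, ← mul_assoc, ih, smul_mul_assoc, h1 k (le_refl _), smul_smul, ← pow_add]
      rfl
  rw [ftwist, Nat.add_sub_cancel, h2]

end TemperleyLieb

end Skein
end

noncomputable section

namespace Skein

/-! ### The trace on the Temperley-Lieb algebra -/

/-- Rational functions in `z`. -/
abbrev RatZ : Type := FractionRing (Polynomial Frac)

/-- The embedding of the skein module into polynomials over the field of fractions. -/
def toFracPoly : SkeinModule →+* Polynomial Frac :=
  Polynomial.mapRingHom (algebraMap Scalar Frac)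

/-- The embedding of the skein module into rational functions in `z`. -/
def toRatZ : SkeinModule →+* RatZ := (algebraMap (Polynomial Frac) RatZ).comp toFracPoly

/-- The core `z` as a rational function. -/
def zRat : RatZ := algebraMap (Polynomial Frac) RatZ Polynomial.X

theorem zRat_ne_zero : zRat ≠ 0 := by
  rw [zRat, Ne, FaithfulSMul.algebraMap_eq_zero_iff]
  exact Polynomial.X_ne_zero

theorem toRatZ_X : toRatZ Polynomial.X = zRat := by
  simp [toRatZ, zRat, toFracPoly]

theorem toRatZ_C_mul (r : Scalar) (x : SkeinModule) :
    toRatZ (Polynomial.C r * x) = algebraMap Scalar Frac r • toRatZ x := by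
  rw [map_mul, Algebra.smul_def]
  congr 1
  rw [toRatZ, RingHom.comp_apply, toFracPoly, Polynomial.coe_mapRingHom, Polynomial.map_C,
    IsScalarTower.algebraMap_apply Frac (Polynomial Frac) RatZ, Polynomial.algebraMap_eq]

theorem loopValue_nil (k : ℕ) : loopValue k [] = Polynomial.X ^ k := by
  induction k with
  | zero => rw [loopValue_zero, pow_zero]
  | succ k ih =>
    have := loopValue_juxtapose (m := k) (n := 1) (u := []) (v := []) (by simp) (by simp)
    simp only [List.map_nil, List.append_nil] at this
    rw [this, ih, loopValue_one, pow_succ]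

theorem toRatZ_loopValue_add {n : ℕ} {w : List ℕ} (hw : ∀ i ∈ w, i + 1 < n) (k : ℕ) :
    toRatZ (loopValue (n + k) (w.map some)) = zRat ^ k * toRatZ (loopValue n (w.map some)) := by
  have := loopValue_juxtapose (m := n) (n := k) (u := w) (v := []) hw (by simp)
  rw [List.map_nil, List.append_nil, List.map_nil, loopValue_nil] at this
  rw [this, map_mul, map_pow, toRatZ_X, mul_comm]

/-- The value of a word in the hooks, normalized so as not to depend on the number of strands. -/
def wordValue (w : List ℕ) : RatZ :=
  (zRat ^ (w.sum + 2))⁻¹ * toRatZ (loopValue (w.sum + 2) (w.map some))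

/-- An extra strand without hooks multiplies the closure by $z$, so dividing by $z^n$ removes the
dependence on $n$; `w.sum + 2` was merely one number of strands that accommodates every letter of
`w`. -/
theorem pow_mul_wordValue {n : ℕ} {w : List ℕ} (hw : ∀ i ∈ w, i + 1 < n) :
    zRat ^ n * wordValue w = toRatZ (loopValue n (w.map some)) := by
  have hs : ∀ i ∈ w, i + 1 < w.sum + 2 := fun i hi => by
    have := List.le_sum_of_mem hi; omega
  have h1 := toRatZ_loopValue_add hw (w.sum + 2)
  have h2 := toRatZ_loopValue_add hs n
  rw [add_comm, h1] at h2
  have h3 := pow_ne_zero (w.sum + 2) zRat_ne_zero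
  rw [wordValue, mul_left_comm, ← h2, ← mul_assoc, inv_mul_cancel₀ h3, one_mul]

theorem exists_bound (w : List ℕ) : ∃ n, ∀ i ∈ w, i + 1 < n :=
  ⟨w.sum + 2, fun i hi => by have := List.le_sum_of_mem hi; omega⟩

theorem wordValue_congr {w w' : List ℕ} (r : Frac) {n : ℕ} (hw : ∀ i ∈ w, i + 1 < n)
    (hw' : ∀ i ∈ w', i + 1 < n)
    (h : toRatZ (loopValue n (w.map some)) = r • toRatZ (loopValue n (w'.map some))) :
    wordValue w = r • wordValue w' := by
  rw [← pow_mul_wordValue hw, ← pow_mul_wordValue hw', ← mul_smul_comm] at h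
  exact mul_left_cancel₀ (pow_ne_zero n zRat_ne_zero) h

/-- The free algebra on the hooks. -/
abbrev Words : Type := MonoidAlgebra Frac (FreeMonoid ℕ)

/-- The trace on the free algebra. -/
def wordTrace : Words →ₗ[Frac] RatZ :=
  (Finsupp.linearCombination Frac fun w : FreeMonoid ℕ => wordValue w.toList) ∘ₗ
    (MonoidAlgebra.coeffLinearEquiv Frac).toLinearMap

theorem wordTrace_single (w : FreeMonoid ℕ) (r : Frac) :
    wordTrace (MonoidAlgebra.single w r) = r • wordValue w.toList := by
  simp only [wordTrace, LinearMap.comp_apply, LinearEquiv.coe_coe]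
  exact Finsupp.linearCombination_single _ _ _

theorem wordTrace_comm (x y : Words) : wordTrace (x * y) = wordTrace (y * x) := by
  induction x using MonoidAlgebra.induction_linear with
  | zero => simp
  | add x x' hx hx' => rw [add_mul, mul_add, map_add, map_add, hx, hx']
  | single u r =>
    induction y using MonoidAlgebra.induction_linear with
    | zero => simp
    | add y y' hy hy' => rw [add_mul, mul_add, map_add, map_add, hy, hy']
    | single v s =>
      rw [MonoidAlgebra.single_mul_single, MonoidAlgebra.single_mul_single, wordTrace_single,
        wordTrace_single, mul_comm]
      congr 1
      obtain ⟨n, hn⟩ := exists_bound (u.toList ++ v.toList)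
      rw [FreeMonoid.toList_mul, FreeMonoid.toList_mul, wordValue_congr 1 hn
        (w' := v.toList ++ u.toList), one_smul]
      · intro i hi; exact hn i (by simpa [or_comm] using hi)
      · rw [one_smul, loopValue_cyclic fun i hi => hn i (by simp [hi])]

/-- The radical of the trace. -/
def traceRadical : RingCon Words where
  r x y := ∀ u v, wordTrace (u * x * v) = wordTrace (u * y * v)
  iseqv := ⟨fun _ _ _ => rfl, fun h u v => (h u v).symm, fun h h' u v => (h u v).trans (h' u v)⟩
  add' := fun h h' u v => by
    simp only [mul_add, add_mul, map_add]
    rw [h u v, h' u v]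
  mul' := fun {w x y z} h h' u v => by
    have h1 := h u (y * v)
    have h2 := h' (u * x) v
    simp only [mul_assoc] at h1 h2 ⊢
    rw [h1, h2]

/-- The Temperley-Lieb algebra on infinitely many strands, modulo the radical of the trace. -/
abbrev TL : Type := traceRadical.Quotient

/-- The class of an element of the free algebra. -/
def tlMk : Words →ₐ[Frac] TL := RingCon.mkₐ Frac traceRadical

theorem tlMk_eq_iff {x y : Words} :
    tlMk x = tlMk y ↔ ∀ u v, wordTrace (u * x * v) = wordTrace (u * y * v) :=
  RingCon.eq traceRadical

/-- The normalized annular trace. -/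
def tlTrace : TL →ₗ[Frac] RatZ where
  toFun := Quotient.lift wordTrace fun x y h => by simpa using h 1 1
  map_add' x y := by
    induction x using Quotient.inductionOn
    induction y using Quotient.inductionOn
    exact map_add wordTrace _ _
  map_smul' r x := by
    induction x using Quotient.inductionOn
    exact map_smul wordTrace _ _

theorem tlTrace_mk (x : Words) : tlTrace (tlMk x) = wordTrace x := rfl

theorem tlMk_surjective : Function.Surjective tlMk := RingCon.mkₐ_surjective _

theorem tlTrace_comm (x y : TL) : tlTrace (x * y) = tlTrace (y * x) := by
  obtain ⟨x, rfl⟩ := tlMk_surjective x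
  obtain ⟨y, rfl⟩ := tlMk_surjective y
  rw [← map_mul, ← map_mul, tlTrace_mk, tlTrace_mk, wordTrace_comm]

/-- The class of a word. -/
def tlWord (w : List ℕ) : TL := tlMk (MonoidAlgebra.single (FreeMonoid.ofList w) 1)

theorem tlTrace_word (w : List ℕ) : tlTrace (tlWord w) = wordValue w := by
  rw [tlWord, tlTrace_mk, wordTrace_single, one_smul, FreeMonoid.toList_ofList]

theorem tlWord_append (u v : List ℕ) : tlWord (u ++ v) = tlWord u * tlWord v := by
  rw [tlWord, tlWord, tlWord, ← map_mul, MonoidAlgebra.single_mul_single, one_mul,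
    FreeMonoid.ofList_append]

theorem tlWord_nil : tlWord [] = 1 := map_one tlMk

/-- The generators. -/
def hook (i : ℕ) : TL := tlWord [i]

/-- Dividing by the radical of the trace makes it enough to verify a relation inside closed
diagrams, where loops can be counted. -/
theorem tlWord_eq_smul {w w' : List ℕ} {r : Frac}
    (h : ∀ u v, wordValue (u ++ w ++ v) = r • wordValue (u ++ w' ++ v)) :
    tlWord w = r • tlWord w' := by
  rw [tlWord, tlWord, ← map_smul, tlMk_eq_iff]
  intro x y
  induction x using MonoidAlgebra.induction_linear with
  | zero => simp
  | add x x' hx hx' => simp only [add_mul, map_add, hx, hx']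
  | single u r =>
    induction y using MonoidAlgebra.induction_linear with
    | zero => simp
    | add y y' hy hy' => simp only [mul_add, map_add, hy, hy']
    | single v s =>
      rw [mul_smul_comm, smul_mul_assoc, map_smul]
      simp only [MonoidAlgebra.single_mul_single, wordTrace_single, FreeMonoid.toList_mul,
        FreeMonoid.toList_ofList]
      rw [h, smul_comm]

/-- `A` in the field of fractions. -/
def AF : Frac := algebraMap Scalar Frac (LaurentPolynomial.T 1)

theorem AF_ne_zero : AF ≠ 0 := by
  rw [AF, Ne, FaithfulSMul.algebraMap_eq_zero_iff]
  exact (LaurentPolynomial.isUnit_T 1).ne_zero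

theorem algebraMap_T (k : ℤ) : algebraMap Scalar Frac (LaurentPolynomial.T k) = AF ^ k := by
  have h1 : ∀ n : ℕ, algebraMap Scalar Frac (LaurentPolynomial.T n) = AF ^ n := fun n => by
    rw [AF, ← map_pow, LaurentPolynomial.T_pow, mul_one]
  obtain ⟨n, rfl | rfl⟩ := k.eq_nat_or_neg
  · rw [h1, zpow_natCast]
  · rw [zpow_neg, zpow_natCast, ← h1]
    refine eq_inv_of_mul_eq_one_left ?_
    rw [← map_mul, ← LaurentPolynomial.T_add, neg_add_cancel, LaurentPolynomial.T_zero, map_one]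

theorem algebraMap_delta : algebraMap Scalar Frac delta = -AF ^ 2 - AF⁻¹ ^ 2 := by
  rw [delta, map_sub, map_neg, algebraMap_T, algebraMap_T, zpow_neg, inv_pow]
  rfl

/-- Each relation is an identity of loop counts in an arbitrary closed context, supplied by the
transfer matrices on a common bound for the number of strands. -/
theorem isTL_hook : IsTL (-AF ^ 2 - AF⁻¹ ^ 2) hook := by
  constructor
  · intro i
    rw [hook, ← tlWord_append]
    refine tlWord_eq_smul fun u v => ?_
    obtain ⟨n, hn⟩ := exists_bound (u ++ [i, i] ++ v)
    refine wordValue_congr _ hn (fun j hj => hn j ?_) ?_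
    · simp only [List.mem_append, List.mem_cons] at hj ⊢; tauto
    · rw [List.singleton_append, loopValue_hook_hook (hn i (by simp)), toRatZ_C_mul,
        algebraMap_delta]
  · intro i
    rw [hook, hook, ← tlWord_append, ← tlWord_append, ← one_smul Frac (tlWord [i])]
    refine tlWord_eq_smul fun u v => ?_
    obtain ⟨n, hn⟩ := exists_bound (u ++ [i, i + 1, i] ++ v)
    refine wordValue_congr _ hn (fun j hj => hn j ?_) ?_
    · simp only [List.mem_append, List.mem_cons] at hj ⊢; tauto
    · rw [one_smul]
      exact congrArg _ (loopValue_braid (hn _ (by simp)) (hn _ (by simp)) (Or.inl rfl) u v)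
  · intro i
    rw [hook, hook, ← tlWord_append, ← tlWord_append, ← one_smul Frac (tlWord [i + 1])]
    refine tlWord_eq_smul fun u v => ?_
    obtain ⟨n, hn⟩ := exists_bound (u ++ [i + 1, i, i + 1] ++ v)
    refine wordValue_congr _ hn (fun j hj => hn j ?_) ?_
    · simp only [List.mem_append, List.mem_cons] at hj ⊢; tauto
    · rw [one_smul]
      exact congrArg _ (loopValue_braid (hn _ (by simp)) (hn _ (by simp)) (Or.inr rfl) u v)
  · intro i j hij
    rw [commute_iff_eq, hook, hook, ← tlWord_append, ← tlWord_append,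
      ← one_smul Frac (tlWord ([j] ++ [i]))]
    refine tlWord_eq_smul fun u v => ?_
    obtain ⟨n, hn⟩ := exists_bound (u ++ [i, j] ++ v)
    refine wordValue_congr _ hn (fun j hj => hn j ?_) ?_
    · simp only [List.mem_append, List.mem_cons] at hj ⊢; tauto
    · rw [one_smul]
      exact congrArg _ (loopValue_comm (hn _ (by simp)) (hn _ (by simp)) (Or.inl hij) u v)

theorem mem_span_words {n : ℕ} {x : TL} (hx : x ∈ tlSub Frac hook n) :
    x ∈ Submodule.span Frac {y | ∃ w : List ℕ, (∀ i ∈ w, i + 1 < n) ∧ tlWord w = y} := by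
  have hx' : x ∈ Subalgebra.toSubmodule (tlSub Frac hook n) := hx
  rw [tlSub, Algebra.adjoin_eq_span] at hx'
  refine Submodule.span_mono ?_ hx'
  intro y hy
  induction hy using Submonoid.closure_induction with
  | mem x hx => obtain ⟨i, hi, rfl⟩ := hx; exact ⟨[i], by simpa using hi, rfl⟩
  | one => exact ⟨[], by simp, tlWord_nil⟩
  | mul x y _ _ hx hy =>
    obtain ⟨u, hu, rfl⟩ := hx
    obtain ⟨v, hv, rfl⟩ := hy
    refine ⟨u ++ v, fun i hi => ?_, tlWord_append u v⟩
    rcases List.mem_append.1 hi with h | h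
    exacts [hu i h, hv i h]

theorem tlTrace_word_juxtapose {m n : ℕ} {u v : List ℕ} (hu : ∀ i ∈ u, i + 1 < m)
    (hv : ∀ i ∈ v, i + 1 < n) :
    tlTrace (tlWord u * tlWord (v.map (m + ·))) = tlTrace (tlWord u) * tlTrace (tlWord v) := by
  rw [← tlWord_append, tlTrace_word, tlTrace_word, tlTrace_word]
  refine mul_left_cancel₀ (pow_ne_zero (m + n) zRat_ne_zero) ?_
  rw [pow_mul_wordValue, loopValue_juxtapose hu hv, map_mul, ← pow_mul_wordValue hu,
    ← pow_mul_wordValue hv, pow_add, mul_mul_mul_comm]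
  intro i hi
  rcases List.mem_append.1 hi with h | h
  · have := hu i h; omega
  · obtain ⟨j, hj, rfl⟩ := List.mem_map.1 h
    have := hv j hj; omega

/-- A hook on two further strands contributes a contractible loop. -/
theorem tlTrace_mul_hook {n : ℕ} {x : TL} (hx : x ∈ tlSub Frac hook n) :
    zRat ^ 2 * tlTrace (x * hook n) = (-AF ^ 2 - AF⁻¹ ^ 2) • tlTrace x := by
  have key : Submodule.span Frac {y | ∃ w : List ℕ, (∀ i ∈ w, i + 1 < n) ∧ tlWord w = y} ≤
      LinearMap.eqLocus (LinearMap.mulLeft Frac (zRat ^ 2) ∘ₗ tlTrace ∘ₗ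
        LinearMap.mulRight Frac (hook n)) ((-AF ^ 2 - AF⁻¹ ^ 2) • tlTrace) := by
    refine Submodule.span_le.2 ?_
    rintro _ ⟨w, hw, rfl⟩
    have h1 := tlTrace_word_juxtapose (m := n) (n := 2) (u := w) (v := [0]) hw (by simp)
    have h2 := pow_mul_wordValue (n := 2) (w := [0]) (by simp)
    rw [List.map_cons, List.map_nil, loopValue_hook] at h2
    have h3 : toRatZ (Polynomial.C delta) = (-AF ^ 2 - AF⁻¹ ^ 2) • (1 : RatZ) := by
      rw [← mul_one (Polynomial.C delta), toRatZ_C_mul, algebraMap_delta, map_one]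
    change zRat ^ 2 * tlTrace (tlWord w * hook n) = (-AF ^ 2 - AF⁻¹ ^ 2) • tlTrace (tlWord w)
    rw [hook]
    simp only [List.map_cons, List.map_nil, add_zero] at h1
    rw [h1, mul_left_comm, tlTrace_word [0], h2, h3, mul_smul_comm, mul_one]
  exact key (mem_span_words hx)

/-! ### Brackets of braids as traces -/

/-- The resolution of a braid diagram. -/
def braidProd (w : List Crossing) : TL :=
  (w.map fun c => if c.2 then sig AF hook c.1 else sigInv AF hook c.1).prod

theorem braidProd_cons_true (i : ℕ) (w : List Crossing) :
    braidProd ((i, true) :: w) = AF • braidProd w + AF⁻¹ • (hook i * braidProd w) := by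
  simp [braidProd, sig, add_mul]

theorem braidProd_cons_false (i : ℕ) (w : List Crossing) :
    braidProd ((i, false) :: w) = AF⁻¹ • braidProd w + AF • (hook i * braidProd w) := by
  simp [braidProd, sigInv, add_mul]

theorem braidProd_append (u v : List Crossing) :
    braidProd (u ++ v) = braidProd u * braidProd v := by
  simp [braidProd]

theorem braidProd_mem {n : ℕ} {w : List Crossing} (hw : ∀ c ∈ w, c.1 + 1 < n) :
    braidProd w ∈ tlSub Frac hook n := by
  refine list_prod_mem fun x hx => ?_
  obtain ⟨c, hc, rfl⟩ := List.mem_map.1 hx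
  split_ifs
  exacts [sig_mem (hw c hc), sigInv_mem (hw c hc)]

/-- The layers already resolved are kept arbitrary, since each smoothing of a crossing appends one.
-/
theorem toRatZ_resolve {n : ℕ} {w : List Crossing} (hw : ∀ c ∈ w, c.1 + 1 < n)
    {s : List (Option ℕ)} (hs : ∀ i ∈ s.reduceOption, i + 1 < n) :
    toRatZ (resolve n w s) = zRat ^ n * tlTrace (tlWord s.reduceOption * braidProd w) := by
  induction w generalizing s with
  | nil =>
    rw [resolve, braidProd, List.map_nil, List.prod_nil, mul_one, tlTrace_word,
      pow_mul_wordValue hs, ← loopValue_reduceOption]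
  | cons c w ih =>
    obtain ⟨i, b⟩ := c
    have hi : i + 1 < n := hw (i, b) (by simp)
    have hw' : ∀ c ∈ w, c.1 + 1 < n := fun c hc => hw c (by simp [hc])
    have e1 : (s ++ [none]).reduceOption = s.reduceOption := by
      simp [List.reduceOption_append]
    have e2 : (s ++ [some i]).reduceOption = s.reduceOption ++ [i] := by
      simp [List.reduceOption_append]
    have h1 := ih hw' (s := s ++ [none]) (by rwa [e1])
    have h2 := ih hw' (s := s ++ [some i]) (by
      rw [e2]; intro j hj
      rcases List.mem_append.1 hj with h | h
      · exact hs j h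
      · rw [List.mem_singleton.1 h]; exact hi)
    rw [e1] at h1
    rw [e2, tlWord_append, mul_assoc] at h2
    cases b
    · rw [resolve, map_add, toRatZ_C_mul, toRatZ_C_mul, h1, h2, braidProd_cons_false,
        algebraMap_T, algebraMap_T, zpow_neg_one, zpow_one, mul_add, mul_smul_comm, mul_smul_comm,
        map_add, map_smul, map_smul, mul_add, mul_smul_comm, mul_smul_comm]
      rfl
    · rw [resolve, map_add, toRatZ_C_mul, toRatZ_C_mul, h1, h2, braidProd_cons_true,
        algebraMap_T, algebraMap_T, zpow_neg_one, zpow_one, mul_add, mul_smul_comm, mul_smul_comm,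
        map_add, map_smul, map_smul, mul_add, mul_smul_comm, mul_smul_comm]
      rfl

theorem toRatZ_annularBracket {n : ℕ} {w : List Crossing} (hw : ∀ c ∈ w, c.1 + 1 < n) :
    toRatZ (annularBracket n w) = zRat ^ n * tlTrace (braidProd w) := by
  have := toRatZ_resolve hw (s := []) (by simp)
  rwa [List.reduceOption_nil, tlWord_nil, one_mul] at this

/-- A braid diagram moved to the right by `m` strands. -/
def shiftBraid (m : ℕ) (w : List Crossing) : List Crossing := w.map fun c => (m + c.1, c.2)

/-- The shifted word `q` accumulates the hooks produced while the crossings of `v` are resolved one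
by one. -/
theorem tlTrace_juxtapose_aux {m n : ℕ} {p : List ℕ} (hp : ∀ i ∈ p, i + 1 < m)
    {q : List ℕ} (hq : ∀ i ∈ q, i + 1 < n) {v : List Crossing} (hv : ∀ c ∈ v, c.1 + 1 < n) :
    tlTrace (tlWord p * (tlWord (q.map (m + ·)) * braidProd (shiftBraid m v))) =
      tlTrace (tlWord p) * tlTrace (tlWord q * braidProd v) := by
  induction v generalizing q with
  | nil => simpa [braidProd, shiftBraid] using tlTrace_word_juxtapose hp hq
  | cons c v ih =>
    obtain ⟨i, b⟩ := c
    have hi : i + 1 < n := hv (i, b) (by simp)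
    have hv' : ∀ c ∈ v, c.1 + 1 < n := fun c hc => hv c (by simp [hc])
    have h1 := ih hq hv'
    have h2 := ih (q := q ++ [i]) (by
      intro j hj
      rcases List.mem_append.1 hj with h | h
      · exact hq j h
      · rw [List.mem_singleton.1 h]; exact hi) hv'
    rw [List.map_append, tlWord_append, tlWord_append, mul_assoc, mul_assoc] at h2
    change _ = tlTrace (tlWord p) * tlTrace (tlWord q * (hook i * braidProd v)) at h2
    change tlTrace (tlWord p * (tlWord (q.map (m + ·)) * (hook (m + i) * _))) = _ at h2
    cases b
    · change tlTrace (tlWord p * (_ * braidProd ((m + i, false) :: shiftBraid m v))) = _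
      rw [braidProd_cons_false, braidProd_cons_false]
      simp only [mul_add, mul_smul_comm, map_add, map_smul, h1, h2]
    · change tlTrace (tlWord p * (_ * braidProd ((m + i, true) :: shiftBraid m v))) = _
      rw [braidProd_cons_true, braidProd_cons_true]
      simp only [mul_add, mul_smul_comm, map_add, map_smul, h1, h2]

theorem tlTrace_juxtapose {m n : ℕ} {x : TL} (hx : x ∈ tlSub Frac hook m) {v : List Crossing}
    (hv : ∀ c ∈ v, c.1 + 1 < n) :
    tlTrace (x * braidProd (shiftBraid m v)) = tlTrace x * tlTrace (braidProd v) := by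
  have key : Submodule.span Frac {y | ∃ w : List ℕ, (∀ i ∈ w, i + 1 < m) ∧ tlWord w = y} ≤
      LinearMap.eqLocus (tlTrace ∘ₗ LinearMap.mulRight Frac (braidProd (shiftBraid m v)))
        (LinearMap.mulRight Frac (tlTrace (braidProd v)) ∘ₗ tlTrace) := by
    refine Submodule.span_le.2 ?_
    rintro _ ⟨w, hw, rfl⟩
    have := tlTrace_juxtapose_aux hw (q := []) (by simp) hv
    rw [List.map_nil, tlWord_nil, one_mul, one_mul] at this
    exact this
  exact key (mem_span_words hx)

end Skein
end

noncomputable section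

namespace Skein

open Polynomial (X C)

/-! ### The twist map on traces -/

theorem toFracPoly_injective : Function.Injective toFracPoly :=
  Polynomial.map_injective _ (FaithfulSMul.algebraMap_injective Scalar Frac)

theorem AF_zpow_eq_one {k : ℤ} (h : AF ^ k = 1) : k = 0 := by
  rw [← algebraMap_T, ← map_one (algebraMap Scalar Frac), ← LaurentPolynomial.T_zero] at h
  have := FaithfulSMul.algebraMap_injective Scalar Frac h
  by_contra hk
  have h2 := congrArg (fun p : Scalar => p.coeff k) this
  simp only [LaurentPolynomial.T, AddMonoidAlgebra.coeff_single, Finsupp.single_apply, if_true,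
    if_neg (Ne.symm hk)] at h2
  exact one_ne_zero h2

theorem AF_delta_ne_zero : -AF ^ 2 - AF⁻¹ ^ 2 ≠ 0 := by
  intro h
  have hA := AF_ne_zero
  have h1 : AF ^ 4 = -1 := by
    field_simp at h
    linear_combination -h
  have h2 : AF ^ (8 : ℤ) = 1 := by
    have : AF ^ (8 : ℤ) = (AF ^ 4) ^ 2 := by rw [← pow_mul]; norm_cast
    rw [this, h1]; norm_num
  exact absurd (AF_zpow_eq_one h2) (by norm_num)

theorem braidProd_flatten_replicate (n : ℕ) (w : List Crossing) :
    braidProd (List.replicate n w).flatten = braidProd w ^ n := by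
  induction n with
  | zero => simp [braidProd]
  | succ n ih => rw [List.replicate_succ, List.flatten_cons, braidProd_append, ih, pow_succ']

theorem braidProd_fullTwist (n : ℕ) : braidProd (fullTwist 0 n) = ftwist AF hook n := by
  rw [fullTwist, braidProd_flatten_replicate, ftwist, cox, braidProd]
  simp only [List.map_map]
  congr 3
  funext i
  simp

theorem fullTwist_lt (o n : ℕ) : ∀ c ∈ fullTwist o n, c.1 + 1 < o + n := by
  intro c hc
  simp only [fullTwist, List.mem_flatten, List.mem_replicate] at hc
  obtain ⟨l, ⟨-, rfl⟩, hc⟩ := hc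
  obtain ⟨i, hi, rfl⟩ := List.mem_map.1 hc
  have := List.mem_range.1 hi
  simp only
  omega

theorem inverseBraid_lt {n : ℕ} {w : List Crossing} (hw : ∀ c ∈ w, c.1 + 1 < n) :
    ∀ c ∈ inverseBraid w, c.1 + 1 < n := by
  intro c hc
  simp only [inverseBraid, List.mem_reverse, List.mem_map] at hc
  obtain ⟨d, hd, rfl⟩ := hc
  exact hw d hd

theorem fullTwist_eq_shiftBraid (o n : ℕ) : fullTwist o n = shiftBraid o (fullTwist 0 n) := by
  simp only [fullTwist, shiftBraid, List.map_flatten, List.map_replicate, List.map_map]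
  congr 3
  funext i
  simp

theorem inverseBraid_shiftBraid (o : ℕ) (w : List Crossing) :
    inverseBraid (shiftBraid o w) = shiftBraid o (inverseBraid w) := by
  simp [inverseBraid, shiftBraid, List.map_reverse, Function.comp_def]

theorem braidProd_inverseBraid_mul (w : List Crossing) :
    braidProd (inverseBraid w) * braidProd w = 1 := by
  induction w with
  | nil => simp [braidProd, inverseBraid]
  | cons c w ih =>
    have e1 : inverseBraid (c :: w) = inverseBraid w ++ [(c.1, !c.2)] := by
      simp [inverseBraid]
    have e2 : braidProd [(c.1, !c.2)] * braidProd [c] = 1 := by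
      obtain ⟨i, b⟩ := c
      cases b
      · simpa [braidProd] using isTL_hook.sig_mul_sigInv AF_ne_zero i
      · simpa [braidProd] using isTL_hook.sigInv_mul_sig AF_ne_zero i
    rw [e1, ← List.singleton_append (x := c), braidProd_append, braidProd_append, mul_assoc,
      ← mul_assoc (braidProd [(c.1, !c.2)]), e2, one_mul, ih]

theorem twist_X_pow (n : ℕ) :
    twist (X ^ n) = C ((-LaurentPolynomial.T 3) ^ n) * annularBracket n (fullTwist 0 n) := by
  have h : (X ^ n : SkeinModule) = Polynomial.basisMonomials Scalar n :=
    (Polynomial.monomial_one_right_eq_X_pow n).symm.trans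
      (congrFun (Polynomial.coe_basisMonomials _) n).symm
  rw [h, twist, Module.Basis.constr_basis]

/-- The twist map over the field of fractions. -/
def fracTwist : Polynomial Frac →ₗ[Frac] Polynomial Frac :=
  (Polynomial.basisMonomials Frac).constr Frac fun n => toFracPoly (twist (X ^ n))

theorem fracTwist_X_pow (n : ℕ) : fracTwist (X ^ n) = toFracPoly (twist (X ^ n)) := by
  have h : (X ^ n : Polynomial Frac) = Polynomial.basisMonomials Frac n :=
    (Polynomial.monomial_one_right_eq_X_pow n).symm.trans
      (congrFun (Polynomial.coe_basisMonomials _) n).symm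
  rw [h, fracTwist, Module.Basis.constr_basis]

theorem toFracPoly_C_mul (r : Scalar) (x : SkeinModule) :
    toFracPoly (C r * x) = algebraMap Scalar Frac r • toFracPoly x := by
  rw [map_mul, toFracPoly, Polynomial.coe_mapRingHom, Polynomial.map_C, Polynomial.smul_eq_C_mul]

theorem fracTwist_toFracPoly (x : SkeinModule) :
    fracTwist (toFracPoly x) = toFracPoly (twist x) := by
  induction x using Polynomial.induction_on' with
  | add p q hp hq => simp only [map_add, hp, hq]
  | monomial n r =>
    rw [← Polynomial.C_mul_X_pow_eq_monomial, toFracPoly_C_mul, map_smul,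
      ← Polynomial.smul_eq_C_mul, map_smul, Polynomial.smul_eq_C_mul r, toFracPoly_C_mul,
      ← fracTwist_X_pow]
    simp [toFracPoly]

theorem neg_T_three (n : ℕ) :
    algebraMap Scalar Frac ((-LaurentPolynomial.T 3) ^ n) = (-AF ^ 3) ^ n := by
  rw [map_pow, map_neg, algebraMap_T]; rfl

theorem tlTrace_one : tlTrace 1 = 1 := by
  rw [← tlWord_nil, tlTrace_word]
  have := pow_mul_wordValue (n := 0) (w := []) (by simp)
  rwa [pow_zero, one_mul, List.map_nil, loopValue_zero, map_one] at this

/-- The rational function of a polynomial over the field of fractions. -/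
def polyRat : Polynomial Frac →ₗ[Frac] RatZ := Algebra.linearMap _ _ |>.restrictScalars Frac

theorem polyRat_injective : Function.Injective polyRat :=
  FaithfulSMul.algebraMap_injective (Polynomial Frac) RatZ

theorem polyRat_toFracPoly (x : SkeinModule) : polyRat (toFracPoly x) = toRatZ x := rfl

/-- The elements on `n` strands for which a full twist of the strands is the twist map. -/
def twistCompatible (n : ℕ) : Submodule Frac TL where
  carrier := {x | ∃ P Q, polyRat P = zRat ^ n * tlTrace x ∧
    polyRat Q = zRat ^ n * tlTrace (x * ftwist AF hook n) ∧ fracTwist P = (-AF ^ 3) ^ n • Q}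
  zero_mem' := ⟨0, 0, by simp⟩
  add_mem' := by
    rintro x y ⟨P, Q, h1, h2, h3⟩ ⟨P', Q', h1', h2', h3'⟩
    refine ⟨P + P', Q + Q', ?_, ?_, ?_⟩
    · rw [map_add, h1, h1', map_add, mul_add]
    · rw [map_add, h2, h2', add_mul, map_add, mul_add]
    · rw [map_add, h3, h3', smul_add]
  smul_mem' := by
    rintro r x ⟨P, Q, h1, h2, h3⟩
    refine ⟨r • P, r • Q, ?_, ?_, ?_⟩
    · rw [map_smul, h1, map_smul, mul_smul_comm]
    · rw [map_smul, h2, smul_mul_assoc, map_smul, mul_smul_comm]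
    · rw [map_smul, h3, smul_comm]

theorem one_mem_twistCompatible (n : ℕ) : 1 ∈ twistCompatible n := by
  refine ⟨X ^ n, toFracPoly (annularBracket n (fullTwist 0 n)), ?_, ?_, ?_⟩
  · rw [tlTrace_one, mul_one, zRat, ← map_pow]; rfl
  · rw [polyRat_toFracPoly, toRatZ_annularBracket, braidProd_fullTwist, one_mul]
    simpa using fullTwist_lt 0 n
  · rw [fracTwist_X_pow, twist_X_pow, toFracPoly_C_mul, neg_T_three]

/-- Up to scalars an element is the identity, where the claim is the definition of the twist map, or
is $ue_mv$. The closure of the latter has the value of an element on $m$ strands, and centrality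
lets the hook absorb the full twist of the two strands it joins. -/
theorem mem_twistCompatible {n : ℕ} {x : TL} (hx : x ∈ tlSub Frac hook n) :
    x ∈ twistCompatible n := by
  have hA := AF_ne_zero
  induction n using Nat.strong_induction_on generalizing x with
  | _ n ih =>
  rcases Nat.lt_or_ge n 2 with hn | hn
  · have : {x : TL | ∃ i, i + 1 < n ∧ hook i = x} = ∅ := by
      ext; simp only [Set.mem_ofPred_eq, Set.mem_empty_iff_false, iff_false]
      rintro ⟨i, hi, -⟩; omega
    rw [tlSub, this, Algebra.adjoin_empty] at hx
    obtain ⟨c, rfl⟩ := Algebra.mem_bot.1 hx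
    rw [Algebra.algebraMap_eq_smul_one]
    exact Submodule.smul_mem _ _ (one_mem_twistCompatible n)
  · obtain ⟨m, rfl⟩ : ∃ m, n = m + 2 := ⟨n - 2, by omega⟩
    refine (sup_le ?_ ?_ : _ ≤ twistCompatible (m + 2)) (isTL_hook.mem_span hx)
    · rw [Submodule.span_singleton_le_iff_mem]
      exact one_mem_twistCompatible _
    refine Submodule.span_le.2 ?_
    rintro _ ⟨u, hu, v, hv, rfl⟩
    obtain ⟨y, hy, hy'⟩ := isTL_hook.hook_mul_hook (mul_mem hv hu)
    obtain ⟨P, Q, h1, h2, h3⟩ := ih m (by omega) hy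
    have hem : hook m ∈ tlSub Frac hook (m + 2) := mem_tlSub (by omega)
    have hF : Commute (ftwist AF hook (m + 2)) (u * hook m) :=
      isTL_hook.ftwist_commute AF_ne_zero (mul_mem hu hem)
    -- Multiplying by $\delta$ creates a second hook via $e_m^2=\delta e_m$. Cyclicity brings the
    -- two around $vu$, and $e_mvue_m=ye_m$ applies; $\delta\neq0$ is cancelled afterwards.
    have t1 : (-AF ^ 2 - AF⁻¹ ^ 2) • (zRat ^ 2 * tlTrace (u * hook m * v)) =
        (-AF ^ 2 - AF⁻¹ ^ 2) • tlTrace y := by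
      rw [← tlTrace_mul_hook hy, ← hy', ← mul_smul_comm, ← map_smul]
      congr 1
      calc tlTrace ((-AF ^ 2 - AF⁻¹ ^ 2) • (u * hook m * v))
          = tlTrace ((u * hook m) * (hook m * v)) := by
            rw [mul_assoc u (hook m) (hook m * v), ← mul_assoc (hook m) (hook m) v, isTL_hook.sq]
            simp only [smul_mul_assoc, mul_smul_comm, mul_assoc]
        _ = _ := by rw [tlTrace_comm]; simp only [mul_assoc]
    have t2 : (-AF ^ 2 - AF⁻¹ ^ 2) •
        (zRat ^ 2 * tlTrace (u * hook m * v * ftwist AF hook (m + 2))) =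
        (-AF ^ 2 - AF⁻¹ ^ 2) • AF⁻¹ ^ 6 • tlTrace (y * ftwist AF hook m) := by
      suffices hs : (-AF ^ 2 - AF⁻¹ ^ 2) • tlTrace (u * hook m * v * ftwist AF hook (m + 2)) =
          AF⁻¹ ^ 6 • tlTrace (y * ftwist AF hook m * hook m) by
        rw [smul_comm, ← tlTrace_mul_hook (mul_mem hy (ftwist_mem m)), ← mul_smul_comm, hs,
          mul_smul_comm]
      refine (map_smul tlTrace _ _).symm.trans (Eq.trans ?_ (map_smul tlTrace _ _))
      calc tlTrace ((-AF ^ 2 - AF⁻¹ ^ 2) • (u * hook m * v * ftwist AF hook (m + 2)))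
          = tlTrace ((u * hook m) * (hook m * v * ftwist AF hook (m + 2))) := by
            rw [mul_assoc u (hook m) (hook m * v * _), ← mul_assoc (hook m) (hook m * v) _,
              ← mul_assoc (hook m) (hook m) v, isTL_hook.sq]
            simp only [smul_mul_assoc, mul_smul_comm, mul_assoc]
        _ = tlTrace (hook m * v * (ftwist AF hook (m + 2) * (u * hook m))) := by
            rw [tlTrace_comm]; simp only [mul_assoc]
        _ = tlTrace ((hook m * (v * u) * hook m) * ftwist AF hook (m + 2)) := by
            rw [hF.eq]; simp only [mul_assoc]
        _ = tlTrace (AF⁻¹ ^ 6 • (y * ftwist AF hook m * hook m)) := by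
            rw [hy', mul_assoc, isTL_hook.hook_mul_ftwist AF_ne_zero, mul_smul_comm, mul_assoc,
              (isTL_hook.commute_hook (ftwist_mem m) (le_refl _)).eq]
    have t1' := smul_right_injective RatZ AF_delta_ne_zero t1
    have t2' := smul_right_injective RatZ AF_delta_ne_zero t2
    refine ⟨P, AF⁻¹ ^ 6 • Q, ?_, ?_, ?_⟩
    · rw [h1, ← t1', pow_add, mul_assoc (zRat ^ m)]
    · rw [map_smul, h2, ← mul_smul_comm, ← t2', pow_add, mul_assoc (zRat ^ m)]
    -- The framing factor $(-A^3)^2$ of the two lost strands cancels the $A^{-6}$ of the absorbed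
    -- twist.
    · rw [h3, smul_smul]
      congr 1
      field_simp
      ring

/-- A full twist of `n` strands is the twist map. -/
theorem twist_eq_of_trace {n : ℕ} {x : TL} (hx : x ∈ tlSub Frac hook n) {p q : SkeinModule}
    (hp : toRatZ p = zRat ^ n * tlTrace x)
    (hq : toRatZ q = zRat ^ n * tlTrace (x * ftwist AF hook n)) :
    twist p = C ((-LaurentPolynomial.T 3) ^ n) * q := by
  obtain ⟨P, Q, h1, h2, h3⟩ := mem_twistCompatible hx
  rw [← hp, ← polyRat_toFracPoly] at h1
  rw [← hq, ← polyRat_toFracPoly] at h2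
  rw [polyRat_injective h1, polyRat_injective h2, fracTwist_toFracPoly, ← neg_T_three,
    ← toFracPoly_C_mul] at h3
  exact toFracPoly_injective h3

/-! ### Eigenvectors of the twist map -/

theorem a_eq : a = AF ^ 2 := by rw [a, algebraMap_T]; rfl

theorem a_ne_zero : a ≠ 0 := by rw [a_eq]; exact pow_ne_zero _ AF_ne_zero

theorem brace_succ_ne_zero (n : ℕ) : brace (n + 1) ≠ 0 := by
  intro h
  have h1 : AF ^ (4 * ((n : ℤ) + 1)) = 1 := by
    have h2 : a ^ ((n + 1 : ℕ) : ℤ) = a ^ (-((n + 1 : ℕ) : ℤ)) := sub_eq_zero.1 h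
    have h3 : AF ^ (4 * ((n : ℤ) + 1)) = a ^ ((n + 1 : ℕ) : ℤ) * a ^ ((n + 1 : ℕ) : ℤ) := by
      rw [a_eq, ← zpow_natCast AF 2, ← zpow_mul, ← zpow_add₀ AF_ne_zero]
      congr 1; push_cast; ring
    rw [h3]
    nth_rewrite 1 [h2]
    rw [← zpow_add₀ a_ne_zero, neg_add_cancel, zpow_zero]
  have := AF_zpow_eq_one h1
  omega

theorem brace_recurrence (k : ℕ) :
    brace (k + 2) = (a + a⁻¹) * brace (k + 1) - brace k := by
  have ha := a_ne_zero
  simp only [brace, zpow_neg, zpow_natCast, pow_succ]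
  field_simp
  ring

/-- The coefficients in the recursion for the Jones-Wenzl idempotents. -/
def jwCoeff (k : ℕ) : Frac := brace (k + 1) / brace (k + 2)

theorem delta_eq_a : -AF ^ 2 - AF⁻¹ ^ 2 = -(a + a⁻¹) := by
  rw [a_eq, inv_pow]; ring

theorem jwCoeff_zero : jwCoeff 0 * (-AF ^ 2 - AF⁻¹ ^ 2) = -1 := by
  have h2 := brace_succ_ne_zero 1
  have h := brace_recurrence 0
  have h0 : brace 0 = 0 := by simp [brace]
  rw [h0, sub_zero] at h
  rw [delta_eq_a, jwCoeff, div_mul_eq_mul_div, div_eq_iff h2]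
  linear_combination h

/-- With $\delta=-(a+a^{-1})$ this is the three-term recurrence $\{k+3\}=(a+a^{-1})\{k+2\}-\{k+1\}$.
-/
theorem jwCoeff_succ (k : ℕ) : jwCoeff (k + 1) * (-AF ^ 2 - AF⁻¹ ^ 2 + jwCoeff k) = -1 := by
  have h2 : brace (k + 2) ≠ 0 := brace_succ_ne_zero (k + 1)
  have h3 : brace (k + 1 + 2) ≠ 0 := brace_succ_ne_zero (k + 2)
  have h := brace_recurrence (k + 1)
  have h' : jwCoeff k * brace (k + 2) = brace (k + 1) := div_mul_cancel₀ _ h2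
  rw [delta_eq_a, jwCoeff, div_mul_eq_mul_div, div_eq_iff h3]
  linear_combination h + h'

/-- The Jones-Wenzl idempotents of the Temperley-Lieb algebra. -/
def jwIdem (k : ℕ) : TL := jw jwCoeff hook k

/-- The closure of the Jones-Wenzl idempotent on `n` strands. -/
def cheb : ℕ → SkeinModule
  | 0 => 1
  | 1 => X
  | n + 2 => X * cheb (n + 1) - cheb n

/-- In the recursion for the idempotents, the first summand gains a free strand $z$. The second
closes up to $c_{k+1}(\delta+c_k)=-1$ times the idempotent on two strands fewer: the Chebyshev
recursion. -/
theorem trace_jwIdem (k : ℕ) :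
    zRat ^ (k + 1) * tlTrace (jwIdem k) = toRatZ (cheb (k + 1)) := by
  have h0 := jwCoeff_zero
  have hc := jwCoeff_succ
  induction k using Nat.strong_induction_on with
  | _ k ih =>
  match k with
  | 0 =>
    rw [jwIdem, jw, tlTrace_one, cheb, toRatZ_X, mul_one, zero_add, pow_one]
  | 1 =>
    have h1 := tlTrace_mul_hook (n := 0) (x := 1) (one_mem _)
    rw [one_mul, tlTrace_one] at h1
    rw [jwIdem, jw, jw, one_mul, mul_one, map_add, map_smul, mul_add, mul_smul_comm, h1, smul_smul,
      h0, tlTrace_one, mul_one, cheb, cheb, map_sub, map_mul, toRatZ_X, cheb, map_one]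
    rw [neg_smul, one_smul, toRatZ_X]
    ring
  | k + 2 =>
    have h1 := ih (k + 1) (by omega)
    have h2 := ih k (by omega)
    have hk : jwIdem k ∈ tlSub Frac hook (k + 1) := jw_mem k
    have hm := tlTrace_mul_hook hk
    set g := jwIdem (k + 1) with hg
    have hgg : g * g = g := isTL_hook.jw_idem h0 hc (k + 1)
    have hege : hook (k + 1) * g * hook (k + 1) =
      (-AF ^ 2 - AF⁻¹ ^ 2 + jwCoeff k) • (jwIdem k * hook (k + 1)) :=
      isTL_hook.hook_mul_jw_mul_hook h0 hc k
    have t1 : tlTrace (g * hook (k + 1) * g) = tlTrace (g * hook (k + 1)) := by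
      rw [tlTrace_comm, ← mul_assoc, hgg]
    have t2 : (-AF ^ 2 - AF⁻¹ ^ 2) • (zRat ^ 2 * tlTrace (g * hook (k + 1))) =
        (-AF ^ 2 - AF⁻¹ ^ 2) • (-AF ^ 2 - AF⁻¹ ^ 2 + jwCoeff k) • tlTrace (jwIdem k) := by
      have hs : (-AF ^ 2 - AF⁻¹ ^ 2) • tlTrace (g * hook (k + 1)) =
          (-AF ^ 2 - AF⁻¹ ^ 2 + jwCoeff k) • tlTrace (jwIdem k * hook (k + 1)) := by
        refine (map_smul tlTrace _ _).symm.trans (Eq.trans ?_ (map_smul tlTrace _ _))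
        rw [← hege, mul_assoc (hook (k + 1)), tlTrace_comm (hook (k + 1)), mul_assoc, isTL_hook.sq,
          mul_smul_comm]
      rw [smul_comm, ← hm, ← mul_smul_comm, hs, mul_smul_comm]
    have t3 : zRat ^ 2 * tlTrace (g * hook (k + 1)) = _ := smul_right_injective RatZ AF_delta_ne_zero t2
    have t4 : zRat ^ 2 * tlTrace (jwCoeff (k + 1) • (g * hook (k + 1) * g)) =
        - tlTrace (jwIdem k) := by
      rw [map_smul, t1, mul_smul_comm, t3, smul_smul, hc, neg_smul, one_smul]
    have e : jwIdem (k + 2) = g + jwCoeff (k + 1) • (g * hook (k + 1) * g) := rfl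
    rw [e, cheb, map_sub, map_mul, ← h1, ← h2, toRatZ_X, map_add, mul_add,
      show zRat ^ (k + 2 + 1) = zRat ^ (k + 1) * zRat ^ 2 by ring, mul_assoc _ (zRat ^ 2)
      (tlTrace (jwCoeff (k + 1) • _)), t4]
    ring

/-- The eigenvalues of the twist map. -/
def mu (n : ℕ) : Scalar := (-1) ^ n * LaurentPolynomial.T ((n : ℤ) ^ 2 + 2 * n)

/-- For $n=k+1$ strands the crossings contribute $A^{k(k+1)}$ and the framings $(-A^3)^{k+1}$; the
exponents add up to $(k+1)(k+3)=n^2+2n$. -/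
theorem twist_cheb (n : ℕ) : twist (cheb n) = C (mu n) * cheb n := by
  cases n with
  | zero =>
    have := twist_X_pow 0
    simp only [pow_zero, map_one, one_mul] at this
    rw [cheb, this, annularBracket]
    simp [fullTwist, resolve, loopValue_zero, mu]
  | succ k =>
    have hj : jwIdem k ∈ tlSub Frac hook (k + 1) := jw_mem k
    rw [twist_eq_of_trace hj (p := cheb (k + 1))
      (q := C (LaurentPolynomial.T ((k : ℤ) * (k + 1))) * cheb (k + 1)) (trace_jwIdem k).symm,
      ← mul_assoc, ← map_mul]
    · congr 2
      rw [mu, neg_pow, LaurentPolynomial.T_pow, mul_assoc, ← LaurentPolynomial.T_add]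
      congr 2
      push_cast; ring
    · rw [jwIdem, isTL_hook.jw_mul_ftwist jwCoeff_zero jwCoeff_succ, map_smul, mul_smul_comm,
        toRatZ_C_mul, ← trace_jwIdem, jwIdem, algebraMap_T, ← zpow_natCast]
      push_cast
      rfl

theorem cheb_monic_natDegree (n : ℕ) :
    ((cheb n).Monic ∧ (cheb n).natDegree = n) ∧
      (cheb (n + 1)).Monic ∧ (cheb (n + 1)).natDegree = n + 1 := by
  induction n with
  | zero => simp [cheb, Polynomial.monic_X]
  | succ n ih =>
    obtain ⟨⟨h1, h2⟩, h3, h4⟩ := ih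
    refine ⟨⟨h3, h4⟩, ?_⟩
    have hm : (X * cheb (n + 1)).Monic := Polynomial.monic_X.mul h3
    have hd : (X * cheb (n + 1)).natDegree = n + 2 := by
      rw [Polynomial.monic_X.natDegree_mul h3, Polynomial.natDegree_X, h4, add_comm]
    have hlt : (cheb n).natDegree < (X * cheb (n + 1)).natDegree := by rw [hd, h2]; omega
    rw [cheb]
    exact ⟨hm.sub_of_left (Polynomial.degree_lt_degree hlt),
      by rw [Polynomial.natDegree_sub_eq_left_of_natDegree_lt hlt, hd]⟩

/-- The `cheb n` as a sequence of polynomials. -/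
def chebSequence : Polynomial.Sequence Scalar where
  elems' := cheb
  degree_eq' n := by
    obtain ⟨h1, h2⟩ := (cheb_monic_natDegree n).1
    rw [Polynomial.degree_eq_natDegree h1.ne_zero, h2]

/-- The basis of eigenvectors of the twist map. -/
def chebBasis : Module.Basis ℕ Scalar SkeinModule :=
  chebSequence.basis fun i => by
    have h : (chebSequence i).leadingCoeff = 1 := (cheb_monic_natDegree i).1.1
    rw [h]
    exact isUnit_one

theorem chebBasis_apply (n : ℕ) : chebBasis n = cheb n :=
  Polynomial.Sequence.basis_eq_self _ _ n

end Skein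
end

noncomputable section

namespace Skein

open Polynomial (X C)

/-! ### The Hopf pairing -/

/-- The class of the closure of the inverse full twist. -/
def untwisted (n : ℕ) : SkeinModule := annularBracket n (inverseBraid (fullTwist 0 n))

theorem toRatZ_untwisted (n : ℕ) :
    toRatZ (untwisted n) = zRat ^ n * tlTrace (braidProd (inverseBraid (fullTwist 0 n))) :=
  toRatZ_annularBracket (inverseBraid_lt (by simpa using fullTwist_lt 0 n))

theorem inverse_fullTwist_mem (n : ℕ) :
    braidProd (inverseBraid (fullTwist 0 n)) ∈ tlSub Frac hook n :=
  braidProd_mem (inverseBraid_lt (by simpa using fullTwist_lt 0 n))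

theorem twist_untwisted (n : ℕ) :
    twist (untwisted n) = C ((-LaurentPolynomial.T 3) ^ n) * X ^ n := by
  refine twist_eq_of_trace (inverse_fullTwist_mem n) (toRatZ_untwisted n) ?_
  rw [← braidProd_fullTwist, braidProd_inverseBraid_mul, tlTrace_one, mul_one, map_pow, toRatZ_X]

/-- Untwisting the two cables separately and twisting them jointly leaves exactly the linking
between them: the Hopf link as a braid. -/
theorem twist_untwisted_mul (m n : ℕ) :
    twist (untwisted m * untwisted n) = C ((-LaurentPolynomial.T 3) ^ (m + n)) *
      annularBracket (m + n)
        (fullTwist 0 (m + n) ++ inverseBraid (fullTwist 0 m) ++ inverseBraid (fullTwist m n)) := by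
  have hm : ∀ c ∈ inverseBraid (fullTwist 0 m), c.1 + 1 < m :=
    inverseBraid_lt (by simpa using fullTwist_lt 0 m)
  have hn : ∀ c ∈ inverseBraid (fullTwist 0 n), c.1 + 1 < n :=
    inverseBraid_lt (by simpa using fullTwist_lt 0 n)
  have hmn : ∀ c ∈ inverseBraid (fullTwist m n), c.1 + 1 < m + n :=
    inverseBraid_lt (fullTwist_lt m n)
  have hF : ∀ c ∈ fullTwist 0 (m + n), c.1 + 1 < m + n := by simpa using fullTwist_lt 0 (m + n)
  have hx : braidProd (inverseBraid (fullTwist 0 m)) * braidProd (inverseBraid (fullTwist m n)) ∈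
      tlSub Frac hook (m + n) :=
    mul_mem (tlSub_mono (by omega) (braidProd_mem hm)) (braidProd_mem hmn)
  refine twist_eq_of_trace hx ?_ ?_
  · rw [fullTwist_eq_shiftBraid m n, inverseBraid_shiftBraid, map_mul, toRatZ_untwisted,
      toRatZ_untwisted, tlTrace_juxtapose (braidProd_mem hm) hn, pow_add, mul_mul_mul_comm]
  · rw [toRatZ_annularBracket, braidProd_append, braidProd_append, braidProd_fullTwist, mul_assoc,
      tlTrace_comm (ftwist AF hook (m + n))]
    intro c hc
    simp only [List.mem_append] at hc
    rcases hc with (h | h) | h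
    · exact hF c h
    · have := hm c h; omega
    · exact hmn c h

/-- The inverse of the twist map. -/
def untwist : SkeinModule →ₗ[Scalar] SkeinModule :=
  (Polynomial.basisMonomials Scalar).constr Scalar fun n =>
    C ((-LaurentPolynomial.T (-3)) ^ n) * untwisted n

theorem untwist_X_pow (n : ℕ) :
    untwist (X ^ n) = C ((-LaurentPolynomial.T (-3)) ^ n) * untwisted n := by
  have h : (X ^ n : SkeinModule) = Polynomial.basisMonomials Scalar n :=
    (Polynomial.monomial_one_right_eq_X_pow n).symm.trans
      (congrFun (Polynomial.coe_basisMonomials _) n).symm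
  rw [h, untwist, Module.Basis.constr_basis]

theorem neg_T_pow_mul (n : ℕ) :
    ((-LaurentPolynomial.T (-3)) ^ n * (-LaurentPolynomial.T 3) ^ n : Scalar) = 1 := by
  rw [← mul_pow, neg_mul_neg, ← LaurentPolynomial.T_add, neg_add_cancel, LaurentPolynomial.T_zero,
    one_pow]

theorem twist_C_mul (r : Scalar) (x : SkeinModule) : twist (C r * x) = C r * twist x := by
  rw [← Polynomial.smul_eq_C_mul, map_smul, Polynomial.smul_eq_C_mul]

theorem untwist_C_mul (r : Scalar) (x : SkeinModule) : untwist (C r * x) = C r * untwist x := by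
  rw [← Polynomial.smul_eq_C_mul, map_smul, Polynomial.smul_eq_C_mul]

theorem twist_untwist (x : SkeinModule) : twist (untwist x) = x := by
  induction x using Polynomial.induction_on' with
  | add p q hp hq => rw [map_add, map_add, hp, hq]
  | monomial n r =>
    rw [← Polynomial.C_mul_X_pow_eq_monomial, untwist_C_mul, twist_C_mul, untwist_X_pow,
      twist_C_mul, twist_untwisted, ← mul_assoc (C _) (C _) (X ^ n), ← map_mul, neg_T_pow_mul,
      map_one, one_mul]

theorem mu_ne_zero (n : ℕ) : mu n ≠ 0 :=
  mul_ne_zero (pow_ne_zero _ (by simp)) (LaurentPolynomial.isUnit_T _).ne_zero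

/-- The inverse of the eigenvalue `mu n`. -/
def muInv (n : ℕ) : Scalar := (-1) ^ n * LaurentPolynomial.T (-((n : ℤ) ^ 2 + 2 * n))

theorem muInv_mul_mu (n : ℕ) : muInv n * mu n = 1 := by
  rw [muInv, mu, mul_mul_mul_comm, ← LaurentPolynomial.T_add, neg_add_cancel,
    LaurentPolynomial.T_zero, mul_one, ← mul_pow]
  simp

/-- The map is diagonal in the basis `chebBasis`, with invertible eigenvalues. -/
theorem twist_injective : Function.Injective twist := by
  have h : (chebBasis.constr Scalar fun n => C (muInv n) * cheb n) ∘ₗ twist = LinearMap.id := by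
    refine chebBasis.ext fun n => ?_
    rw [LinearMap.comp_apply, chebBasis_apply, twist_cheb, ← Polynomial.smul_eq_C_mul, map_smul,
      ← chebBasis_apply, Module.Basis.constr_basis, chebBasis_apply, Polynomial.smul_eq_C_mul,
      ← mul_assoc, ← map_mul, mul_comm (mu n), muInv_mul_mu, map_one, one_mul]
    rfl
  exact Function.LeftInverse.injective (g := chebBasis.constr Scalar fun n => C (muInv n) * cheb n)
    fun x => LinearMap.congr_fun h x

theorem untwist_cheb (n : ℕ) : untwist (cheb n) = C (muInv n) * cheb n := by
  apply twist_injective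
  rw [twist_untwist, twist_C_mul, twist_cheb, ← mul_assoc, ← map_mul, muInv_mul_mu, map_one,
    one_mul]

theorem hopfBracket_eq (m n : ℕ) :
    hopfBracket m n = (twist (untwist (X ^ m) * untwist (X ^ n))).eval delta := by
  have h : untwist (X ^ m) * untwist (X ^ n) =
      C ((-LaurentPolynomial.T (-3)) ^ (m + n)) * (untwisted m * untwisted n) := by
    rw [untwist_X_pow, untwist_X_pow, pow_add, map_mul]; ring
  rw [h, twist_C_mul, twist_untwisted_mul, ← mul_assoc, ← map_mul, neg_T_pow_mul, map_one, one_mul]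
  rfl

theorem untwist_eq_sum (x : SkeinModule) :
    untwist x = x.sum fun m c => c • untwist (X ^ m) := by
  conv_lhs => rw [x.as_sum_support_C_mul_X_pow]
  rw [map_sum, Polynomial.sum]
  exact Finset.sum_congr rfl fun i _ => by rw [untwist_C_mul, Polynomial.smul_eq_C_mul]

/-- The pairing in terms of the twist map. -/
theorem pairing_eq (x y : SkeinModule) :
    pairing x y = (twist (untwist x * untwist y)).eval delta := by
  rw [untwist_eq_sum x, untwist_eq_sum y]
  simp only [pairing, Polynomial.sum, Finset.sum_mul, Finset.mul_sum, map_sum,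
    Polynomial.eval_finsetSum]
  rw [Finset.sum_comm]
  refine Finset.sum_congr rfl fun i _ => Finset.sum_congr rfl fun j _ => ?_
  rw [smul_mul_smul_comm, map_smul, Polynomial.eval_smul, hopfBracket_eq, smul_eq_mul]

/-! ### The Hopf pairing in the Chebyshev basis -/

/-- The value of the twisted product of two eigenvectors. -/
def chebPair (m n : ℕ) : Frac := algebraMap Scalar Frac ((twist (cheb m * cheb n)).eval delta)

/-- The Chebyshev closed form under $x=-q-q^{-1}$; two consecutive cases are carried because the
recursion has two terms. -/
theorem cheb_eval_formula {q x : Frac} (hq : q ≠ 0) (hx : x = -q - q⁻¹) (m : ℕ) :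
    (q - q⁻¹) * Polynomial.aeval x (cheb m) = (-1) ^ m * (q ^ (m + 1) - (q ^ (m + 1))⁻¹) ∧
    (q - q⁻¹) * Polynomial.aeval x (cheb (m + 1)) =
      (-1) ^ (m + 1) * (q ^ (m + 2) - (q ^ (m + 2))⁻¹) := by
  induction m with
  | zero =>
    subst hx
    simp only [cheb, map_one, Polynomial.aeval_X]
    constructor
    · simp
    · field_simp
      ring
  | succ m ih =>
    refine ⟨ih.2, ?_⟩
    rw [cheb, map_sub, map_mul, Polynomial.aeval_X, mul_sub, mul_left_comm, ih.1, ih.2, hx]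
    field_simp
    ring

theorem algebraMap_eval (p : SkeinModule) (r : Scalar) :
    algebraMap Scalar Frac (p.eval r) = Polynomial.aeval (algebraMap Scalar Frac r) p := by
  rw [Polynomial.aeval_algebraMap_apply, Polynomial.coe_aeval_eq_eval]

theorem algebraMap_lam (n : ℕ) :
    algebraMap Scalar Frac (lam n) = -AF ^ (2 * ((n : ℤ) + 1)) - (AF ^ (2 * ((n : ℤ) + 1)))⁻¹ := by
  rw [lam, map_sub, map_neg, algebraMap_T, algebraMap_T, zpow_neg]

theorem lam_zero : lam 0 = delta := by
  simp [lam, delta]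

theorem algebraMap_mu (n : ℕ) :
    algebraMap Scalar Frac (mu n) = (-1) ^ n * AF ^ ((n : ℤ) ^ 2 + 2 * n) := by
  rw [mu, map_mul, algebraMap_T, map_pow, map_neg, map_one]

theorem cheb_delta (n : ℕ) :
    (AF ^ (2 : ℤ) - AF ^ (-2 : ℤ)) * algebraMap Scalar Frac ((cheb n).eval delta) =
      (-1) ^ n * (AF ^ (2 * ((n : ℤ) + 1)) - AF ^ (-(2 * ((n : ℤ) + 1)))) := by
  have := (cheb_eval_formula (q := AF ^ (2 : ℤ)) (x := algebraMap Scalar Frac delta)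
    (zpow_ne_zero _ AF_ne_zero) (by rw [← lam_zero, algebraMap_lam]; simp) n).1
  rw [← zpow_natCast (AF ^ (2 : ℤ)), ← zpow_mul, ← zpow_neg, ← zpow_neg, ← algebraMap_eval] at this
  rw [this]
  push_cast
  rfl

theorem chebPair_comm (m n : ℕ) : chebPair m n = chebPair n m := by
  rw [chebPair, mul_comm, chebPair]

/-- `A ^ (k ^ 2 - 2)`. -/
def quadPow (k : ℤ) : Frac := AF ^ (k ^ 2 - 2)

theorem quadPow_neg (k : ℤ) : quadPow (-k) = quadPow k := by rw [quadPow, neg_sq, quadPow]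

theorem chebPair_zero (n : ℕ) :
    (AF ^ (2 : ℤ) - AF ^ (-2 : ℤ)) * chebPair 0 n = quadPow (n + 2) - quadPow n := by
  have h1 : ((-1 : Frac) ^ n) * (-1) ^ n = 1 := by rw [← mul_pow]; simp
  rw [chebPair, cheb, one_mul, twist_cheb, Polynomial.eval_C_mul, map_mul, mul_left_comm,
    cheb_delta, algebraMap_mu, mul_mul_mul_comm, h1, one_mul, mul_sub, ← zpow_add₀ AF_ne_zero,
    ← zpow_add₀ AF_ne_zero, quadPow, quadPow]
  congr 2 <;> ring

/-- Expresses $(zS_{m+1})S_{n+1}=S_{m+1}(zS_{n+1})$: a discrete wave equation in $(m,n)$. -/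
theorem chebPair_step (m n : ℕ) :
    chebPair (m + 2) (n + 1) = chebPair (m + 1) (n + 2) + chebPair (m + 1) n - chebPair m (n + 1) := by
  simp only [chebPair]
  rw [← map_add, ← map_sub, ← Polynomial.eval_add, ← Polynomial.eval_sub, ← map_add, ← map_sub]
  congr 3
  rw [cheb, cheb]
  ring

theorem chebPair_one (n : ℕ) : chebPair 1 (n + 1) = chebPair 0 (n + 2) + chebPair 0 n := by
  simp only [chebPair]
  rw [← map_add, ← Polynomial.eval_add, ← map_add]
  congr 3
  simp only [cheb]
  ring

/-- Functions of $m+n$ and of $m-n$ solve the wave equation. Symmetry and the row $m=0$, which is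
known from the twist eigenvalues, determine the solution. -/
theorem chebPair_eq (m n : ℕ) :
    (AF ^ (2 : ℤ) - AF ^ (-2 : ℤ)) * chebPair m n = quadPow (m + n + 2) - quadPow (m - n) := by
  induction m using Nat.strong_induction_on generalizing n with
  | _ m ih =>
  match m, n with
  | 0, n => rw [chebPair_zero, ← quadPow_neg n]; simp
  | m + 1, 0 => rw [chebPair_comm, chebPair_zero]; simp
  | 1, n + 1 =>
    have e1 : ((n + 2 : ℕ) : ℤ) + 2 = (1 : ℕ) + ((n + 1 : ℕ) : ℤ) + 2 := by push_cast; ring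
    have e2 : ((n + 2 : ℕ) : ℤ) = (n : ℤ) + 2 := by push_cast; ring
    have e3 : -(n : ℤ) = ((1 : ℕ) : ℤ) - ((n + 1 : ℕ) : ℤ) := by push_cast; ring
    rw [chebPair_one, mul_add, chebPair_zero, chebPair_zero, e1, ← quadPow_neg n, e2, e3]
    ring
  | m + 2, n + 1 =>
    rw [chebPair_step, mul_sub, mul_add, ih (m + 1) (by omega), ih (m + 1) (by omega),
      ih m (by omega)]
    have e1 : ((m + 1 : ℕ) : ℤ) + ((n + 2 : ℕ) : ℤ) + 2 = ((m + 2 : ℕ) : ℤ) + ((n + 1 : ℕ) : ℤ) + 2 := by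
      push_cast; ring
    have e2 : ((m + 1 : ℕ) : ℤ) - ((n + 2 : ℕ) : ℤ) = (m : ℤ) - ((n + 1 : ℕ) : ℤ) := by
      push_cast; ring
    have e3 : ((m + 1 : ℕ) : ℤ) + (n : ℤ) + 2 = (m : ℤ) + ((n + 1 : ℕ) : ℤ) + 2 := by
      push_cast; ring
    have e4 : ((m + 1 : ℕ) : ℤ) - (n : ℤ) = ((m + 2 : ℕ) : ℤ) - ((n + 1 : ℕ) : ℤ) := by
      push_cast; ring
    rw [e1, e2, e3, e4]
    ring

theorem AF_sub_ne_zero : AF ^ (2 : ℤ) - AF ^ (-2 : ℤ) ≠ 0 := by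
  have := brace_succ_ne_zero 0
  rw [brace, a_eq] at this
  simpa [zpow_neg] using this

/-- After multiplication by the two twist eigenvalues, it suffices to note
$(m+n+2)^2-2=(m^2+2m)+(n^2+2n)+2(m+1)(n+1)$ and the same with $(m-n)^2$ and a minus sign before the
last term. -/
theorem pairing_cheb_cheb (m n : ℕ) :
    pairing (cheb m) (cheb n) = (cheb m).eval (lam n) * (cheb n).eval delta := by
  have hA := AF_ne_zero
  apply FaithfulSMul.algebraMap_injective Scalar Frac
  have h1 : algebraMap Scalar Frac (pairing (cheb m) (cheb n)) =
      algebraMap Scalar Frac (muInv m * muInv n) * chebPair m n := by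
    rw [pairing_eq, untwist_cheb, untwist_cheb, mul_mul_mul_comm, ← map_mul, twist_C_mul,
      Polynomial.eval_C_mul, map_mul, chebPair]
  set M := algebraMap Scalar Frac (mu m * mu n) with hM
  have hM0 : M ≠ 0 := by
    rw [hM, Ne, FaithfulSMul.algebraMap_eq_zero_iff]
    exact mul_ne_zero (mu_ne_zero m) (mu_ne_zero n)
  have h2 : M * algebraMap Scalar Frac (muInv m * muInv n) = 1 := by
    rw [hM, ← map_mul, mul_mul_mul_comm, mul_comm (mu m), mul_comm (mu n), muInv_mul_mu,
      muInv_mul_mu, one_mul, map_one]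
  refine mul_left_cancel₀ AF_sub_ne_zero (mul_left_cancel₀ hM0 ?_)
  rw [mul_left_comm, h1, ← mul_assoc M, h2, one_mul, chebPair_eq, map_mul,
    mul_left_comm _ (algebraMap Scalar Frac ((cheb m).eval (lam n))), cheb_delta]
  have h3 := (cheb_eval_formula (q := AF ^ (2 * ((n : ℤ) + 1))) (x := algebraMap Scalar Frac (lam n))
    (zpow_ne_zero _ hA) (algebraMap_lam n) m).1
  rw [← zpow_neg, ← zpow_natCast (AF ^ (2 * ((n : ℤ) + 1))), ← zpow_mul, ← zpow_neg,
    ← algebraMap_eval] at h3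
  have h4 : ∀ k : ℕ, ((-1 : Frac) ^ k) * (-1) ^ k = 1 := fun k => by rw [← mul_pow]; simp
  rw [mul_left_comm (algebraMap Scalar Frac ((cheb m).eval (lam n))),
    mul_comm (algebraMap Scalar Frac ((cheb m).eval (lam n))), h3, hM, map_mul, algebraMap_mu,
    algebraMap_mu]
  rw [show ∀ s t x y z : Frac, s * x * (t * y) * (t * (s * z)) = (s * s) * (t * t) * (x * y * z) from
    fun s t x y z => by ring, h4, h4, one_mul, one_mul, mul_sub, ← zpow_add₀ hA, ← zpow_add₀ hA,
    ← zpow_add₀ hA, quadPow, quadPow]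
  push_cast
  congr 2 <;> ring

/-- Encircling strands act on the `cheb n` by scalars. -/
theorem pairing_cheb (x : SkeinModule) (n : ℕ) :
    pairing x (cheb n) = x.eval (lam n) * (cheb n).eval delta := by
  -- Both sides are linear in `x`, so the basis `chebBasis` suffices.
  have h : Polynomial.leval delta ∘ₗ twist ∘ₗ LinearMap.mulRight Scalar (untwist (cheb n)) ∘ₗ
      untwist = LinearMap.mulRight Scalar ((cheb n).eval delta) ∘ₗ Polynomial.leval (lam n) := by
    refine chebBasis.ext fun m => ?_
    rw [chebBasis_apply]
    exact (pairing_eq _ _).symm.trans (pairing_cheb_cheb m n)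
  rw [pairing_eq]
  exact LinearMap.congr_fun h x

theorem bracket_twist_cheb (n : ℕ) :
    bracket (twist (cheb n)) = mu n * (cheb n).eval delta := by
  have := pairing_cheb (twist (cheb n)) 0
  rw [cheb, lam_zero, Polynomial.eval_one, mul_one] at this
  rw [bracket, this, twist_cheb, Polynomial.eval_C_mul]

theorem cheb_delta_ne_zero (n : ℕ) : (cheb n).eval delta ≠ 0 := by
  intro h
  have h1 := cheb_delta n
  rw [h, map_zero, mul_zero] at h1
  have h2 := brace_succ_ne_zero n
  rw [brace, a_eq, ← zpow_natCast AF 2, ← zpow_mul, ← zpow_mul] at h2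
  have h3 : AF ^ (2 * ((n : ℤ) + 1)) - AF ^ (-(2 * ((n : ℤ) + 1))) ≠ 0 := by
    convert h2 using 3 <;> push_cast <;> ring
  exact mul_ne_zero (pow_ne_zero n (by simp)) h3 h1.symm

/-! ### The even part -/

theorem cheb_add_four (n : ℕ) : cheb (n + 4) = X ^ 2 * cheb (n + 2) - 2 * cheb (n + 2) - cheb n := by
  rw [cheb, cheb]
  have : cheb (n + 2) = X * cheb (n + 1) - cheb n := by rw [cheb]
  linear_combination this

theorem X_sq_mul_mem_evenPart {x : SkeinModule} (hx : x ∈ evenPart) : X ^ 2 * x ∈ evenPart := by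
  have : evenPart ≤ evenPart.comap (LinearMap.mulLeft Scalar (X ^ 2 : SkeinModule)) := by
    conv_lhs => rw [evenPart]
    refine Submodule.span_le.2 ?_
    rintro _ ⟨k, rfl⟩
    refine Submodule.subset_span ⟨k + 1, ?_⟩
    simp only [LinearMap.mulLeft_apply]
    ring
  exact this hx

theorem cheb_even_mem (k : ℕ) : cheb (2 * k) ∈ evenPart := by
  have h0 : (1 : SkeinModule) ∈ evenPart := Submodule.subset_span ⟨0, by simp⟩
  suffices h : ∀ k, cheb (2 * k) ∈ evenPart ∧ cheb (2 * k + 2) ∈ evenPart from (h k).1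
  intro k
  induction k with
  | zero =>
    refine ⟨h0, ?_⟩
    have : cheb (2 * 0 + 2) = X ^ 2 * 1 - 1 := by simp only [cheb]; ring
    rw [this]
    exact sub_mem (X_sq_mul_mem_evenPart h0) h0
  | succ k ih =>
    refine ⟨ih.2, ?_⟩
    rw [show 2 * (k + 1) + 2 = 2 * k + 4 by ring, cheb_add_four, two_mul (cheb _)]
    exact sub_mem (sub_mem (X_sq_mul_mem_evenPart ih.2) (add_mem ih.2 ih.2)) ih.1

/-- Both spans are stable under $z^2$, by the even-step recursion $S_{n+4}=(z^2-2)S_{n+2}-S_n$, and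
both contain 1. -/
theorem evenPart_eq_span : evenPart = Submodule.span Scalar (Set.range fun k => cheb (2 * k)) := by
  apply le_antisymm
  · set S := Submodule.span Scalar (Set.range fun k => cheb (2 * k)) with hS
    have hmem : ∀ k, cheb (2 * k) ∈ S := fun k => Submodule.subset_span ⟨k, rfl⟩
    have hX : ∀ x ∈ S, X ^ 2 * x ∈ S := by
      intro x hx
      have : S ≤ S.comap (LinearMap.mulLeft Scalar (X ^ 2 : SkeinModule)) := by
        conv_lhs => rw [hS]
        refine Submodule.span_le.2 ?_
        rintro _ ⟨k, rfl⟩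
        change X ^ 2 * cheb (2 * k) ∈ S
        cases k with
        | zero =>
          have : X ^ 2 * cheb (2 * 0) = cheb (2 * 1) + cheb (2 * 0) := by
            simp only [cheb]; ring
          rw [this]
          exact add_mem (hmem 1) (hmem 0)
        | succ k =>
          have e : cheb (2 * (k + 2)) =
              X ^ 2 * cheb (2 * (k + 1)) - 2 * cheb (2 * (k + 1)) - cheb (2 * k) := by
            rw [show 2 * (k + 2) = 2 * k + 4 by ring, show 2 * (k + 1) = 2 * k + 2 by ring,
              cheb_add_four]
          have : X ^ 2 * cheb (2 * (k + 1)) =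
              cheb (2 * (k + 2)) + (cheb (2 * (k + 1)) + cheb (2 * (k + 1))) + cheb (2 * k) := by
            rw [e]; ring
          rw [this]
          exact add_mem (add_mem (hmem _) (add_mem (hmem _) (hmem _))) (hmem _)
      exact this hx
    refine Submodule.span_le.2 ?_
    rintro _ ⟨k, rfl⟩
    induction k with
    | zero => simpa [cheb] using hmem 0
    | succ k ih =>
      have e : (X ^ (2 * (k + 1)) : SkeinModule) = X ^ 2 * X ^ (2 * k) := by ring
      change X ^ (2 * (k + 1)) ∈ S
      rw [e]
      exact hX _ ih
  · refine Submodule.span_le.2 ?_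
    rintro _ ⟨k, rfl⟩
    exact cheb_even_mem k

end Skein
end

noncomputable section

namespace Skein

open Polynomial (X C)

/-! ### Series as functions of the points `λ_{2k}` -/

/-- The value of `R_n` at `λ_{2k}`. -/
def RVal (n k : ℕ) : Frac := algebraMap Scalar Frac ((R n).eval (lam (2 * k)))

/-- The value of a series at `λ_{2k}`, which is a finite sum. -/
def Series.value (c : Series) (k : ℕ) : Frac := ∑ n ∈ Finset.range (k + 1), c n * RVal n k

theorem RVal_eq_prod (n k : ℕ) :
    RVal n k = ∏ i ∈ Finset.range n, algebraMap Scalar Frac (lam (2 * k) - lam (2 * i)) := by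
  rw [RVal, R, Polynomial.eval_prod, map_prod]
  simp

theorem RVal_zero (k : ℕ) : RVal 0 k = 1 := by simp [RVal_eq_prod]

theorem RVal_eq_zero {n k : ℕ} (h : k < n) : RVal n k = 0 := by
  rw [RVal_eq_prod]
  exact Finset.prod_eq_zero (Finset.mem_range.2 h) (by simp)

theorem a_zpow (k : ℤ) : a ^ k = AF ^ (2 * k) := by
  rw [a_eq, ← zpow_natCast AF 2, ← zpow_mul]; rfl

theorem algebraMap_lam_a (n : ℕ) :
    algebraMap Scalar Frac (lam n) = -a ^ ((n : ℤ) + 1) - a ^ (-((n : ℤ) + 1)) := by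
  rw [algebraMap_lam, a_zpow, a_zpow, ← zpow_neg, mul_neg]

/-- Makes $R_n(\lambda_{2k})$ a signed product of quantum integers, nonzero for $n\le k$. -/
theorem lam_sub_lam {i k : ℕ} (h : i ≤ k) :
    algebraMap Scalar Frac (lam (2 * k) - lam (2 * i)) = -(brace (k + i + 1) * brace (k - i)) := by
  have ha := a_ne_zero
  obtain ⟨d, rfl⟩ := Nat.exists_eq_add_of_le h
  rw [map_sub, algebraMap_lam_a, algebraMap_lam_a, brace, brace, Nat.add_sub_cancel_left]
  rw [sub_mul, mul_sub, mul_sub, ← zpow_add₀ ha, ← zpow_add₀ ha, ← zpow_add₀ ha, ← zpow_add₀ ha]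
  have e1 : ((i + d + i + 1 : ℕ) : ℤ) + (d : ℤ) = ((2 * (i + d) : ℕ) : ℤ) + 1 := by push_cast; ring
  have e2 : ((i + d + i + 1 : ℕ) : ℤ) + -(d : ℤ) = ((2 * i : ℕ) : ℤ) + 1 := by push_cast; ring
  have e3 : -((i + d + i + 1 : ℕ) : ℤ) + (d : ℤ) = -(((2 * i : ℕ) : ℤ) + 1) := by push_cast; ring
  have e4 : -((i + d + i + 1 : ℕ) : ℤ) + -(d : ℤ) = -(((2 * (i + d) : ℕ) : ℤ) + 1) := by
    push_cast; ring
  rw [e1, e2, e3, e4]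
  ring

theorem RVal_self_ne_zero (n : ℕ) : RVal n n ≠ 0 := by
  rw [RVal_eq_prod]
  refine Finset.prod_ne_zero_iff.2 fun i hi => ?_
  have hi := Finset.mem_range.1 hi
  rw [lam_sub_lam hi.le]
  obtain ⟨d, rfl⟩ : ∃ d, n = i + (d + 1) := ⟨n - i - 1, by omega⟩
  rw [Nat.add_sub_cancel_left]
  exact neg_ne_zero.2 (mul_ne_zero (brace_succ_ne_zero _) (brace_succ_ne_zero _))

/-- Evaluation at $\lambda_0,\lambda_2,\dots$ is triangular with nonzero diagonal `RVal n n`. -/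
theorem Series.value_injective {c d : Series} (h : ∀ k, c.value k = d.value k) : c = d := by
  funext n
  induction n using Nat.strong_induction_on with
  | _ n ih =>
    have h1 := h n
    simp only [Series.value, Finset.sum_range_succ] at h1
    rw [Finset.sum_congr rfl (g := fun i => d i * RVal i n)
      fun i hi => by rw [ih i (Finset.mem_range.1 hi)]] at h1
    exact mul_right_cancel₀ (RVal_self_ne_zero n) (add_left_cancel h1)

theorem RBasis_apply (n : ℕ) : RBasis n = R n :=
  Polynomial.Sequence.basis_eq_self _ _ n

theorem RVal_mul (n m k : ℕ) :
    RVal n k * RVal m k =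
      ∑ j ∈ Finset.range (k + 1), algebraMap Scalar Frac (structConst n m j) * RVal j k := by
  have h := congrArg (fun p => algebraMap Scalar Frac (p.eval (lam (2 * k))))
    (RBasis.linearCombination_repr (R n * R m))
  simp only [Finsupp.linearCombination_apply, Finsupp.sum, Polynomial.eval_finsetSum, map_sum,
    Polynomial.eval_smul, RBasis_apply, Polynomial.eval_mul, map_mul, smul_eq_mul] at h
  rw [RVal, RVal, ← h]
  have h1 : ∀ j, j ∉ (RBasis.repr (R n * R m)).support →
      algebraMap Scalar Frac (structConst n m j) * RVal j k = 0 := fun j hj => by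
    rw [structConst, Finsupp.notMem_support_iff.1 hj, map_zero, zero_mul]
  have h2 : ∀ j, j ∉ Finset.range (k + 1) →
      algebraMap Scalar Frac (structConst n m j) * RVal j k = 0 := fun j hj => by
    rw [RVal_eq_zero (by simpa using hj), mul_zero]
  -- The expansion runs over the support of the coordinates, the claim over $j\le k$. Terms outside
  -- either set vanish, so both sums equal the one over the union.
  exact (Finset.sum_subset (Finset.subset_union_left (s₂ := Finset.range (k + 1)))
    fun j _ hj => h1 j hj).trans
    (Finset.sum_subset Finset.subset_union_right fun j _ hj => h2 j hj).symm

/-- Evaluate the expansion of $R_nR_m$ at $\lambda_{2j}$: the left side vanishes, earlier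
coefficients vanish by induction, and $R_j(\lambda_{2j})\neq0$. -/
theorem structConst_eq_zero {n m j : ℕ} (h : j < n ∨ j < m) :
    algebraMap Scalar Frac (structConst n m j) = 0 := by
  induction j using Nat.strong_induction_on with
  | _ j ih =>
    have h1 := RVal_mul n m j
    have h2 : RVal n j * RVal m j = 0 := by
      rcases h with h | h <;> rw [RVal_eq_zero h] <;> simp
    rw [h2, Finset.sum_range_succ, Finset.sum_eq_zero, zero_add] at h1
    · exact (mul_eq_zero.1 h1.symm).resolve_right (RVal_self_ne_zero j)
    · intro i hi
      have hi := Finset.mem_range.1 hi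
      rw [ih i hi (by omega), zero_mul]

theorem Series.value_mul (c d : Series) (k : ℕ) :
    (c.mul d).value k = c.value k * d.value k := by
  have h1 : ∀ j ∈ Finset.range (k + 1), c.mul d j * RVal j k =
      ∑ n ∈ Finset.range (k + 1), ∑ m ∈ Finset.range (k + 1),
        c n * d m * (algebraMap Scalar Frac (structConst n m j) * RVal j k) := by
    intro j hj
    have hj : j + 1 ≤ k + 1 := by have := Finset.mem_range.1 hj; omega
    have hsub : Finset.range (j + 1) ⊆ Finset.range (k + 1) := Finset.range_mono hj
    rw [Series.mul, Finset.sum_mul]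
    simp only [Finset.sum_mul, mul_assoc]
    rw [Finset.sum_subset hsub]
    · refine Finset.sum_congr rfl fun n _ => Finset.sum_subset hsub fun m _ hm => ?_
      rw [structConst_eq_zero (Or.inr (by simpa using hm))]; simp
    · intro n _ hn
      refine Finset.sum_eq_zero fun m _ => ?_
      rw [structConst_eq_zero (Or.inl (by simpa using hn))]; simp
  rw [Series.value, Finset.sum_congr rfl h1, Finset.sum_comm, Series.value, Series.value,
    Finset.sum_mul_sum]
  refine Finset.sum_congr rfl fun n _ => ?_
  rw [Finset.sum_comm]
  refine Finset.sum_congr rfl fun m _ => ?_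
  rw [← Finset.mul_sum, ← RVal_mul]
  ring

theorem Series.value_one (k : ℕ) : Series.one.value k = 1 := by
  rw [Series.value, Finset.sum_eq_single 0]
  · simp [Series.one, RVal_zero]
  · intro n _ hn; simp [Series.one, hn]
  · simp

theorem Series.value_pow (c : Series) (p k : ℕ) : (c.pow p).value k = c.value k ^ p := by
  induction p with
  | zero => rw [Series.pow, Series.value_one, pow_zero]
  | succ p ih => rw [Series.pow, Series.value_mul, ih, pow_succ]

theorem conj_algebraMap (f : Scalar) :
    conj (algebraMap Scalar Frac f) = algebraMap Scalar Frac (LaurentPolynomial.invert f) :=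
  IsFractionRing.ringEquivOfRingEquiv_algebraMap _ f

theorem conj_AF : conj AF = AF⁻¹ := by
  rw [AF, conj_algebraMap, LaurentPolynomial.invert_T, algebraMap_T, ← zpow_neg_one]
  rfl

theorem conj_a : conj a = a⁻¹ := by rw [a_eq, map_pow, conj_AF, inv_pow]

theorem invert_lam (n : ℕ) : LaurentPolynomial.invert (lam n) = lam n := by
  rw [lam, map_sub, map_neg, LaurentPolynomial.invert_T, LaurentPolynomial.invert_T, neg_neg]
  ring

theorem conj_RVal (n k : ℕ) : conj (RVal n k) = RVal n k := by
  rw [RVal_eq_prod, map_prod]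
  refine Finset.prod_congr rfl fun i _ => ?_
  rw [conj_algebraMap, map_sub, invert_lam, invert_lam]

theorem Series.value_conj (c : Series) (k : ℕ) : c.conj.value k = Skein.conj (c.value k) := by
  rw [Series.value, Series.value, map_sum]
  refine Finset.sum_congr rfl fun n _ => ?_
  rw [map_mul, conj_RVal]
  rfl

theorem algebraMap_mu_even (k : ℕ) :
    algebraMap Scalar Frac (mu (2 * k)) = a ^ (2 * k * (k + 1)) := by
  rw [algebraMap_mu, pow_mul, neg_one_sq, one_pow, one_mul, ← zpow_natCast, a_zpow]
  congr 1; push_cast; ring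

theorem pairing_R_cheb (n k : ℕ) : algebraMap Scalar Frac (pairing (R n) (cheb (2 * k))) =
    RVal n k * algebraMap Scalar Frac ((cheb (2 * k)).eval delta) := by
  rw [pairing_cheb, map_mul, RVal]

/-- On $S_{2k}$ both sides carry the nonzero factor $S_{2k}(\delta)$; what remains is the value of
the series against the twist eigenvalue. Linearity extends this to the whole even part. -/
theorem isOmega_iff (c : Series) : IsOmega c ↔ ∀ k, c.value k = a ^ (2 * k * (k + 1)) := by
  have hsupp : ∀ k, (Function.support fun n =>
      c n * algebraMap Scalar Frac (pairing (R n) (cheb (2 * k)))) ⊆ Finset.range (k + 1) := by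
    intro k n hn
    by_contra h
    refine hn ?_
    simp only
    rw [pairing_R_cheb, RVal_eq_zero (by simpa using h), zero_mul, mul_zero]
  have hsum : ∀ k, ∑ᶠ n, c n * algebraMap Scalar Frac (pairing (R n) (cheb (2 * k))) =
      c.value k * algebraMap Scalar Frac ((cheb (2 * k)).eval delta) := by
    intro k
    rw [finsum_eq_sum_of_support_subset _ (hsupp k), Series.value, Finset.sum_mul]
    exact Finset.sum_congr rfl fun n _ => by rw [pairing_R_cheb, mul_assoc]
  have hδ : ∀ k, algebraMap Scalar Frac ((cheb (2 * k)).eval delta) ≠ 0 := fun k => by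
    rw [Ne, FaithfulSMul.algebraMap_eq_zero_iff]
    exact cheb_delta_ne_zero _
  constructor
  · intro h k
    have h1 := (h _ (cheb_even_mem k)).2
    rw [hsum, bracket_twist_cheb, map_mul, algebraMap_mu_even] at h1
    exact mul_right_cancel₀ (hδ k) h1
  · intro h x hx
    have hpair : ∀ (n : ℕ) (x y : SkeinModule),
        pairing (R n) (x + y) = pairing (R n) x + pairing (R n) y := fun n x y => by
      simp only [pairing_eq, map_add, mul_add, Polynomial.eval_add]
    have hpair' : ∀ (n : ℕ) (r : Scalar) (x : SkeinModule),
        pairing (R n) (r • x) = r * pairing (R n) x := fun n r x => by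
      simp only [pairing_eq, map_smul, mul_smul_comm, Polynomial.eval_smul, smul_eq_mul]
    have hbr : ∀ x, bracket x = x.eval delta := fun x => by
      have := pairing_cheb x 0
      rwa [cheb, lam_zero, Polynomial.eval_one, mul_one] at this
    rw [evenPart_eq_span] at hx
    induction hx using Submodule.span_induction with
    | mem x hx =>
      obtain ⟨k, rfl⟩ := hx
      refine ⟨(Finset.finite_toSet _).subset (hsupp k), ?_⟩
      simp only
      rw [hsum, h, bracket_twist_cheb, map_mul, algebraMap_mu_even]
    | zero =>
      have h0 : ∀ n, pairing (R n) 0 = 0 := fun n => by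
        simpa using hpair' n 0 0
      simp [h0, hbr]
    | add x y _ _ hx hy =>
      have e : (fun n => c n * algebraMap Scalar Frac (pairing (R n) (x + y))) = fun n =>
          c n * algebraMap Scalar Frac (pairing (R n) x) +
            c n * algebraMap Scalar Frac (pairing (R n) y) := by
        funext n; rw [hpair, map_add, mul_add]
      rw [e, finsum_add_distrib hx.1 hy.1, hx.2, hy.2]
      refine ⟨(hx.1.union hy.1).subset (Function.support_add _ _), ?_⟩
      rw [hbr, hbr, hbr, map_add, Polynomial.eval_add, map_add]
    | smul r x _ hx =>
      have e : (fun n => c n * algebraMap Scalar Frac (pairing (R n) (r • x))) = fun n =>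
          algebraMap Scalar Frac r * (c n * algebraMap Scalar Frac (pairing (R n) x)) := by
        funext n; rw [hpair', map_mul, mul_left_comm]
      rw [e, ← mul_finsum, hx.2]
      refine ⟨hx.1.subset fun n hn h0 => hn (by simp only at h0 ⊢; rw [h0, mul_zero]), ?_⟩
      rw [hbr, hbr, map_smul, Polynomial.eval_smul, smul_eq_mul, map_mul]

/-! ### A summation formula -/

/-- The quantum binomial coefficients. -/
def qBinom (l j : ℕ) : Frac := (∏ i ∈ Finset.range j, brace (l - i)) / braceFactorial j

theorem braceFactorial_ne_zero (n : ℕ) : braceFactorial n ≠ 0 :=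
  Finset.prod_ne_zero_iff.2 fun i _ => brace_succ_ne_zero i

theorem braceFactorial_succ (n : ℕ) :
    braceFactorial (n + 1) = braceFactorial n * brace (n + 1) := Finset.prod_range_succ _ _

theorem brace_zero : brace 0 = 0 := by simp [brace]

theorem qBinom_zero_right (l : ℕ) : qBinom l 0 = 1 := by simp [qBinom, braceFactorial]

theorem qBinom_of_lt {l j : ℕ} (h : l < j) : qBinom l j = 0 := by
  rw [qBinom, Finset.prod_eq_zero (Finset.mem_range.2 h) (by rw [Nat.sub_self, brace_zero]),
    zero_div]

theorem qBinom_pascal {l j : ℕ} (h : j ≤ l) :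
    qBinom (l + 1) (j + 1) =
      a ^ ((j : ℤ) + 1) * qBinom l (j + 1) + a ^ (-((l : ℤ) - j)) * qBinom l j := by
  have ha := a_ne_zero
  have h1 : brace (l + 1) =
      a ^ ((j : ℤ) + 1) * brace (l - j) + a ^ (-((l : ℤ) - j)) * brace (j + 1) := by
    obtain ⟨d, rfl⟩ := Nat.exists_eq_add_of_le h
    rw [Nat.add_sub_cancel_left]
    simp only [brace, mul_sub, ← zpow_add₀ ha]
    have e1 : (j : ℤ) + 1 + d = ((j + d + 1 : ℕ) : ℤ) := by push_cast; ring
    have e2 : -(((j + d : ℕ) : ℤ) - j) + -((j + 1 : ℕ) : ℤ) = -((j + d + 1 : ℕ) : ℤ) := by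
      push_cast; ring
    have e3 : -(((j + d : ℕ) : ℤ) - j) + ((j + 1 : ℕ) : ℤ) = (j : ℤ) + 1 + -d := by
      push_cast; ring
    rw [e1, e2, e3]
    ring
  have hf := braceFactorial_ne_zero j
  have hb := brace_succ_ne_zero j
  simp only [qBinom]
  rw [Finset.prod_range_succ', Finset.prod_range_succ, braceFactorial_succ]
  simp only [Nat.add_sub_add_right, Nat.sub_zero]
  rw [h1]
  field_simp

theorem mul_braceFactorial (m j : ℕ) :
    (∏ i ∈ Finset.range j, brace (m + j - i)) * braceFactorial m = braceFactorial (m + j) := by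
  induction j with
  | zero => simp
  | succ j ih =>
    rw [Finset.prod_range_succ', ← add_assoc m j 1, braceFactorial_succ, ← ih]
    simp only [Nat.add_sub_add_right, Nat.sub_zero]
    ring

theorem qBinom_eq (m j : ℕ) :
    qBinom (m + j) j = braceFactorial (m + j) / (braceFactorial j * braceFactorial m) := by
  have hj := braceFactorial_ne_zero j
  have hm := braceFactorial_ne_zero m
  rw [← mul_braceFactorial, qBinom]
  field_simp

/-- The source of all integrality: Pascal's rule has monomial coefficients. -/
theorem qBinom_mem_range (l j : ℕ) : qBinom l j ∈ (algebraMap Scalar Frac).range := by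
  have ha : ∀ k : ℤ, a ^ k ∈ (algebraMap Scalar Frac).range := fun k =>
    ⟨LaurentPolynomial.T (2 * k), by rw [algebraMap_T, a_zpow]⟩
  induction l generalizing j with
  | zero =>
    cases j with
    | zero => rw [qBinom_zero_right]; exact one_mem _
    | succ j => rw [qBinom_of_lt (by omega)]; exact zero_mem _
  | succ l ih =>
    cases j with
    | zero => rw [qBinom_zero_right]; exact one_mem _
    | succ j =>
      rcases Nat.lt_or_ge l j with h | h
      · rw [qBinom_of_lt (by omega)]; exact zero_mem _
      · rw [qBinom_pascal h]
        exact add_mem (mul_mem (ha _) (ih _)) (mul_mem (ha _) (ih _))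

/-- The exponents `j (j + 3) / 2`. -/
def tri (j : ℕ) : ℕ := j * (j + 3) / 2

theorem tri_add (m j : ℕ) : tri (m + j) = tri m + tri j + m * j := by
  have h : ∀ n, 2 * tri n = n * (n + 3) := fun n => by
    have : Even (n * (n + 3)) := by
      rw [Nat.even_mul, Nat.even_add]
      have : ¬ Even 3 := by decide
      tauto
    exact Nat.two_mul_div_two_of_even this
  have h1 := h (m + j)
  have h2 := h m
  have h3 := h j
  nlinarith

theorem tri_succ (j : ℕ) : tri (j + 1) = tri j + j + 2 := by
  rw [tri_add, show tri 1 = 2 from rfl]; omega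

/-- The summands of the summation formula. -/
def sumTerm (l M j : ℕ) : Frac :=
  a ^ ((tri j : ℤ) + ((M : ℤ) - l) * j) * qBinom l j *
    ∏ i ∈ Finset.range j, brace (M + 1 + i)

/-- Pascal's rule splits the term so that the second part belongs to the same family with $M$
replaced by $M+1$. -/
theorem sumTerm_succ {l j : ℕ} (M : ℕ) (h : j ≤ l) :
    sumTerm (l + 1) M (j + 1) = sumTerm l M (j + 1) +
      a ^ ((M : ℤ) - 2 * l + 1) * brace (M + 1) * sumTerm l (M + 1) j := by
  have ha := a_ne_zero
  simp only [sumTerm]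
  rw [qBinom_pascal h]
  have hP : ∏ i ∈ Finset.range (j + 1), brace (M + 1 + i) =
      brace (M + 1) * ∏ i ∈ Finset.range j, brace (M + 1 + 1 + i) := by
    rw [Finset.prod_range_succ', mul_comm, Nat.add_zero]
    congr 1
    exact Finset.prod_congr rfl fun i _ => by congr 1; omega
  have e1 : a ^ ((tri (j + 1) : ℤ) + ((M : ℤ) - l) * ((j + 1 : ℕ) : ℤ)) =
      a ^ ((tri (j + 1) : ℤ) + ((M : ℤ) - (l + 1 : ℕ)) * ((j + 1 : ℕ) : ℤ)) * a ^ ((j : ℤ) + 1) := by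
    rw [← zpow_add₀ ha]; congr 1; push_cast; ring
  have e2 : a ^ ((tri (j + 1) : ℤ) + ((M : ℤ) - (l + 1 : ℕ)) * ((j + 1 : ℕ) : ℤ)) *
      a ^ (-((l : ℤ) - j)) =
      a ^ ((M : ℤ) - 2 * l + 1) * a ^ ((tri j : ℤ) + (((M + 1 : ℕ) : ℤ) - l) * j) := by
    rw [← zpow_add₀ ha, ← zpow_add₀ ha, tri_succ]; congr 1; push_cast; ring
  rw [hP, e1]
  linear_combination (qBinom l j * (brace (M + 1) * ∏ i ∈ Finset.range j, brace (M + 1 + 1 + i))) * e2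

/-- By Pascal, $S(l+1,M)=S(l,M)+a^{M-2l+1}\{M+1\}S(l,M+1)$. The two terms of $\{M+1\}$ give the new
value and minus the old one, so $M$ must vary in the induction. -/
theorem sum_sumTerm (l M : ℕ) :
    ∑ j ∈ Finset.range (l + 1), sumTerm l M j = a ^ (2 * (l : ℤ) * (M + 1)) := by
  have ha := a_ne_zero
  induction l generalizing M with
  | zero => simp [sumTerm, qBinom_zero_right, tri]
  | succ l ih =>
    have h0 : ∀ l, sumTerm l M 0 = 1 := fun l => by simp [sumTerm, qBinom_zero_right, tri]
    have h1 : ∑ j ∈ Finset.range (l + 1), sumTerm l M (j + 1) + 1 =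
        ∑ j ∈ Finset.range (l + 1), sumTerm l M j := by
      rw [← h0 l, ← Finset.sum_range_succ' (sumTerm l M), Finset.sum_range_succ _ (l + 1)]
      rw [show sumTerm l M (l + 1) = 0 by simp [sumTerm, qBinom_of_lt], add_zero]
    rw [Finset.sum_range_succ', h0, Finset.sum_congr rfl fun j hj =>
      sumTerm_succ M (Nat.lt_succ_iff.1 (Finset.mem_range.1 hj)), Finset.sum_add_distrib,
      add_right_comm, h1, ← Finset.mul_sum, ih, ih, brace, mul_sub, sub_mul, ← zpow_add₀ ha,
      ← zpow_add₀ ha, ← zpow_add₀ ha, ← zpow_add₀ ha]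
    have e1 : (M : ℤ) - 2 * l + 1 + -((M + 1 : ℕ) : ℤ) + 2 * (l : ℤ) * (((M + 1 : ℕ) : ℤ) + 1) =
        2 * (l : ℤ) * (M + 1) := by push_cast; ring
    have e2 : (M : ℤ) - 2 * l + 1 + ((M + 1 : ℕ) : ℤ) + 2 * (l : ℤ) * (((M + 1 : ℕ) : ℤ) + 1) =
        2 * ((l + 1 : ℕ) : ℤ) * (M + 1) := by push_cast; ring
    rw [e1, e2]
    ring

end Skein
end

noncomputable section

namespace Skein

/-! ### The powers of the twist series -/

/-- The coefficients of the product of `R_m` with the twist series. -/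
def stepCoeff (j m : ℕ) : Frac :=
  (-1) ^ j * a ^ (tri j + 2 * m * j + 2 * m * (m + 1)) / braceFactorial j

theorem RVal_add {m j k : ℕ} (h : m + j ≤ k) :
    RVal (m + j) k = RVal m k *
      ((-1) ^ j * (∏ i ∈ Finset.range j, brace (k - m - i)) *
        ∏ i ∈ Finset.range j, brace (k + m + 1 + i)) := by
  rw [RVal_eq_prod, RVal_eq_prod, Finset.prod_range_add]
  congr 1
  have h1 : ∀ i ∈ Finset.range j, algebraMap Scalar Frac (lam (2 * k) - lam (2 * (m + i))) =
      -1 * brace (k - m - i) * brace (k + m + 1 + i) := fun i hi => by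
    have := Finset.mem_range.1 hi
    rw [lam_sub_lam (by omega), show k - (m + i) = k - m - i by omega,
      show k + (m + i) + 1 = k + m + 1 + i by omega]
    ring
  rw [Finset.prod_congr rfl h1, Finset.prod_mul_distrib, Finset.prod_mul_distrib,
    Finset.prod_const, Finset.card_range]

/-- This is $\omega R_m=\sum_j$ `stepCoeff j m` $R_{m+j}$ read at $\lambda_{2k}$. After division by
$R_m(\lambda_{2k})$ it is the summation formula with $l=k-m$ and $M=k+m$. -/
theorem sum_stepCoeff {m k : ℕ} (h : m ≤ k) :
    ∑ j ∈ Finset.range (k + 1 - m), stepCoeff j m * RVal (m + j) k =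
      a ^ (2 * k * (k + 1)) * RVal m k := by
  have ha := a_ne_zero
  obtain ⟨l, rfl⟩ := Nat.exists_eq_add_of_le h
  have hterm : ∀ j ∈ Finset.range (l + 1), stepCoeff j m * RVal (m + j) (m + l) =
      RVal m (m + l) * a ^ (2 * m * (m + 1)) * sumTerm l (m + l + m) j := by
    intro j hj
    have := Finset.mem_range.1 hj
    have hs : ((-1 : Frac) ^ j) * (-1) ^ j = 1 := by rw [← mul_pow]; simp
    have he : a ^ ((tri j : ℤ) + (((m + l + m : ℕ) : ℤ) - l) * j) = a ^ (tri j + 2 * m * j) := by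
      rw [← zpow_natCast]; congr 1; push_cast; ring
    rw [RVal_add (by omega), stepCoeff, sumTerm, qBinom, he, pow_add, Nat.add_sub_cancel_left]
    linear_combination (a ^ (tri j + 2 * m * j) * a ^ (2 * m * (m + 1)) / braceFactorial j *
      RVal m (m + l) * (∏ i ∈ Finset.range j, brace (l - i)) *
        ∏ i ∈ Finset.range j, brace (m + l + m + 1 + i)) * hs
  rw [show m + l + 1 - m = l + 1 by omega, Finset.sum_congr rfl hterm, ← Finset.mul_sum,
    sum_sumTerm, mul_assoc, mul_comm, ← zpow_natCast, ← zpow_natCast, ← zpow_add₀ ha]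
  congr 2
  push_cast; ring

/-- The sum over tuples in the formula for the powers of the twist series. -/
def tupleSum (p n : ℕ) : Frac :=
  ∑ k ∈ Finset.Nat.antidiagonalTuple p n, a ^ phi k * qMultinomial n k

/-- The explicit coefficients of the powers of the twist series. -/
def powCoeff (p : ℕ) : Series := fun n => (-1) ^ n * a ^ tri n * tupleSum p n / braceFactorial n

/-- The outer variable is $m=r_1$, the sum of all entries but the first. -/
theorem sum_antidiagonalTuple_succ (p n : ℕ) (f : (Fin (p + 1) → ℕ) → Frac) :
    ∑ k ∈ Finset.Nat.antidiagonalTuple (p + 1) n, f k =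
      ∑ m ∈ Finset.range (n + 1), ∑ k ∈ Finset.Nat.antidiagonalTuple p m,
        f (Fin.cons (n - m) k) := by
  rw [Finset.sum_sigma']
  refine Finset.sum_bij' (fun k _ => ⟨∑ i, Fin.tail k i, Fin.tail k⟩)
    (fun x _ => Fin.cons (n - x.1) x.2) ?_ ?_ ?_ ?_ ?_
  · intro k hk
    have h := Finset.Nat.mem_antidiagonalTuple.1 hk
    rw [Fin.sum_univ_succ] at h
    simp only [Finset.mem_sigma, Finset.mem_range, Finset.Nat.mem_antidiagonalTuple, and_true]
    simp only [Fin.tail]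
    omega
  · rintro ⟨m, k⟩ h
    simp only [Finset.mem_sigma, Finset.mem_range, Finset.Nat.mem_antidiagonalTuple] at h
    rw [Finset.Nat.mem_antidiagonalTuple, Fin.sum_cons]
    simp only
    omega
  · intro k hk
    have h := Finset.Nat.mem_antidiagonalTuple.1 hk
    rw [Fin.sum_univ_succ] at h
    have : n - ∑ i, Fin.tail k i = k 0 := by simp only [Fin.tail]; omega
    simp only [this, Fin.cons_self_tail]
  · rintro ⟨m, k⟩ h
    simp only [Finset.mem_sigma, Finset.mem_range, Finset.Nat.mem_antidiagonalTuple] at h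
    obtain ⟨-, rfl⟩ := h
    simp only [Fin.tail_cons]
  · intro k hk
    have h := Finset.Nat.mem_antidiagonalTuple.1 hk
    rw [Fin.sum_univ_succ] at h
    have : n - ∑ i, Fin.tail k i = k 0 := by simp only [Fin.tail]; omega
    simp only [this, Fin.cons_self_tail]

theorem tailSum_zero {p : ℕ} (k : Fin p → ℕ) : tailSum k 0 = ∑ i, k i := by
  simp [tailSum]

theorem tailSum_cons_succ {p : ℕ} (x : ℕ) (k : Fin p → ℕ) (i : ℕ) :
    tailSum (Fin.cons x k : Fin (p + 1) → ℕ) (i + 1) = tailSum k i := by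
  simp [tailSum, Fin.sum_univ_succ]

/-- Prepending an entry shifts the tails, so only the term $r_1(r_0+r_1+2)$ is new. For the empty
tuple this term is zero, in agreement with the empty sum. -/
theorem phi_cons {p : ℕ} (x : ℕ) (k : Fin p → ℕ) :
    phi (Fin.cons x k : Fin (p + 1) → ℕ) =
      (∑ i, k i) * (x + (∑ i, k i) + (∑ i, k i) + 2) + phi k := by
  cases p with
  | zero => simp [phi]
  | succ p =>
    have h0 : tailSum (Fin.cons x k : Fin (p + 2) → ℕ) 0 = x + ∑ i, k i := by
      rw [tailSum_zero, Fin.sum_cons]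
    rw [phi, Finset.sum_eq_sum_Ico_succ_bot (by omega), tailSum_cons_succ, Nat.sub_self, h0,
      tailSum_zero, phi]
    congr 1
    rw [← Finset.sum_Ico_add' _ 1 (p + 1) 1]
    refine Finset.sum_congr rfl fun i hi => ?_
    obtain ⟨j, rfl⟩ : ∃ j, i = j + 1 := ⟨i - 1, by have := (Finset.mem_Ico.1 hi).1; omega⟩
    rw [Nat.add_sub_cancel, tailSum_cons_succ, tailSum_cons_succ, Nat.add_sub_cancel]

theorem brace_one_ne_zero : a - a⁻¹ ≠ 0 := by
  have := brace_succ_ne_zero 0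
  simpa [brace] using this

theorem braceFactorial_eq (n : ℕ) : braceFactorial n = (a - a⁻¹) ^ n * qFactorial n := by
  rw [braceFactorial, qFactorial, ← Finset.card_range n, ← Finset.prod_const, Finset.card_range,
    ← Finset.prod_mul_distrib]
  refine Finset.prod_congr rfl fun i _ => ?_
  rw [qInt, mul_div_cancel₀ _ brace_one_ne_zero]
  rfl

theorem qFactorial_ne_zero (n : ℕ) : qFactorial n ≠ 0 := fun h =>
  braceFactorial_ne_zero n (by rw [braceFactorial_eq, h, mul_zero])

theorem qBinom_eq_qFactorial (m j : ℕ) :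
    qBinom (m + j) j = qFactorial (m + j) / (qFactorial j * qFactorial m) := by
  have h := brace_one_ne_zero
  have hj := qFactorial_ne_zero j
  have hm := qFactorial_ne_zero m
  rw [qBinom_eq, braceFactorial_eq, braceFactorial_eq, braceFactorial_eq, pow_add]
  generalize a - a⁻¹ = c at h
  field_simp

theorem qMultinomial_cons {p : ℕ} (m j : ℕ) (k : Fin p → ℕ) :
    qMultinomial (m + j) (Fin.cons j k : Fin (p + 1) → ℕ) =
      qBinom (m + j) j * qMultinomial m k := by
  have hj := qFactorial_ne_zero j
  have hm := qFactorial_ne_zero m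
  have hk : ∏ i, qFactorial (k i) ≠ 0 := Finset.prod_ne_zero_iff.2 fun i _ => qFactorial_ne_zero _
  rw [qMultinomial, qMultinomial, qBinom_eq_qFactorial, Fin.prod_univ_succ]
  simp only [Fin.cons_zero, Fin.cons_succ]
  field_simp

theorem tupleSum_zero (n : ℕ) : tupleSum 0 n = if n = 0 then 1 else 0 := by
  cases n with
  | zero => simp [tupleSum, phi, qMultinomial, qFactorial]
  | succ n => simp [tupleSum]

theorem tupleSum_succ (p n : ℕ) :
    tupleSum (p + 1) n = ∑ m ∈ Finset.range (n + 1),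
      a ^ (m * (n + m + 2)) * qBinom n (n - m) * tupleSum p m := by
  rw [tupleSum, sum_antidiagonalTuple_succ]
  refine Finset.sum_congr rfl fun m hm => ?_
  obtain ⟨j, rfl⟩ := Nat.exists_eq_add_of_le (Nat.lt_succ_iff.1 (Finset.mem_range.1 hm))
  rw [tupleSum, Finset.mul_sum, Nat.add_sub_cancel_left]
  refine Finset.sum_congr rfl fun k hk => ?_
  rw [qMultinomial_cons, phi_cons, Finset.Nat.mem_antidiagonalTuple.1 hk, pow_add,
    show j + m + m + 2 = m + j + m + 2 by omega]
  ring

theorem powCoeff_zero : powCoeff 0 = Series.one := by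
  funext n
  cases n with
  | zero => simp [powCoeff, tupleSum_zero, Series.one, tri, braceFactorial]
  | succ n => simp [powCoeff, tupleSum_zero, Series.one]

/-- Multiplication by the twist series sends $R_m$ to $R_n$ with weight `stepCoeff (n - m) m`. The
exponents match because `tri` is quadratic with cross term $mj$: $m(n+m+2)+mj=2mj+2m(m+1)$ for
$n=m+j$. -/
theorem powCoeff_succ (p n : ℕ) :
    powCoeff (p + 1) n = ∑ m ∈ Finset.range (n + 1), stepCoeff (n - m) m * powCoeff p m := by
  rw [powCoeff, tupleSum_succ, Finset.mul_sum, Finset.sum_div]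
  refine Finset.sum_congr rfl fun m hm => ?_
  obtain ⟨j, rfl⟩ := Nat.exists_eq_add_of_le (Nat.lt_succ_iff.1 (Finset.mem_range.1 hm))
  have hn := braceFactorial_ne_zero (m + j)
  have hj := braceFactorial_ne_zero j
  have hm := braceFactorial_ne_zero m
  rw [Nat.add_sub_cancel_left, qBinom_eq, stepCoeff, powCoeff, tri_add]
  field_simp
  ring

theorem powCoeff_value (p k : ℕ) : (powCoeff p).value k = (a ^ (2 * k * (k + 1))) ^ p := by
  induction p with
  | zero => rw [powCoeff_zero, Series.value_one, pow_zero]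
  | succ p ih =>
    have h1 : (powCoeff (p + 1)).value k = ∑ n ∈ Finset.range (k + 1), ∑ m ∈ Finset.range (n + 1),
        powCoeff p m * (stepCoeff (n - m) m * RVal (m + (n - m)) k) := by
      rw [Series.value]
      refine Finset.sum_congr rfl fun n _ => ?_
      rw [powCoeff_succ, Finset.sum_mul]
      refine Finset.sum_congr rfl fun m hm => ?_
      have := Finset.mem_range.1 hm
      rw [show m + (n - m) = n by omega]
      ring
    -- Reindexing the triangle $m\le n\le k$ by $j=n-m$ exhibits, for each $m$, the expansion of
    -- $\omega R_m$.
    have h2 := Finset.sum_range_diag_flip (k + 1)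
      fun m j => powCoeff p m * (stepCoeff j m * RVal (m + j) k)
    rw [h1, h2, pow_succ, ← ih, Series.value, Finset.sum_mul]
    refine Finset.sum_congr rfl fun m hm => ?_
    rw [← Finset.mul_sum, sum_stepCoeff (Nat.lt_succ_iff.1 (Finset.mem_range.1 hm))]
    ring

theorem tupleSum_mem_range (p n : ℕ) : tupleSum p n ∈ (algebraMap Scalar Frac).range := by
  induction p generalizing n with
  | zero => rw [tupleSum_zero]; split_ifs; exacts [one_mem _, zero_mem _]
  | succ p ih =>
    rw [tupleSum_succ]
    refine sum_mem fun m _ => mul_mem (mul_mem (pow_mem ?_ _) (qBinom_mem_range _ _)) (ih m)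
    exact ⟨_, rfl⟩

/-! ### Identification of the powers of ω, conjugation symmetry and integrality -/

theorem isOmega_powCoeff_one : IsOmega (powCoeff 1) :=
  (isOmega_iff _).2 fun k => by rw [powCoeff_value, pow_one]

/-- Conjugation inverts $a$, so the series used for negative powers does take the inverse values. -/
theorem IsOmega.value_omegaPow {ω : Series} (h : IsOmega ω) (p : ℤ) (k : ℕ) :
    (omegaPow ω p).value k = (a ^ (2 * k * (k + 1))) ^ p := by
  have h1 := (isOmega_iff ω).1 h k
  cases p with
  | ofNat p => rw [omegaPow, Series.value_pow, h1, Int.ofNat_eq_natCast, zpow_natCast]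
  | negSucc p =>
    rw [omegaPow, Series.value_pow, Series.value_conj, h1, map_pow, conj_a, zpow_negSucc, inv_pow,
      inv_pow]

theorem IsOmega.omegaPow_natCast {ω : Series} (h : IsOmega ω) (p : ℕ) :
    omegaPow ω p = powCoeff p :=
  Series.value_injective fun k => by rw [h.value_omegaPow, powCoeff_value, zpow_natCast]

theorem IsOmega.omegaPow_neg {ω : Series} (h : IsOmega ω) (p : ℤ) :
    omegaPow ω (-p) = (omegaPow ω p).conj :=
  Series.value_injective fun k => by
    rw [h.value_omegaPow, Series.value_conj, h.value_omegaPow, map_zpow₀, map_pow, conj_a, inv_pow,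
      inv_zpow, zpow_neg]

/-- Each $\{i\}$ is odd under $a\mapsto a^{-1}$; this is the sole origin of the sign in the symmetry
$p\mapsto-p$. -/
theorem conj_braceFactorial (n : ℕ) : conj (braceFactorial n) = (-1) ^ n * braceFactorial n := by
  have h : ∀ i, conj (brace i) = -1 * brace i := fun i => by
    rw [brace, map_sub, map_zpow₀, map_zpow₀, conj_a, inv_zpow', inv_zpow', neg_neg]; ring
  rw [braceFactorial, map_prod, Finset.prod_congr rfl fun i _ => h (i + 1),
    Finset.prod_mul_distrib, Finset.prod_const, Finset.card_range]

theorem IsOmega.normCoeff_natCast {ω : Series} (h : IsOmega ω) (n p : ℕ) :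
    normCoeff ω n p = (-1) ^ n * a ^ (n * (n + 3) / 2) * tupleSum p n := by
  rw [normCoeff, h.omegaPow_natCast, powCoeff, mul_div_cancel₀ _ (braceFactorial_ne_zero n)]
  rfl

theorem IsOmega.normCoeff_neg {ω : Series} (h : IsOmega ω) (n : ℕ) (p : ℤ) :
    normCoeff ω n (-p) = (-1) ^ n * conj (normCoeff ω n p) := by
  have hs : ((-1 : Frac) ^ n) * (-1) ^ n = 1 := by rw [← mul_pow]; simp
  rw [normCoeff, normCoeff, map_mul, conj_braceFactorial, h.omegaPow_neg, ← mul_assoc, ← mul_assoc,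
    hs, one_mul]
  rfl

theorem IsOmega.normCoeff_natCast_mem_range {ω : Series} (h : IsOmega ω) (n p : ℕ) :
    normCoeff ω n p ∈ (algebraMap Scalar Frac).range := by
  rw [h.normCoeff_natCast]
  exact mul_mem (mul_mem (pow_mem (neg_mem (one_mem _)) _) (pow_mem (RingHom.mem_range_self _ _) _))
    (tupleSum_mem_range p n)

theorem IsOmega.normCoeff_mem_range {ω : Series} (h : IsOmega ω) (n : ℕ) (p : ℤ) :
    normCoeff ω n p ∈ (algebraMap Scalar Frac).range := by
  obtain ⟨q, rfl | rfl⟩ := p.eq_nat_or_neg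
  · exact h.normCoeff_natCast_mem_range n q
  · rw [h.normCoeff_neg]
    refine mul_mem (pow_mem (neg_mem (one_mem _)) _) ?_
    obtain ⟨f, hf⟩ := h.normCoeff_natCast_mem_range n q
    exact ⟨LaurentPolynomial.invert f, by rw [← hf, conj_algebraMap]⟩

theorem IsOmega.mul_conj {ω : Series} (h : IsOmega ω) : ω.mul ω.conj = Series.one :=
  Series.value_injective fun k => by
    rw [Series.value_mul, Series.value_conj, (isOmega_iff ω).1 h, map_pow, conj_a, inv_pow,
      Series.value_one, mul_inv_cancel₀ (pow_ne_zero _ a_ne_zero)]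

end Skein

end

theorem mainTheorem3 :
    (∃! ω : Skein.Series, Skein.IsOmega ω) ∧
    ∀ ω : Skein.Series, Skein.IsOmega ω →
      ω.mul ω.conj = Skein.Series.one ∧
      (∀ p : ℕ, 1 ≤ p → ∀ n : ℕ,
        Skein.normCoeff ω n (p : ℤ) =
          (-1) ^ n * Skein.a ^ (n * (n + 3) / 2) *
            ∑ k ∈ Finset.Nat.antidiagonalTuple p n,
              Skein.a ^ Skein.phi k * Skein.qMultinomial n k) ∧
      (∀ (p : ℤ) (n : ℕ),
        Skein.normCoeff ω n (-p) = (-1) ^ n * Skein.conj (Skein.normCoeff ω n p)) ∧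
      (∀ (p : ℤ) (n : ℕ),
        ∃ f : LaurentPolynomial ℤ,
          algebraMap (LaurentPolynomial ℤ) (FractionRing (LaurentPolynomial ℤ)) f =
            Skein.normCoeff ω n p) := by
  refine ⟨⟨Skein.powCoeff 1, Skein.isOmega_powCoeff_one, fun ω h => ?_⟩, fun ω h =>
    ⟨h.mul_conj, fun p _ n => h.normCoeff_natCast n p, fun p n => h.normCoeff_neg n p,
      fun p n => h.normCoeff_mem_range n p⟩⟩
  refine Skein.Series.value_injective fun k => ?_
  rw [(Skein.isOmega_iff ω).1 h, (Skein.isOmega_iff _).1 Skein.isOmega_powCoeff_one]
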